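/- Let $\Sigma$ be a signature: a set of generators $\psi$, each with an arity, i.e. a finite word $p_1\cdots p_k$ in the two directions "output" and "input". Let $\mathcal C$ be the free (strict) compact closed category on one object $X$ and a morphism $\psi : I \to X_1\otimes\cdots\otimes X_k$ for each generator, where $X_i = X$ if $p_i$ is an output and $X_i = X^*$ if $p_i$ is an input. Explicitly, its objects are finite lists in $X, X^*$, and its morphisms are the well-typed expressions in $\circ$, $\otimes$, identities, symmetries, the cup $\eta_X : I \to X\otimes X^*$, the cap $\epsilon_X : X^*\otimes X\to I$ and the generators, modulo the axioms of strict symmetric monoidal categories and the two snake equations for $\eta_X,\epsilon_X$. Fix a set of edge names containing distinct canonical names $x_1, x_2, \ldots$. Each name $a$ gives an output edge $\hat a$ and an input edge $\check a$. *Tensor expressions* are built from the empty tensor $1$, identity tensors $1_{\hat a\check b}$, generators $\psi_{e_1\cdots e_k}$ whose directed edges $e_1,\dots,e_k$ match the arity of $\psi$, and products $GH$, where every directed edge may occur at most once in an expression. A name is *bound* in $G$ if it occurs as both an output and an input; a directed edge of $G$ whose name is not bound is *free*. Let $\equiv$ be the least equivalence relation on tensor expressions such that $(GH)K\equiv G(HK)$,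 $GH\equiv HG$, $G1\equiv G$; $G\equiv G'$ if $G'$ is $G$ with a bound name replaced by a name that does not occur in $G$; $G\,1_{\hat b\check a}\equiv G[\check b\mapsto\check a]$ if $\check b$ is free in $G$; $H\,1_{\hat a\check b}\equiv H[\hat b\mapsto\hat a]$ if $\hat b$ is free in $H$; and $GK\equiv HK$ whenever $G\equiv H$ (all expressions being well formed). A tensor expression is *canonically named* if for some $N$ its free edges consist of exactly one of $\hat x_i,\check x_i$ for each $1\le i\le N$; its boundary is the list $w = X_1\otimes\cdots\otimes X_N$ with $X_i = X$ if $\hat x_i$ is free and $X_i = X^*$ if $\check x_i$ is free. *Canonically named tensors* are the $\equiv$-classes of canonically named tensor expressions. A *normal form* of a canonically named expression $G$ with boundary $w$ is a morphism expression $$(1_w\otimes\epsilon_X\otimes\cdots\otimes\epsilon_X)\circ\sigma\circ(\psi^1\otimes\cdots\otimes\psi^m) : I\to w,$$ where $\psi^1,\dots,\psi^m$ are the atoms of $G$ in order of occurrence (an identity tensor being read as $\eta_X$ and $1$ as $1_I$), the caps correspond to the bound names $a_1,\ldots,a_k$ of $G$ listed in any order without repetition, and $\sigma$ is a map consisting just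 of symmetries and identities that connects each wire of $\psi^1\otimes\cdots\otimes\psi^m$ to the wire with the same label, the $i$-th outer wire being labelled by the free edge named $x_i$ and the wires of the $j$-th cap by $\check a_j,\hat a_j$. **Theorem.** There is a bijection $\Phi$ from the set of canonically named tensors to the set of all points $I\to w$ of $\mathcal C$ ($w$ ranging over all objects) such that every canonically named expression $G$ has a normal form, every normal form of $G$ denotes the point $\Phi([G])$, and every point of $\mathcal C$ is denoted by a normal form of some canonically named expression. -/

import Mathlib

universe u v

namespace TensorCC

/-- The two directions of an edge. `out` is an output (written with a hat, of type `X`);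
`inp` is an input (written with a check, of type `X*`). -/
inductive Pol : Type
  | out
  | inp

/-- The opposite direction. -/
def Pol.flip : Pol → Pol
  | .out => .inp
  | .inp => .out

/-- A signature: a set of generators, each with a fixed finite arity, a word of outputs and inputs.
A generator of arity `p₁ … pₙ` stands for a generating point `I → X₁ ⊗ … ⊗ Xₙ`, with `Xᵢ = X` for
an output and `Xᵢ = X*` for an input. -/
structure Signature where
  Gen : Type u
  arity : Gen → List Pol

/-! ### The free compact closed category on a signature -/

/-- Formal expressions for the morphisms. Objects are lists of `X` (`Pol.out`) and `X*` (`Pol.inp`),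
the tensor product of objects is concatenation and the unit `I` is the empty list. Composition is
written in diagrammatic order: `comp f g` is `g ∘ f`. -/
inductive Term (S : Signature.{u}) : Type u
  | id (a : List Pol)
  | comp (f g : Term S)
  | tens (f g : Term S)
  | symm (a b : List Pol)
  | cup
  | cap
  | gen (φ : S.Gen)

/-- `HasType f a b` : the expression `f` is a well-formed morphism `a → b`. -/
inductive HasType {S : Signature.{u}} : Term S → List Pol → List Pol → Prop
  | id (a : List Pol) : HasType (.id a) a a
  | comp {f g : Term S} {a b c : List Pol} :
      HasType f a b → HasType g b c → HasType (.comp f g) a c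
  | tens {f g : Term S} {a b a' b' : List Pol} :
      HasType f a a' → HasType g b b' → HasType (.tens f g) (a ++ b) (a' ++ b')
  | symm (a b : List Pol) : HasType (.symm a b) (a ++ b) (b ++ a)
  | cup : HasType .cup [] [.out, .inp]
  | cap : HasType .cap [.inp, .out] []
  | gen (φ : S.Gen) : HasType (.gen φ) [] (S.arity φ)

/-- `Eqv a b f g` : the expressions `f, g : a → b` are equal by the axioms of a strict symmetric
monoidal category in which `X*` is dual to `X` with unit `cup : I → X ⊗ X*` and counit
`cap : X* ⊗ X → I`. It is the congruence generated by these axioms. -/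
inductive Eqv {S : Signature.{u}} : List Pol → List Pol → Term S → Term S → Prop
  -- equivalence relation and congruence
  | refl {a b : List Pol} {f : Term S} : HasType f a b → Eqv a b f f
  | sym {a b : List Pol} {f g : Term S} : Eqv a b f g → Eqv a b g f
  | trans {a b : List Pol} {f g h : Term S} : Eqv a b f g → Eqv a b g h → Eqv a b f h
  | comp_congr {a b c : List Pol} {f f' g g' : Term S} :
      Eqv a b f f' → Eqv b c g g' → Eqv a c (.comp f g) (.comp f' g')
  | tens_congr {a b a' b' : List Pol} {f f' g g' : Term S} :
      Eqv a a' f f' → Eqv b b' g g' → Eqv (a ++ b) (a' ++ b') (.tens f g) (.tens f' g')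
  -- category
  | id_comp {a b : List Pol} {f : Term S} : HasType f a b → Eqv a b (.comp (.id a) f) f
  | comp_id {a b : List Pol} {f : Term S} : HasType f a b → Eqv a b (.comp f (.id b)) f
  | assoc {a b c d : List Pol} {f g h : Term S} :
      HasType f a b → HasType g b c → HasType h c d →
      Eqv a d (.comp (.comp f g) h) (.comp f (.comp g h))
  -- strict monoidal category
  | tens_id (a b : List Pol) : Eqv (a ++ b) (a ++ b) (.tens (.id a) (.id b)) (.id (a ++ b))
  | interchange {a b c a' b' c' : List Pol} {f g f' g' : Term S} :
      HasType f a b → HasType g b c → HasType f' a' b' → HasType g' b' c' →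
      Eqv (a ++ a') (c ++ c') (.comp (.tens f f') (.tens g g')) (.tens (.comp f g) (.comp f' g'))
  | tens_assoc {a b c a' b' c' : List Pol} {f g h : Term S} :
      HasType f a a' → HasType g b b' → HasType h c c' →
      Eqv (a ++ b ++ c) (a' ++ b' ++ c') (.tens (.tens f g) h) (.tens f (.tens g h))
  | unit_tens {a b : List Pol} {f : Term S} : HasType f a b → Eqv a b (.tens (.id []) f) f
  | tens_unit {a b : List Pol} {f : Term S} : HasType f a b → Eqv a b (.tens f (.id [])) f
  -- symmetry
  | symm_natural {a b a' b' : List Pol} {f g : Term S} :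
      HasType f a a' → HasType g b b' →
      Eqv (a ++ b) (b' ++ a') (.comp (.tens f g) (.symm a' b')) (.comp (.symm a b) (.tens g f))
  | symm_symm (a b : List Pol) :
      Eqv (a ++ b) (a ++ b) (.comp (.symm a b) (.symm b a)) (.id (a ++ b))
  | hexagon (a b c : List Pol) :
      Eqv (a ++ (b ++ c)) ((b ++ c) ++ a) (.symm a (b ++ c))
        (.comp (.tens (.symm a b) (.id c)) (.tens (.id b) (.symm a c)))
  -- compactness
  | snake :
      Eqv [.out] [.out] (.comp (.tens .cup (.id [.out])) (.tens (.id [.out]) .cap)) (.id [.out])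
  | snake' :
      Eqv [.inp] [.inp] (.comp (.tens (.id [.inp]) .cup) (.tens .cap (.id [.inp]))) (.id [.inp])

/-- Morphism expressions `a → b` up to the axioms. -/
instance homSetoid (S : Signature.{u}) (a b : List Pol) :
    Setoid {f : Term S // HasType f a b} where
  r f g := Eqv a b f.1 g.1
  iseqv := ⟨fun f => .refl f.2, fun h => .sym h, fun h k => .trans h k⟩

/-- The objects of the free compact closed category on `S`: lists in `X` and `X*`. -/
structure FreeCC (S : Signature.{u}) : Type where
  word : List Pol

/-- The free compact closed category on `S`: morphisms are well-typed expressions modulo the strict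
monoidal compact closed axioms. -/
instance FreeCC.category (S : Signature.{u}) : CategoryTheory.Category.{u} (FreeCC S) where
  Hom A B := Quotient (homSetoid S A.word B.word)
  id A := Quotient.mk _ ⟨.id A.word, .id _⟩
  comp f g := Quotient.map₂ (fun s t => ⟨.comp s.1 t.1, .comp s.2 t.2⟩)
    (fun _ _ h _ _ k => Eqv.comp_congr h k) f g
  id_comp := by
    rintro A B ⟨f⟩
    exact Quotient.sound (Eqv.id_comp f.2)
  comp_id := by
    rintro A B ⟨f⟩
    exact Quotient.sound (Eqv.comp_id f.2)
  assoc := by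
    rintro A B C D ⟨f⟩ ⟨g⟩ ⟨h⟩
    exact Quotient.sound (Eqv.assoc f.2 g.2 h.2)

/-- The points `I → w` of the free compact closed category. -/
abbrev Point (S : Signature.{u}) (w : List Pol) : Type u :=
  (FreeCC.mk [] : FreeCC S) ⟶ (FreeCC.mk w : FreeCC S)

/-- The point denoted by a well-typed expression. -/
def Point.mk {S : Signature.{u}} {w : List Pol} (f : Term S) (h : HasType f [] w) : Point S w :=
  Quotient.mk (homSetoid S [] w) ⟨f, h⟩

/-! ### Tensor expressions and tensors -/

/-- A directed edge: a name together with a direction. -/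
structure Edge (Name : Type v) : Type v where
  pol : Pol
  name : Name

/-- The same name with the other direction. -/
def Edge.flip {Name : Type v} (e : Edge Name) : Edge Name := ⟨e.pol.flip, e.name⟩

/-- Tensor expressions, before imposing the conditions on names. `ident a b` is the identity tensor
with output `a` and input `b`. -/
inductive Expr (S : Signature.{u}) (Name : Type v) : Type (max u v)
  | one
  | ident (a b : Name)
  | gen (φ : S.Gen) (es : List (Edge Name))
  | mul (G H : Expr S Name)

namespace Expr

variable {S : Signature.{u}} {Name : Type v}

/-- The directed edges of an expression, in order of occurrence. -/
def edges : Expr S Name → List (Edge Name)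
  | one => []
  | ident a b => [⟨.out, a⟩, ⟨.inp, b⟩]
  | gen _ es => es
  | mul G H => G.edges ++ H.edges

/-- The names on each generator match its arity. -/
def AritiesMatch : Expr S Name → Prop
  | one => True
  | ident _ _ => True
  | gen φ es => es.map Edge.pol = S.arity φ
  | mul G H => G.AritiesMatch ∧ H.AritiesMatch

/-- A tensor expression proper: arities match and each directed edge occurs at most once. -/
def WF (G : Expr S Name) : Prop := G.AritiesMatch ∧ G.edges.Nodup

/-- A free directed edge: it occurs, and its name does not occur in the other direction. -/
def IsFree (G : Expr S Name) (e : Edge Name) : Prop := e ∈ G.edges ∧ e.flip ∉ G.edges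

/-- A bound name: it occurs in both directions. -/
def IsBound (G : Expr S Name) (a : Name) : Prop :=
  (⟨.out, a⟩ : Edge Name) ∈ G.edges ∧ (⟨.inp, a⟩ : Edge Name) ∈ G.edges

/-- Renaming of directed edges, keeping directions. -/
def rename (r : Pol → Name → Name) : Expr S Name → Expr S Name
  | one => one
  | ident a b => ident (r .out a) (r .inp b)
  | gen φ es => gen φ (es.map fun e => ⟨e.pol, r e.pol e.name⟩)
  | mul G H => mul (G.rename r) (H.rename r)

open Classical in
/-- `G[e ↦ a]`: give the directed edge `e` the name `a`, in its own direction only. -/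
noncomputable def substEdge (G : Expr S Name) (e : Edge Name) (a : Name) : Expr S Name :=
  G.rename fun p n => if (⟨p, n⟩ : Edge Name) = e then a else n

open Classical in
/-- Replace the name `a` by the name `b`, in both directions. -/
noncomputable def substName (G : Expr S Name) (a b : Name) : Expr S Name :=
  G.rename fun _ n => if n = a then b else n

/-- Equivalence of tensor expressions. -/
inductive Equiv : Expr S Name → Expr S Name → Prop
  | refl {G : Expr S Name} : WF G → Equiv G G
  | symm {G H : Expr S Name} : Equiv G H → Equiv H G
  | trans {G H K : Expr S Name} : Equiv G H → Equiv H K → Equiv G K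
  | mul_congr {G H K : Expr S Name} :
      Equiv G H → WF (mul G K) → WF (mul H K) → Equiv (mul G K) (mul H K)
  | assoc {G H K : Expr S Name} :
      WF (mul (mul G H) K) → Equiv (mul (mul G H) K) (mul G (mul H K))
  | comm {G H : Expr S Name} : WF (mul G H) → Equiv (mul G H) (mul H G)
  | mul_one {G : Expr S Name} : WF G → Equiv (mul G one) G
  | rename_bound {G : Expr S Name} {a b : Name} :
      WF G → IsBound G a → (∀ p, (⟨p, b⟩ : Edge Name) ∉ G.edges) → Equiv G (G.substName a b)
  | contract_inp {G : Expr S Name} {a b : Name} :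
      WF (mul G (ident b a)) → IsFree G ⟨.inp, b⟩ →
      Equiv (mul G (ident b a)) (G.substEdge ⟨.inp, b⟩ a)
  | contract_out {H : Expr S Name} {a b : Name} :
      WF (mul H (ident a b)) → IsFree H ⟨.out, b⟩ →
      Equiv (mul H (ident a b)) (H.substEdge ⟨.out, b⟩ a)

/-- Canonically named: for some `N`, for each `i < N` exactly one of the two directed edges named
`x i` is free, and these are all the free edges. (The names are indexed from `0`.) -/
def IsCanonical (x : ℕ ↪ Name) (G : Expr S Name) : Prop :=
  ∃ N : ℕ, (∀ i < N, ∃! p : Pol, G.IsFree ⟨p, x i⟩) ∧ ∀ e, G.IsFree e → ∃ i < N, e.name = x i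

/-- Canonically named tensor expressions. -/
def CanonExpr (S : Signature.{u}) (x : ℕ ↪ Name) : Type (max u v) :=
  {G : Expr S Name // G.WF ∧ G.IsCanonical x}

/-- `≡` on canonically named tensor expressions. -/
instance canonSetoid (S : Signature.{u}) (x : ℕ ↪ Name) : Setoid (CanonExpr S x) where
  r G H := Equiv G.1 H.1
  iseqv := ⟨fun G => .refl G.2.1, fun h => .symm h, fun h k => .trans h k⟩

/-- Canonically named tensors: canonically named tensor expressions modulo `≡`. -/
def CanonTensor (S : Signature.{u}) (x : ℕ ↪ Name) : Type (max u v) :=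
  Quotient (canonSetoid S x)

/-! ### The normal form of a tensor expression -/

/-- The tensor product of the atoms of an expression, from left to right, an identity tensor being
read as a cup and the empty tensor as the identity of `I`. -/
def base : Expr S Name → Term S
  | one => .id []
  | ident _ _ => .cup
  | gen φ _ => .gen φ
  | mul G H => .tens G.base H.base

end Expr

section NormalForm

variable {S : Signature.{u}} {Name : Type v}

/-- `Rewiring l m σ` : `σ` consists just of symmetries and identities, and connects each wire of `l`
to the wire of `m` labelled by the same directed edge. If the labels in `l` are distinct, they
determine the permutation of the wires that underlies `σ`. -/
inductive Rewiring : List (Edge Name) → List (Edge Name) → Term S → Prop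
  | id (l : List (Edge Name)) : Rewiring l l (.id (l.map Edge.pol))
  | symm (l m : List (Edge Name)) :
      Rewiring (l ++ m) (m ++ l) (.symm (l.map Edge.pol) (m.map Edge.pol))
  | comp {l m n : List (Edge Name)} {σ τ : Term S} :
      Rewiring l m σ → Rewiring m n τ → Rewiring l n (.comp σ τ)
  | tens {l m l' m' : List (Edge Name)} {σ τ : Term S} :
      Rewiring l l' σ → Rewiring m m' τ → Rewiring (l ++ m) (l' ++ m') (.tens σ τ)

/-- The canonically named directed edges with directions `w`, in order. -/
def boundary (x : ℕ ↪ Name) (w : List Pol) : List (Edge Name) :=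
  w.mapIdx fun i p => ⟨p, x i⟩

/-- The wires entering the caps of the bound names `as`, in order. -/
def capEdges : List Name → List (Edge Name)
  | [] => []
  | a :: as => ⟨.inp, a⟩ :: ⟨.out, a⟩ :: capEdges as

/-- `cap ⊗ … ⊗ cap`, with `k` factors. -/
def caps : ℕ → Term S
  | 0 => .id []
  | k + 1 => .tens .cap (caps k)

/-- The choices made in writing down the normal form of the expression `G`, as a point of type `w`:
an enumeration of the bound names, and a map of symmetries and identities that connects the wires of
the atoms of `G` to the canonically named outer wires, followed by the caps of the bound names. -/
structure NormalForm (x : ℕ ↪ Name) (G : Expr S Name) (w : List Pol) where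
  bound : List Name
  bound_nodup : bound.Nodup
  mem_bound : ∀ a, a ∈ bound ↔ G.IsBound a
  σ : Term S
  rewiring : Rewiring G.edges (boundary x w ++ capEdges bound) σ

/-- Generators and cups at the bottom, then a permutation, then identities and caps. -/
def NormalForm.term {x : ℕ ↪ Name} {G : Expr S Name} {w : List Pol} (d : NormalForm x G w) :
    Term S :=
  .comp G.base (.comp d.σ (.tens (.id w) (caps d.bound.length)))

theorem hasType_base (G : Expr S Name) (hG : G.AritiesMatch) :
    HasType G.base [] (G.edges.map Edge.pol) := by
  induction G with
  | one => exact .id []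
  | ident a b => exact .cup
  | gen φ es =>
    have h : es.map Edge.pol = S.arity φ := hG
    simpa only [Expr.edges, Expr.base, h] using HasType.gen φ
  | mul G H ihG ihH =>
    simpa only [Expr.edges, Expr.base, List.map_append, List.append_nil] using HasType.tens (ihG hG.1) (ihH hG.2)

theorem Rewiring.hasType {l m : List (Edge Name)} {σ : Term S} (h : Rewiring l m σ) :
    HasType σ (l.map Edge.pol) (m.map Edge.pol) := by
  induction h with
  | id l => exact .id _
  | symm l m => simpa only [List.map_append] using HasType.symm _ _
  | comp _ _ ih ih' => exact .comp ih ih'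
  | tens _ _ ih ih' => simpa only [List.map_append] using HasType.tens ih ih'

theorem map_pol_boundary (x : ℕ ↪ Name) (w : List Pol) : (boundary x w).map Edge.pol = w := by
  apply List.ext_getElem <;> simp [boundary]

theorem hasType_caps (as : List Name) :
    HasType (caps as.length : Term S) ((capEdges as).map Edge.pol) [] := by
  induction as with
  | nil => exact .id []
  | cons a as ih => exact HasType.tens .cap ih

theorem NormalForm.hasType {x : ℕ ↪ Name} {G : Expr S Name} {w : List Pol} (d : NormalForm x G w)
    (hG : G.WF) : HasType d.term [] w := by
  refine .comp (hasType_base G hG.1) (.comp d.rewiring.hasType ?_)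
  have h := HasType.tens (.id w) (hasType_caps (S := S) d.bound)
  rwa [List.append_nil, ← congrArg (· ++ _) (map_pol_boundary x w), ← List.map_append] at h

/-- The point that a normal form of `G` denotes. -/
def NormalForm.point {x : ℕ ↪ Name} {G : Expr S Name} {w : List Pol} (d : NormalForm x G w)
    (hG : G.WF) : Point S w :=
  Point.mk d.term (d.hasType hG)

end NormalForm

end TensorCC

/-!
Tensors are turned into points by contracting labelled wires, points into tensors by naming the wires
of a morphism expression, and these two passages are shown to be inverse to each other.

*From tensors to points.* A contraction `Contr l m c` is a morphism made of symmetries and of caps on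
pairs of wires with the same name. Coherence for symmetric monoidal categories (`Wiring.unique`) and
the fact that caps commute past each other show that it depends only on the labels when these are
distinct (`Contr.unique`), so the normal form of `G` denotes `c ∘ G.base` for the unique contraction
`c` of the wires of the atoms to the boundary.
This point is invariant under the equivalence of expressions (`Expr.Equiv.sound`): the laws of a
commutative monoid permute the atoms, and contracting an identity tensor is one of the snake
equations.

*From morphisms to tensors.* The relation `Expr.Rep f A B K` interprets a morphism expression `f` as a
tensor `K`, whose free edges are the targets `B` and the opposites of the sources `A`. A composite is
interpreted by a product in which the edges in the middle have become bound, and identities,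
symmetries, the cup and the cap by products of identity tensors. Every well-typed expression has such
a tensor, unique up to equivalence (`Expr.exists_rep`, `Expr.Rep.unique`); here the infinitely many
names are needed, to choose those in the middle. Each axiom of compact closed categories holds for
this interpretation (`Expr.rep_iff_of_eqv`): the axioms for composition amount to the commutative
monoid laws, and those for identities, symmetries and the snakes to contractions of identity tensors.

*The two are inverse.* The normal form of `G` is interpreted by `G` itself (`Expr.rep_normalForm`), so
expressions whose normal forms denote the same point are equivalent. Conversely a morphism is
recovered from a tensor that interprets it, by bending the inputs down and contracting
(`Expr.Rep.eq_contr`, by induction on the morphism, each case being independent of the representing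
expression by soundness). Hence two morphism expressions with the same tensor are equal
(`Expr.Rep.eqv`), and every point is denoted by the normal form of a tensor that interprets it.
-/

namespace TensorCC

/-! ### Morphisms with total operations -/

section Mor

variable {S : Signature.{u}}

/-- The source of an expression, also when it is ill-typed. -/
def Term.dom : Term S → List Pol
  | .id a => a
  | .comp f _ => f.dom
  | .tens f g => f.dom ++ g.dom
  | .symm a b => a ++ b
  | .cup => []
  | .cap => [.inp, .out]
  | .gen _ => []

/-- The target of an expression, also when it is ill-typed. -/
def Term.cod : Term S → List Pol
  | .id a => a
  | .comp _ g => g.cod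
  | .tens f g => f.cod ++ g.cod
  | .symm a b => b ++ a
  | .cup => [.out, .inp]
  | .cap => []
  | .gen φ => S.arity φ

/-- All composites inside the expression match. -/
def Term.Typed : Term S → Prop
  | .comp f g => f.Typed ∧ g.Typed ∧ f.cod = g.dom
  | .tens f g => f.Typed ∧ g.Typed
  | _ => True

theorem hasType_iff {f : Term S} {a b : List Pol} :
    HasType f a b ↔ f.Typed ∧ f.dom = a ∧ f.cod = b := by
  constructor
  · intro h
    induction h <;> simp_all [Term.Typed, Term.dom, Term.cod]
  · rintro ⟨h, rfl, rfl⟩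
    induction f with
    | id a => exact .id a
    | comp f g ihf ihg => exact .comp (h.2.2 ▸ ihf h.1) (ihg h.2.1)
    | tens f g ihf ihg => exact .tens (ihf h.1) (ihg h.2)
    | symm a b => exact .symm a b
    | cup => exact .cup
    | cap => exact .cap
    | gen φ => exact .gen φ

theorem HasType.dom_eq {f : Term S} {a b : List Pol} (h : HasType f a b) : f.dom = a :=
  (hasType_iff.1 h).2.1

theorem HasType.cod_eq {f : Term S} {a b : List Pol} (h : HasType f a b) : f.cod = b :=
  (hasType_iff.1 h).2.2

theorem Term.Typed.hasType {f : Term S} (h : f.Typed) : HasType f f.dom f.cod :=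
  hasType_iff.2 ⟨h, rfl, rfl⟩

theorem Eqv.hasType {a b : List Pol} {f g : Term S} (h : Eqv a b f g) :
    HasType f a b ∧ HasType g a b := by
  induction h with
  | refl h => exact ⟨h, h⟩
  | sym _ ih => exact ih.symm
  | trans _ _ ih ih' => exact ⟨ih.1, ih'.2⟩
  | comp_congr _ _ ih ih' => exact ⟨.comp ih.1 ih'.1, .comp ih.2 ih'.2⟩
  | tens_congr _ _ ih ih' => exact ⟨.tens ih.1 ih'.1, .tens ih.2 ih'.2⟩
  | id_comp h => exact ⟨.comp (.id _) h, h⟩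
  | comp_id h => exact ⟨.comp h (.id _), h⟩
  | assoc h k l => exact ⟨.comp (.comp h k) l, .comp h (.comp k l)⟩
  | tens_id a b => exact ⟨.tens (.id _) (.id _), .id _⟩
  | interchange h k h' k' =>
    exact ⟨.comp (.tens h h') (.tens k k'), .tens (.comp h k) (.comp h' k')⟩
  | tens_assoc h k l =>
    exact ⟨.tens (.tens h k) l, by simpa only [List.append_assoc] using HasType.tens h (.tens k l)⟩
  | unit_tens h => exact ⟨.tens (.id []) h, h⟩
  | tens_unit h => exact ⟨by simpa only [List.append_nil] using HasType.tens h (.id []), h⟩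
  | symm_natural h k => exact ⟨.comp (.tens h k) (.symm _ _), .comp (.symm _ _) (.tens k h)⟩
  | symm_symm a b => exact ⟨.comp (.symm _ _) (.symm _ _), .id _⟩
  | hexagon a b c =>
    refine ⟨.symm _ _, .comp (b := b ++ a ++ c) ?_ ?_⟩
    · simpa only [List.append_assoc] using HasType.tens (HasType.symm a b) (HasType.id (S := S) c)
    · simpa only [List.append_assoc] using HasType.tens (HasType.id (S := S) b) (HasType.symm a c)
  | snake => exact ⟨.comp (.tens .cup (.id [.out])) (.tens (.id [.out]) .cap), .id _⟩
  | snake' => exact ⟨.comp (.tens (.id [.inp]) .cup) (.tens .cap (.id [.inp])), .id _⟩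

/-- Equality of expressions by the axioms, extended to all expressions by identifying ill-typed ones
that have the same source and target. This extension is a congruence for `comp` and `tens` without
any typing conditions. -/
instance termSetoid (S : Signature.{u}) : Setoid (Term S) where
  r f g := f.dom = g.dom ∧ f.cod = g.cod ∧ (f.Typed ↔ g.Typed) ∧ (f.Typed → Eqv f.dom f.cod f g)
  iseqv := by
    refine ⟨fun f => ⟨rfl, rfl, .rfl, fun h => .refl h.hasType⟩, ?_, ?_⟩
    · rintro f g ⟨h₁, h₂, h₃, h₄⟩
      exact ⟨h₁.symm, h₂.symm, h₃.symm, fun h => h₁ ▸ h₂ ▸ (h₄ (h₃.2 h)).sym⟩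
    · rintro f g k ⟨h₁, h₂, h₃, h₄⟩ ⟨k₁, k₂, k₃, k₄⟩
      exact ⟨h₁.trans k₁, h₂.trans k₂, h₃.trans k₃,
        fun h => (h₄ h).trans (by rw [h₁, h₂]; exact k₄ (h₃.1 h))⟩

/-- The morphisms of the free compact closed category, as a one-sorted algebra: composition and
tensor product are total, and every equation holds as soon as the sources and targets match. -/
def Mor (S : Signature.{u}) : Type u := Quotient (termSetoid S)

namespace Mor

/-- The morphism denoted by an expression. -/
def mk (f : Term S) : Mor S := Quotient.mk _ f

theorem mk_eq_of_eqv {a b : List Pol} {f g : Term S} (h : Eqv a b f g) : mk f = mk g := by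
  obtain ⟨hf, hg⟩ := h.hasType
  rw [hasType_iff] at hf hg
  refine Quotient.sound ⟨hf.2.1.trans hg.2.1.symm, hf.2.2.trans hg.2.2.symm,
    iff_of_true hf.1 hg.1, fun _ => ?_⟩
  rwa [hf.2.1, hf.2.2]

theorem eqv_of_mk_eq {a b : List Pol} {f g : Term S} (hf : HasType f a b) (h : mk f = mk g) :
    Eqv a b f g := by
  obtain ⟨ht, rfl, rfl⟩ := hasType_iff.1 hf
  exact (Quotient.exact h).2.2.2 ht

/-- Two expressions with the same source and target denote the same morphism if they are equal by
the axioms whenever they are well-typed. -/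
theorem mk_eq {f g : Term S} (h₁ : f.dom = g.dom) (h₂ : f.cod = g.cod) (h₃ : f.Typed ↔ g.Typed)
    (h₄ : f.Typed → g.Typed → mk f = mk g) : mk f = mk g :=
  Quotient.sound ⟨h₁, h₂, h₃, fun h => eqv_of_mk_eq h.hasType (h₄ h (h₃.1 h))⟩

/-- Composition in diagrammatic order. -/
def comp (f g : Mor S) : Mor S :=
  Quotient.map₂ Term.comp (by
    rintro f f' ⟨h₁, h₂, h₃, h₄⟩ g g' ⟨k₁, k₂, k₃, k₄⟩
    refine ⟨h₁, k₂, by simp only [Term.Typed, h₃, k₃, h₂, k₁], fun h => ?_⟩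
    exact .comp_congr (h₄ h.1) (by rw [h.2.2]; exact k₄ h.2.1)) f g

/-- The tensor product of morphisms. -/
def tens (f g : Mor S) : Mor S :=
  Quotient.map₂ Term.tens (by
    rintro f f' ⟨h₁, h₂, h₃, h₄⟩ g g' ⟨k₁, k₂, k₃, k₄⟩
    refine ⟨by simp only [Term.dom, h₁, k₁], by simp only [Term.cod, h₂, k₂],
      by simp only [Term.Typed, h₃, k₃], fun h => ?_⟩
    exact .tens_congr (h₄ h.1) (k₄ h.2)) f g

infixr:70 " ≫ₘ " => Mor.comp
infixr:75 " ⊗ₘ " => Mor.tens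

/-- The identity of a word. -/
def id (a : List Pol) : Mor S := mk (.id a)
/-- The symmetry of two words. -/
def symm (a b : List Pol) : Mor S := mk (.symm a b)
/-- The unit `I → X ⊗ X*`. -/
def cup : Mor S := mk .cup
/-- The counit `X* ⊗ X → I`. -/
def cap : Mor S := mk .cap
/-- The source of a morphism. -/
def dom (f : Mor S) : List Pol :=
  Quotient.lift (s := termSetoid S) Term.dom (fun _ _ h => And.left h) f
/-- The target of a morphism. -/
def cod (f : Mor S) : List Pol :=
  Quotient.lift (s := termSetoid S) Term.cod (fun _ _ h => And.left (And.right h)) f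

theorem mk_comp (f g : Term S) : mk (.comp f g) = mk f ≫ₘ mk g := rfl
theorem mk_tens (f g : Term S) : mk (.tens f g) = mk f ⊗ₘ mk g := rfl
theorem mk_id (a : List Pol) : mk (.id a : Term S) = id a := rfl

@[simp] theorem dom_id (a : List Pol) : (id a : Mor S).dom = a := rfl
@[simp] theorem cod_id (a : List Pol) : (id a : Mor S).cod = a := rfl
@[simp] theorem dom_symm (a b : List Pol) : (symm a b : Mor S).dom = a ++ b := rfl
@[simp] theorem cod_symm (a b : List Pol) : (symm a b : Mor S).cod = b ++ a := rfl
@[simp] theorem dom_cup : (cup : Mor S).dom = [] := rfl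
@[simp] theorem cod_cup : (cup : Mor S).cod = [.out, .inp] := rfl
@[simp] theorem dom_cap : (cap : Mor S).dom = [.inp, .out] := rfl
@[simp] theorem cod_cap : (cap : Mor S).cod = [] := rfl
@[simp] theorem dom_comp (f g : Mor S) : (f ≫ₘ g).dom = f.dom := by
  induction f using Quotient.inductionOn; induction g using Quotient.inductionOn; rfl
@[simp] theorem cod_comp (f g : Mor S) : (f ≫ₘ g).cod = g.cod := by
  induction f using Quotient.inductionOn; induction g using Quotient.inductionOn; rfl
@[simp] theorem dom_tens (f g : Mor S) : (f ⊗ₘ g).dom = f.dom ++ g.dom := by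
  induction f using Quotient.inductionOn; induction g using Quotient.inductionOn; rfl
@[simp] theorem cod_tens (f g : Mor S) : (f ⊗ₘ g).cod = f.cod ++ g.cod := by
  induction f using Quotient.inductionOn; induction g using Quotient.inductionOn; rfl

theorem id_comp {a : List Pol} {f : Mor S} (h : f.dom = a) : id a ≫ₘ f = f := by
  induction f using Quotient.inductionOn with | _ f
  subst h
  exact mk_eq rfl rfl (by simp [Term.Typed, Term.cod]; exact fun _ => rfl)
    fun _ h => mk_eq_of_eqv (.id_comp h.hasType)

theorem comp_id {a : List Pol} {f : Mor S} (h : f.cod = a) : f ≫ₘ id a = f := by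
  induction f using Quotient.inductionOn with | _ f
  subst h
  exact mk_eq rfl rfl (by simp [Term.Typed, Term.dom]; exact fun _ => rfl)
    fun _ h => mk_eq_of_eqv (.comp_id h.hasType)

theorem assoc (f g h : Mor S) : (f ≫ₘ g) ≫ₘ h = f ≫ₘ g ≫ₘ h := by
  induction f using Quotient.inductionOn with | _ f
  induction g using Quotient.inductionOn with | _ g
  induction h using Quotient.inductionOn with | _ h
  refine mk_eq rfl rfl (by simp [Term.Typed, Term.dom, Term.cod]; tauto) fun t _ => ?_
  obtain ⟨⟨tf, tg, e⟩, th, e'⟩ := t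
  exact mk_eq_of_eqv (.assoc tf.hasType (e ▸ tg.hasType) (e' ▸ th.hasType))

theorem tens_id (a b : List Pol) : (id a ⊗ₘ id b : Mor S) = id (a ++ b) :=
  mk_eq_of_eqv (.tens_id a b)

theorem interchange {f g f' g' : Mor S} (h : f.cod = g.dom) :
    (f ⊗ₘ f') ≫ₘ (g ⊗ₘ g') = (f ≫ₘ g) ⊗ₘ (f' ≫ₘ g') := by
  induction f using Quotient.inductionOn with | _ f
  induction g using Quotient.inductionOn with | _ g
  induction f' using Quotient.inductionOn with | _ f'
  induction g' using Quotient.inductionOn with | _ g'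
  change f.cod = g.dom at h
  refine mk_eq rfl rfl ?_ fun t t' => ?_
  · simp [Term.Typed, Term.dom, Term.cod, h]; tauto
  · obtain ⟨⟨tf, tg, e⟩, tf', tg', e'⟩ := t'
    exact mk_eq_of_eqv (.interchange tf.hasType (e ▸ tg.hasType) tf'.hasType (e' ▸ tg'.hasType))

theorem interchange' {f g f' g' : Mor S} (h : f'.cod = g'.dom) :
    (f ⊗ₘ f') ≫ₘ (g ⊗ₘ g') = (f ≫ₘ g) ⊗ₘ (f' ≫ₘ g') := by
  induction f using Quotient.inductionOn with | _ f
  induction g using Quotient.inductionOn with | _ g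
  induction f' using Quotient.inductionOn with | _ f'
  induction g' using Quotient.inductionOn with | _ g'
  change f'.cod = g'.dom at h
  refine mk_eq rfl rfl ?_ fun t t' => ?_
  · simp [Term.Typed, Term.dom, Term.cod, h]; tauto
  · obtain ⟨⟨tf, tg, e⟩, tf', tg', e'⟩ := t'
    exact mk_eq_of_eqv (.interchange tf.hasType (e ▸ tg.hasType) tf'.hasType (e' ▸ tg'.hasType))

theorem comp_tens_id (a : List Pol) (f g : Mor S) :
    (f ≫ₘ g) ⊗ₘ id a = (f ⊗ₘ id a) ≫ₘ (g ⊗ₘ id a) := by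
  rw [interchange' rfl, id_comp (dom_id a)]

/-- A tensor product, as the left factor followed by the right factor. -/
theorem tens_eq_comp (f g : Mor S) {a b : List Pol} (hf : f.cod = a) (hg : g.dom = b) :
    f ⊗ₘ g = (f ⊗ₘ id b) ≫ₘ (id a ⊗ₘ g) := by
  rw [interchange hf, comp_id hf, id_comp hg]

/-- A tensor product, as the right factor followed by the left factor. -/
theorem tens_eq_comp' (f g : Mor S) {a b : List Pol} (hf : f.dom = a) (hg : g.cod = b) :
    f ⊗ₘ g = (id a ⊗ₘ g) ≫ₘ (f ⊗ₘ id b) := by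
  rw [interchange (f := id a) hf.symm, comp_id hg, id_comp hf]

theorem tens_assoc (f g h : Mor S) : (f ⊗ₘ g) ⊗ₘ h = f ⊗ₘ g ⊗ₘ h := by
  induction f using Quotient.inductionOn with | _ f
  induction g using Quotient.inductionOn with | _ g
  induction h using Quotient.inductionOn with | _ h
  refine mk_eq (List.append_assoc ..) (List.append_assoc ..) (and_assoc) fun t _ => ?_
  exact mk_eq_of_eqv (.tens_assoc t.1.1.hasType t.1.2.hasType t.2.hasType)

theorem unit_tens (f : Mor S) : id [] ⊗ₘ f = f := by
  induction f using Quotient.inductionOn with | _ f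
  exact mk_eq rfl rfl (by simp [Term.Typed]) fun _ t => mk_eq_of_eqv (.unit_tens t.hasType)

theorem tens_unit (f : Mor S) : f ⊗ₘ id [] = f := by
  induction f using Quotient.inductionOn with | _ f
  exact mk_eq (List.append_nil _) (List.append_nil _) (by simp [Term.Typed])
    fun _ t => mk_eq_of_eqv (.tens_unit t.hasType)

theorem symm_natural (f g : Mor S) {a b a' b' : List Pol} (hf : f.cod = a') (hg : g.cod = b')
    (hf' : f.dom = a) (hg' : g.dom = b) :
    (f ⊗ₘ g) ≫ₘ symm a' b' = symm a b ≫ₘ (g ⊗ₘ f) := by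
  subst hf hg hf' hg'
  induction f using Quotient.inductionOn with | _ f
  induction g using Quotient.inductionOn with | _ g
  refine mk_eq rfl rfl ?_ fun t _ => mk_eq_of_eqv (.symm_natural t.1.1.hasType t.1.2.hasType)
  simp only [Term.Typed, Term.dom, Term.cod, true_and]
  exact ⟨fun h => ⟨⟨h.1.2, h.1.1⟩, rfl⟩, fun h => ⟨⟨h.1.2, h.1.1⟩, rfl⟩⟩

theorem symm_symm (a b : List Pol) : (symm a b ≫ₘ symm b a : Mor S) = id (a ++ b) :=
  mk_eq_of_eqv (.symm_symm a b)

theorem hexagon (a b c : List Pol) :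
    (symm a (b ++ c) : Mor S) = (symm a b ⊗ₘ id c) ≫ₘ (id b ⊗ₘ symm a c) :=
  mk_eq_of_eqv (.hexagon a b c)

theorem snake : (cup ⊗ₘ id [.out] : Mor S) ≫ₘ (id [.out] ⊗ₘ cap) = id [.out] :=
  mk_eq_of_eqv .snake

theorem snake' : (id [.inp] ⊗ₘ cup : Mor S) ≫ₘ (cap ⊗ₘ id [.inp]) = id [.inp] :=
  mk_eq_of_eqv .snake'

theorem symm_nil (a : List Pol) : (symm a [] : Mor S) = id a := by
  have h := hexagon (S := S) a [] []
  rw [List.append_nil, tens_unit, unit_tens] at h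
  have h' := symm_symm (S := S) a []
  rw [List.append_nil] at h'
  calc (symm a [] : Mor S) = symm a [] ≫ₘ id a := (comp_id (by simp)).symm
    _ = (symm a [] ≫ₘ symm a []) ≫ₘ symm [] a := by rw [← h', assoc]
    _ = id a := by rw [← h, h']

theorem nil_symm (a : List Pol) : (symm [] a : Mor S) = id a := by
  have h := symm_symm (S := S) a []
  rwa [symm_nil, id_comp (by simp), List.append_nil] at h

/-- The other hexagon: moving `a ⊗ b` past `c` is moving `b`, then `a`. -/
theorem hexagon' (a b c : List Pol) :
    (symm (a ++ b) c : Mor S) = (id a ⊗ₘ symm b c) ≫ₘ (symm a c ⊗ₘ id b) := by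
  have key : (symm c (a ++ b) : Mor S) ≫ₘ (id a ⊗ₘ symm b c) ≫ₘ (symm a c ⊗ₘ id b) =
      id (c ++ (a ++ b)) := by
    rw [hexagon, assoc, ← assoc (id a ⊗ₘ _), interchange (by simp), id_comp (by simp), symm_symm,
      tens_id, id_comp (by simp), interchange (by simp), symm_symm, id_comp (by simp), tens_id,
      List.append_assoc]
  calc (symm (a ++ b) c : Mor S)
      = symm (a ++ b) c ≫ₘ symm c (a ++ b) ≫ₘ (id a ⊗ₘ symm b c) ≫ₘ (symm a c ⊗ₘ id b) := by
        rw [key, comp_id (by simp)]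
    _ = _ := by rw [← assoc, symm_symm, id_comp (by simp)]

theorem symm_natural_left (f : Mor S) {a b c : List Pol} (h : f.dom = a) (h' : f.cod = b) :
    (f ⊗ₘ id c) ≫ₘ symm b c = symm a c ≫ₘ (id c ⊗ₘ f) :=
  symm_natural f (id c) h' rfl h rfl

theorem symm_natural_right (f : Mor S) {a b c : List Pol} (h : f.dom = a) (h' : f.cod = b) :
    (id c ⊗ₘ f) ≫ₘ symm c b = symm c a ≫ₘ (f ⊗ₘ id c) :=
  symm_natural (id c) f rfl h' rfl h

end Mor

end Mor

/-! ### Coherence for permutations of labelled wires -/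

section Wiring

variable {S : Signature.{u}} {N : Type v}

open Mor

/-- The morphisms denoted by rewirings. -/
inductive Wiring : List (Edge N) → List (Edge N) → Mor S → Prop
  | id (l : List (Edge N)) : Wiring l l (Mor.id (l.map Edge.pol))
  | symm (l m : List (Edge N)) :
      Wiring (l ++ m) (m ++ l) (Mor.symm (l.map Edge.pol) (m.map Edge.pol))
  | comp {l m n : List (Edge N)} {f g : Mor S} :
      Wiring l m f → Wiring m n g → Wiring l n (f ≫ₘ g)
  | tens {l m l' m' : List (Edge N)} {f g : Mor S} :
      Wiring l l' f → Wiring m m' g → Wiring (l ++ m) (l' ++ m') (f ⊗ₘ g)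

theorem Rewiring.wiring {l m : List (Edge N)} {σ : Term S} (h : Rewiring l m σ) :
    Wiring l m (Mor.mk σ) := by
  induction h with
  | id l => exact .id l
  | symm l m => exact .symm l m
  | comp _ _ ih ih' => exact .comp ih ih'
  | tens _ _ ih ih' => exact .tens ih ih'

theorem Wiring.perm {l m : List (Edge N)} {f : Mor S} (h : Wiring l m f) : l.Perm m := by
  induction h with
  | id l => exact .refl l
  | symm l m => exact List.perm_append_comm
  | comp _ _ ih ih' => exact ih.trans ih'
  | tens _ _ ih ih' => exact ih.append ih'

theorem Wiring.dom {l m : List (Edge N)} {f : Mor S} (h : Wiring l m f) :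
    f.dom = l.map Edge.pol := by
  induction h <;> simp_all

theorem Wiring.cod {l m : List (Edge N)} {f : Mor S} (h : Wiring l m f) :
    f.cod = m.map Edge.pol := by
  induction h <;> simp_all

/-- The morphism that moves the wire `p` in `a ⊗ p ⊗ b` to the front. -/
def front (a : List Pol) (p : Pol) (b : List Pol) : Mor S := Mor.symm a [p] ⊗ₘ Mor.id b

@[simp] theorem dom_front (a : List Pol) (p : Pol) (b : List Pol) :
    (front a p b : Mor S).dom = a ++ p :: b := by simp [front]

@[simp] theorem cod_front (a : List Pol) (p : Pol) (b : List Pol) :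
    (front a p b : Mor S).cod = p :: (a ++ b) := by simp [front]

theorem front_tens_id (a b c : List Pol) (p : Pol) :
    (front a p b ⊗ₘ Mor.id c : Mor S) = front a p (b ++ c) := by
  rw [front, front, Mor.tens_assoc, Mor.tens_id]

theorem front_append (a b c : List Pol) (p : Pol) :
    (front (a ++ b) p c : Mor S) =
      (Mor.id a ⊗ₘ front b p c) ≫ₘ (Mor.symm a [p] ⊗ₘ Mor.id (b ++ c)) := by
  rw [front, hexagon', front, ← Mor.tens_id b c, comp_tens_id, Mor.tens_assoc, Mor.tens_assoc]

theorem front_comp_back (a b : List Pol) (p : Pol) :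
    (front a p b : Mor S) ≫ₘ (Mor.symm [p] a ⊗ₘ Mor.id b) = Mor.id (a ++ p :: b) := by
  rw [front, interchange (by simp), symm_symm, id_comp (by simp), Mor.tens_id]
  simp

theorem tens_comp_front_left {f g f' : Mor S} {l₁ l₂ m₁ m₂ k k' : List Pol} {p : Pol}
    (hf : f.cod = m₁ ++ p :: m₂) (hg : g.dom = k) (hg' : g.cod = k')
    (h : f ≫ₘ front m₁ p m₂ = front l₁ p l₂ ≫ₘ (Mor.id [p] ⊗ₘ f')) :
    (f ⊗ₘ g) ≫ₘ front m₁ p (m₂ ++ k') = front l₁ p (l₂ ++ k) ≫ₘ (Mor.id [p] ⊗ₘ f' ⊗ₘ g) := by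
  rw [← front_tens_id, ← front_tens_id, interchange (by simp [hf]), h, comp_id hg',
    ← Mor.tens_assoc, interchange' (by simp [hg]), id_comp hg]

theorem tens_comp_front_right {f g g' : Mor S} {l l' l₁ l₂ m₁ m₂ : List Pol} {p : Pol}
    (hf : f.dom = l) (hf' : f.cod = l') (hg : g'.dom = l₁ ++ l₂) (hg' : g'.cod = m₁ ++ m₂)
    (h : g ≫ₘ front m₁ p m₂ = front l₁ p l₂ ≫ₘ (Mor.id [p] ⊗ₘ g')) :
    (f ⊗ₘ g) ≫ₘ front (l' ++ m₁) p m₂ = front (l ++ l₁) p l₂ ≫ₘ (Mor.id [p] ⊗ₘ f ⊗ₘ g') := by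
  have e₁ : f ⊗ₘ (front l₁ p l₂ ≫ₘ (Mor.id [p] ⊗ₘ g')) =
      (Mor.id l ⊗ₘ front l₁ p l₂) ≫ₘ (f ⊗ₘ Mor.id [p] ⊗ₘ g') := by
    rw [interchange (f := Mor.id l) hf.symm, id_comp hf]
  have e₂ : (f ⊗ₘ Mor.id [p] ⊗ₘ g') ≫ₘ (Mor.symm l' [p] ⊗ₘ Mor.id (m₁ ++ m₂)) =
      (Mor.symm l [p] ⊗ₘ Mor.id (l₁ ++ l₂)) ≫ₘ (Mor.id [p] ⊗ₘ f ⊗ₘ g') := by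
    rw [← Mor.tens_assoc, ← Mor.tens_assoc, interchange' hg', interchange' (f' := Mor.id (l₁ ++ l₂)) hg.symm,
      symm_natural_left f hf hf', comp_id hg', id_comp hg]
  rw [front_append, ← Mor.assoc, interchange hf', h, comp_id hf', e₁, Mor.assoc, e₂, front_append,
    Mor.assoc]

theorem symm_comp_front_left (l₁ l₂ k : List Pol) (p : Pol) :
    (Mor.symm (l₁ ++ p :: l₂) k : Mor S) ≫ₘ front (k ++ l₁) p l₂ =
      front l₁ p (l₂ ++ k) ≫ₘ (Mor.id [p] ⊗ₘ Mor.symm (l₁ ++ l₂) k) := by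
  have h : (Mor.symm (p :: (l₁ ++ l₂)) k : Mor S) =
      (Mor.id [p] ⊗ₘ Mor.symm (l₁ ++ l₂) k) ≫ₘ (Mor.symm [p] k ⊗ₘ Mor.id (l₁ ++ l₂)) :=
    hexagon' [p] (l₁ ++ l₂) k
  rw [front_append, ← Mor.assoc, ← symm_natural_left (front l₁ p l₂) (dom_front ..) (cod_front ..),
    h, front_tens_id, Mor.assoc, Mor.assoc, interchange (by simp), symm_symm, Mor.id_comp (by simp),
    Mor.tens_id, comp_id (by simp)]

theorem symm_comp_front_right (l k₁ k₂ : List Pol) (p : Pol) :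
    (Mor.symm l (k₁ ++ p :: k₂) : Mor S) ≫ₘ front k₁ p (k₂ ++ l) =
      front (l ++ k₁) p k₂ ≫ₘ (Mor.id [p] ⊗ₘ Mor.symm l (k₁ ++ k₂)) := by
  have h : (Mor.symm l (p :: (k₁ ++ k₂)) : Mor S) =
      (Mor.symm l [p] ⊗ₘ Mor.id (k₁ ++ k₂)) ≫ₘ (Mor.id [p] ⊗ₘ Mor.symm l (k₁ ++ k₂)) :=
    hexagon l [p] (k₁ ++ k₂)
  rw [← front_tens_id, ← symm_natural_right (front k₁ p k₂) (dom_front ..) (cod_front ..), h,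
    front_append, Mor.assoc]

theorem append_eq_append_cons {α : Type*} {l k l₁ l₂ : List α} {e : α}
    (h : l ++ k = l₁ ++ e :: l₂) :
    (∃ t, l = l₁ ++ e :: t ∧ l₂ = t ++ k) ∨ ∃ t, l₁ = l ++ t ∧ k = t ++ e :: l₂ := by
  rcases List.append_eq_append_iff.1 h with ⟨t, rfl, h'⟩ | ⟨t, rfl, h'⟩
  · exact .inr ⟨t, rfl, h'⟩
  · rcases List.cons_eq_append_iff.1 h' with ⟨rfl, rfl⟩ | ⟨t', rfl, rfl⟩
    · exact .inr ⟨[], by simp, rfl⟩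
    · exact .inl ⟨t', rfl, rfl⟩

/-- A wiring followed by moving one outgoing wire to the front is the same as first moving that wire
to the front and then wiring the others. -/
theorem Wiring.pull {l m : List (Edge N)} {f : Mor S} (h : Wiring l m f) :
    ∀ {l₁ l₂ : List (Edge N)} {e : Edge N}, l = l₁ ++ e :: l₂ →
      ∃ m₁ m₂ g, m = m₁ ++ e :: m₂ ∧ Wiring (l₁ ++ l₂) (m₁ ++ m₂) g ∧
        f ≫ₘ front (m₁.map Edge.pol) e.pol (m₂.map Edge.pol) =
          front (l₁.map Edge.pol) e.pol (l₂.map Edge.pol) ≫ₘ (Mor.id [e.pol] ⊗ₘ g) := by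
  induction h with
  | id l =>
    rintro l₁ l₂ e rfl
    refine ⟨l₁, l₂, _, rfl, .id _, ?_⟩
    rw [id_comp (by simp), Mor.tens_id, comp_id (by simp)]
  | @comp l m n f g _ _ ihf ihg =>
    rintro l₁ l₂ e h
    obtain ⟨m₁, m₂, f', hm, hf', ef⟩ := ihf h
    obtain ⟨n₁, n₂, g', hn, hg', eg⟩ := ihg hm
    refine ⟨n₁, n₂, _, hn, hf'.comp hg', ?_⟩
    rw [Mor.assoc, eg, ← Mor.assoc, ef, Mor.assoc, interchange (by simp), id_comp (by simp)]
  | @tens l k l' k' f g hf hg ihf ihg =>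
    rintro l₁ l₂ e h
    rcases append_eq_append_cons h with ⟨t, h₁, rfl⟩ | ⟨t, rfl, h₁⟩
    · obtain ⟨m₁, m₂, f', rfl, hf', ef⟩ := ihf h₁
      refine ⟨m₁, m₂ ++ k', f' ⊗ₘ g, by simp, by simpa using hf'.tens hg, ?_⟩
      simpa using tens_comp_front_left (by simpa using hf.cod) hg.dom hg.cod ef
    · obtain ⟨m₁, m₂, g', rfl, hg', eg⟩ := ihg h₁
      refine ⟨l' ++ m₁, m₂, f ⊗ₘ g', by simp, by simpa using hf.tens hg', ?_⟩
      simpa using tens_comp_front_right hf.dom hf.cod (by simpa using hg'.dom)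
        (by simpa using hg'.cod) eg
  | symm l k =>
    rintro l₁ l₂ e h
    rcases append_eq_append_cons h with ⟨t, rfl, rfl⟩ | ⟨t, rfl, rfl⟩
    · refine ⟨k ++ l₁, t, Mor.symm ((l₁ ++ t).map Edge.pol) (k.map Edge.pol), by simp,
        by simpa using Wiring.symm (l₁ ++ t) k, ?_⟩
      simpa using symm_comp_front_left (S := S) (l₁.map Edge.pol) (t.map Edge.pol)
        (k.map Edge.pol) e.pol
    · refine ⟨t, l₂ ++ l, Mor.symm (l.map Edge.pol) ((t ++ l₂).map Edge.pol), by simp,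
        by simpa using Wiring.symm l (t ++ l₂), ?_⟩
      simpa using symm_comp_front_right (S := S) (l.map Edge.pol) (t.map Edge.pol)
        (l₂.map Edge.pol) e.pol

theorem Wiring.eq_id_nil {l m : List (Edge N)} {f : Mor S} (h : Wiring l m f) (hl : l = []) :
    f = Mor.id [] := by
  induction h with
  | id l => simp [hl]
  | symm l m => simp_all [symm_nil]
  | comp h _ ih ih' =>
    subst hl
    rw [ih rfl, ih' h.perm.nil_eq.symm, id_comp (dom_id [])]
  | tens _ _ ih ih' =>
    rw [List.append_eq_nil_iff] at hl
    rw [ih hl.1, ih' hl.2, Mor.tens_id, List.append_nil]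

/-- Coherence: the permutation of the wires determines a morphism made of symmetries. -/
theorem Wiring.unique {l m : List (Edge N)} {f g : Mor S} (hl : l.Nodup) (hf : Wiring l m f)
    (hg : Wiring l m g) : f = g := by
  induction l generalizing m f g with
  | nil => rw [hf.eq_id_nil rfl, hg.eq_id_nil rfl]
  | cons e l ih =>
    obtain ⟨m₁, m₂, f', rfl, hf', ef⟩ := hf.pull (l₁ := []) rfl
    obtain ⟨n₁, n₂, g', hn, hg', eg⟩ := hg.pull (l₁ := []) rfl
    -- the wire `e` occurs only once in the target
    have hm := (hf.perm.nodup_iff).1 hl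
    have hmn : m₁ = n₁ ∧ m₂ = n₂ := by
      have := List.nodup_middle.1 hm
      rcases append_eq_append_cons hn with ⟨t, rfl, rfl⟩ | ⟨t, rfl, h⟩
      · simp at this
      · rcases List.cons_eq_append_iff.1 h with ⟨rfl, h⟩ | ⟨t', rfl, rfl⟩
        · exact ⟨by simp, (List.cons.inj h).2⟩
        · simp at this
    obtain ⟨rfl, rfl⟩ := hmn
    rw [ih (List.nodup_cons.1 hl).2 hf' hg', ← eg] at ef
    have := congrArg (· ≫ₘ (Mor.symm [e.pol] (m₁.map Edge.pol) ⊗ₘ Mor.id (m₂.map Edge.pol))) ef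
    simpa [Mor.assoc, front_comp_back, comp_id, hf.cod, hg.cod] using this

/-- Every permutation of the wires is realised by symmetries. -/
theorem exists_rewiring {l m : List (Edge N)} (h : l.Perm m) :
    ∃ σ : Term S, Rewiring l m σ := by
  induction h with
  | nil => exact ⟨_, .id []⟩
  | cons e _ ih => exact ⟨_, .tens (.id [e]) ih.choose_spec⟩
  | swap e e' l => exact ⟨_, .tens (.symm [e'] [e]) (.id l)⟩
  | trans _ _ ih ih' => exact ⟨_, .comp ih.choose_spec ih'.choose_spec⟩

theorem exists_wiring {l m : List (Edge N)} (h : l.Perm m) : ∃ f : Mor S, Wiring l m f :=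
  (exists_rewiring h).imp' Mor.mk fun _ => Rewiring.wiring

/-! ### Contractions: symmetries and caps -/

/-- `Contr l m f` : `f` is made of symmetries and of caps on pairs of wires with the same name, and it
connects the other wires of `l` to the wires of `m` with the same label. -/
inductive Contr : List (Edge N) → List (Edge N) → Mor S → Prop
  | id (l : List (Edge N)) : Contr l l (Mor.id (l.map Edge.pol))
  | symm (l m : List (Edge N)) :
      Contr (l ++ m) (m ++ l) (Mor.symm (l.map Edge.pol) (m.map Edge.pol))
  | cap (a : N) : Contr [⟨.inp, a⟩, ⟨.out, a⟩] [] Mor.cap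
  | comp {l m n : List (Edge N)} {f g : Mor S} :
      Contr l m f → Contr m n g → Contr l n (f ≫ₘ g)
  | tens {l m l' m' : List (Edge N)} {f g : Mor S} :
      Contr l l' f → Contr m m' g → Contr (l ++ m) (l' ++ m') (f ⊗ₘ g)

theorem Wiring.contr {l m : List (Edge N)} {f : Mor S} (h : Wiring l m f) : Contr l m f := by
  induction h with
  | id l => exact .id l
  | symm l m => exact .symm l m
  | comp _ _ ih ih' => exact .comp ih ih'
  | tens _ _ ih ih' => exact .tens ih ih'

theorem Contr.dom {l m : List (Edge N)} {f : Mor S} (h : Contr l m f) :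
    f.dom = l.map Edge.pol := by
  induction h <;> simp_all

theorem Contr.cod {l m : List (Edge N)} {f : Mor S} (h : Contr l m f) :
    f.cod = m.map Edge.pol := by
  induction h <;> simp_all

theorem capEdges_append (as bs : List N) : capEdges (as ++ bs) = capEdges as ++ capEdges bs := by
  induction as with
  | nil => rfl
  | cons a as ih => simp [capEdges, ih]

theorem mem_capEdges {as : List N} {e : Edge N} : e ∈ capEdges as ↔ e.name ∈ as := by
  induction as with
  | nil => simp [capEdges]
  | cons a as ih =>
    obtain ⟨_ | _, n⟩ := e <;> simp [capEdges, ih]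

theorem nodup_capEdges {as : List N} (h : as.Nodup) : (capEdges as).Nodup := by
  induction as with
  | nil => simp [capEdges]
  | cons a as ih =>
    rw [List.nodup_cons] at h
    simp [capEdges, ih h.2, mem_capEdges, h.1]

theorem Mor.mk_caps_add (n k : ℕ) :
    (Mor.mk (caps (n + k)) : Mor S) = Mor.mk (caps n) ⊗ₘ Mor.mk (caps k) := by
  induction n with
  | zero => rw [Nat.zero_add]; exact (unit_tens _).symm
  | succ n ih =>
    rw [Nat.succ_add]
    simp only [caps, Mor.mk_tens]
    rw [ih, Mor.tens_assoc]

theorem Mor.dom_caps (as : List N) :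
    (Mor.mk (caps as.length) : Mor S).dom = (capEdges as).map Edge.pol :=
  (hasType_caps as).dom_eq

theorem Mor.cod_caps (as : List N) : (Mor.mk (caps as.length) : Mor S).cod = [] :=
  (hasType_caps as).cod_eq

theorem contr_caps (as : List N) :
    Contr (capEdges as) [] (Mor.mk (caps as.length) : Mor S) := by
  induction as with
  | nil => exact .id []
  | cons a as ih => exact .tens (.cap a) ih

/-- In every contraction the caps can be moved to the end. -/
theorem Contr.normal {l m : List (Edge N)} {f : Mor S} (h : Contr l m f) :
    ∃ as g, Wiring l (m ++ capEdges as) g ∧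
      f = g ≫ₘ (Mor.id (m.map Edge.pol) ⊗ₘ Mor.mk (caps as.length)) := by
  induction h with
  | id l =>
    refine ⟨[], Mor.id (l.map Edge.pol), by simpa [capEdges] using Wiring.id (S := S) l, ?_⟩
    rw [id_comp (by simp [caps, mk_id])]
    exact (tens_unit _).symm
  | symm l m =>
    refine ⟨[], _, by simpa [capEdges] using Wiring.symm (S := S) l m, ?_⟩
    rw [List.length_nil, caps, mk_id, tens_unit, comp_id (by simp)]
  | cap a =>
    refine ⟨[a], _, .id _, ?_⟩
    rw [id_comp]
    · exact ((unit_tens _).trans (tens_unit _)).symm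
    · simp [caps, mk_id, mk_tens]; rfl
  | @comp l m n f g hf hg ihf ihg =>
    obtain ⟨as, f', hf', ef⟩ := ihf
    obtain ⟨bs, g', hg', eg⟩ := ihg
    refine ⟨bs ++ as, f' ≫ₘ (g' ⊗ₘ Mor.id ((capEdges as).map Edge.pol)), hf'.comp ?_, ?_⟩
    · simpa [capEdges_append] using hg'.tens (.id (capEdges as))
    · rw [List.length_append, mk_caps_add, Mor.assoc, ← Mor.tens_assoc,
        interchange' (by simp [dom_caps]), ← eg, id_comp (dom_caps as),
        tens_eq_comp' g _ hg.dom (cod_caps as), tens_unit, ← Mor.assoc, ← ef]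
  | @tens l k l' k' f g hf hg ihf ihg =>
    obtain ⟨as, f', hf', ef⟩ := ihf
    obtain ⟨bs, g', hg', eg⟩ := ihg
    refine ⟨as ++ bs, (f' ⊗ₘ g') ≫ₘ (Mor.id (l'.map Edge.pol) ⊗ₘ
      Mor.symm ((capEdges as).map Edge.pol) (k'.map Edge.pol) ⊗ₘ
      Mor.id ((capEdges bs).map Edge.pol)), (hf'.tens hg').comp ?_, ?_⟩
    · simpa [capEdges_append] using
        (Wiring.id (S := S) l').tens ((Wiring.symm (capEdges as) k').tens (.id (capEdges bs)))
    · rw [ef, eg, ← interchange (by simp [hf'.cod, dom_caps]), Mor.assoc]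
      congr 1
      have e := symm_natural_left (Mor.mk (caps as.length) : Mor S) (c := k'.map Edge.pol)
        (dom_caps as) (cod_caps as)
      rw [nil_symm, comp_id (by simp [cod_caps])] at e
      rw [List.length_append, mk_caps_add, List.map_append, ← Mor.tens_id (List.map _ l'),
        Mor.tens_assoc (Mor.id _) (Mor.id _), interchange (by simp), id_comp (by simp),
        ← Mor.tens_assoc (Mor.id (List.map _ k')), interchange (by simp [dom_caps]),
        id_comp (dom_caps bs), ← e, Mor.tens_assoc, Mor.tens_assoc]

theorem exists_wiring_caps {as bs : List N} (h : as.Perm bs) :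
    ∃ f : Mor S, Wiring (capEdges as) (capEdges bs) f ∧
      f ≫ₘ Mor.mk (caps bs.length) = Mor.mk (caps as.length) := by
  induction h with
  | nil => exact ⟨_, .id [], id_comp rfl⟩
  | @cons a as bs _ ih =>
    obtain ⟨f, hf, ef⟩ := ih
    refine ⟨_, Wiring.tens (.id [⟨.inp, a⟩, ⟨.out, a⟩]) hf, ?_⟩
    rw [List.length_cons, List.length_cons, caps, caps, mk_tens, mk_tens, interchange (by rfl), ef,
      id_comp (by rfl)]
  | swap a b as =>
    refine ⟨_, Wiring.tens (.symm [⟨.inp, b⟩, ⟨.out, b⟩] [⟨.inp, a⟩, ⟨.out, a⟩])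
      (.id (capEdges as)), ?_⟩
    have e := symm_natural (Mor.cap : Mor S) Mor.cap rfl rfl rfl rfl
    rw [cod_cap, nil_symm, comp_id (by simp)] at e
    simp only [List.length_cons, caps, mk_tens]
    rw [← Mor.tens_assoc, interchange (by rfl), id_comp (dom_caps as)]
    exact congrArg (· ⊗ₘ _) e.symm
  | trans _ _ ih ih' =>
    obtain ⟨f, hf, ef⟩ := ih
    obtain ⟨g, hg, eg⟩ := ih'
    exact ⟨_, hf.comp hg, by rw [Mor.assoc, eg, ef]⟩

theorem perm_of_perm_capEdges {as bs : List N} (h : (capEdges as).Perm (capEdges bs)) :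
    as.Perm bs := by
  have key (as : List N) : (capEdges as).filterMap
      (fun e => match e.pol with | .out => some e.name | .inp => none) = as := by
    induction as with
    | nil => rfl
    | cons a as ih => simp [capEdges, ih]
  rw [← key as, ← key bs]
  exact h.filterMap _

/-- The labels determine a contraction, if they are distinct. -/
theorem Contr.unique {l m : List (Edge N)} {f g : Mor S} (hl : l.Nodup) (hf : Contr l m f)
    (hg : Contr l m g) : f = g := by
  obtain ⟨as, f', hf', rfl⟩ := hf.normal
  obtain ⟨bs, g', hg', rfl⟩ := hg.normal
  have hp : as.Perm bs :=
    perm_of_perm_capEdges ((List.perm_append_left_iff m).1 (hf'.perm.symm.trans hg'.perm))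
  obtain ⟨h, hh, eh⟩ := exists_wiring_caps (S := S) hp
  rw [hg'.unique hl (hf'.comp (.tens (.id m) hh)), Mor.assoc, interchange (by simp), eh,
    id_comp (by simp)]

/-- The wires of a list whose name does not also occur in the other direction. -/
def FreeIn (l : List (Edge N)) (e : Edge N) : Prop := e ∈ l ∧ e.flip ∉ l

@[simp] theorem Edge.pol_flip (e : Edge N) : e.flip.pol = e.pol.flip := rfl
@[simp] theorem Edge.name_flip (e : Edge N) : e.flip.name = e.name := rfl

@[simp] theorem Edge.flip_flip (e : Edge N) : e.flip.flip = e := by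
  obtain ⟨_ | _, n⟩ := e <;> rfl

theorem Edge.flip_ne (e : Edge N) : e.flip ≠ e := by
  obtain ⟨_ | _, n⟩ := e <;> simp [Edge.flip, Pol.flip]

/-- Contracting all pairs of wires with the same name leaves the free wires. -/
theorem exists_perm_capEdges {l m : List (Edge N)} (hl : l.Nodup) (hm : m.Nodup)
    (h : ∀ e, e ∈ m ↔ FreeIn l e) :
    ∃ as : List N, as.Nodup ∧ (∀ a, a ∈ as ↔ (⟨.out, a⟩ : Edge N) ∈ l ∧ ⟨.inp, a⟩ ∈ l) ∧
      l.Perm (m ++ capEdges as) := by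
  classical
  let as := (l.filter fun e => e.pol = .out ∧ e.flip ∈ l).map Edge.name
  have mem (a : N) : a ∈ as ↔ (⟨.out, a⟩ : Edge N) ∈ l ∧ ⟨.inp, a⟩ ∈ l := by
    simp only [as, List.mem_map, List.mem_filter, decide_eq_true_eq]
    constructor
    · rintro ⟨⟨p, n⟩, ⟨h₁, rfl, h₂⟩, rfl⟩
      exact ⟨h₁, h₂⟩
    · exact fun h => ⟨_, ⟨h.1, rfl, h.2⟩, rfl⟩
  have nodup : as.Nodup := by
    refine List.Nodup.map_on ?_ (hl.filter _)
    rintro ⟨p, n⟩ h ⟨q, k⟩ h' rfl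
    simp only [List.mem_filter, decide_eq_true_eq] at h h'
    rw [h.2.1, h'.2.1]
  refine ⟨as, nodup, mem, (List.perm_ext_iff_of_nodup hl ?_).2 fun e => ?_⟩
  · refine List.nodup_append.2 ⟨hm, nodup_capEdges nodup, ?_⟩
    rintro e he _ he' rfl
    rw [mem_capEdges, mem] at he'
    obtain ⟨_ | _, n⟩ := e
    · exact ((h _).1 he).2 he'.2
    · exact ((h _).1 he).2 he'.1
  · rw [List.mem_append, mem_capEdges, mem, h, FreeIn]
    obtain ⟨_ | _, n⟩ := e <;> simp only [Edge.flip, Pol.flip] <;> tauto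

theorem exists_contr {l m : List (Edge N)} (hl : l.Nodup) (hm : m.Nodup)
    (h : ∀ e, e ∈ m ↔ FreeIn l e) : ∃ f : Mor S, Contr l m f := by
  obtain ⟨as, -, -, hp⟩ := exists_perm_capEdges hl hm h
  obtain ⟨f, hf⟩ := exists_wiring (S := S) hp
  have := hf.contr.comp ((Contr.id m).tens (contr_caps as))
  rw [List.append_nil] at this
  exact ⟨_, this⟩

end Wiring

/-! ### Renaming of tensor expressions -/

namespace Expr

variable {S : Signature.{u}} {Name : Type v}

theorem edges_rename (r : Pol → Name → Name) (G : Expr S Name) :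
    (G.rename r).edges = G.edges.map fun e => ⟨e.pol, r e.pol e.name⟩ := by
  induction G with
  | one => rfl
  | ident a b => rfl
  | gen φ es => rfl
  | mul G H ihG ihH => simp [rename, edges, ihG, ihH]

theorem aritiesMatch_rename (r : Pol → Name → Name) (G : Expr S Name) :
    (G.rename r).AritiesMatch ↔ G.AritiesMatch := by
  induction G with
  | one => rfl
  | ident a b => rfl
  | gen φ es => simp [rename, AritiesMatch, Function.comp_def]
  | mul G H ihG ihH => exact and_congr ihG ihH

theorem rename_rename (r s : Pol → Name → Name) (G : Expr S Name) :
    (G.rename r).rename s = G.rename fun p n => s p (r p n) := by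
  induction G with
  | one => rfl
  | ident a b => rfl
  | gen φ es => simp [rename]
  | mul G H ihG ihH => simp [rename, ihG, ihH]

theorem rename_congr {r s : Pol → Name → Name} {G : Expr S Name}
    (h : ∀ e ∈ G.edges, r e.pol e.name = s e.pol e.name) : G.rename r = G.rename s := by
  induction G with
  | one => rfl
  | ident a b => simp [edges] at h; simp [rename, h]
  | gen φ es => simpa [rename, edges] using h
  | mul G H ihG ihH =>
    simp only [edges, List.mem_append] at h
    rw [rename, rename, ihG fun e he => h e (.inl he), ihH fun e he => h e (.inr he)]

theorem rename_eq_self {r : Pol → Name → Name} {G : Expr S Name}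
    (h : ∀ e ∈ G.edges, r e.pol e.name = e.name) : G.rename r = G := by
  rw [rename_congr (s := fun _ n => n) h]
  induction G with
  | one => rfl
  | ident a b => rfl
  | gen φ es => simp [rename]
  | mul G H ihG ihH =>
    simp only [edges, List.mem_append] at h
    rw [rename, ihG fun e he => h e (.inl he), ihH fun e he => h e (.inr he)]

theorem WF.rename {r : Pol → Name → Name} {G : Expr S Name} (hG : G.WF)
    (h : ∀ p n k, (⟨p, n⟩ : Edge Name) ∈ G.edges → ⟨p, k⟩ ∈ G.edges → r p n = r p k → n = k) :
    (G.rename r).WF := by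
  refine ⟨(aritiesMatch_rename r G).2 hG.1, ?_⟩
  rw [edges_rename]
  refine List.Nodup.map_on ?_ hG.2
  rintro ⟨p, n⟩ hn ⟨q, k⟩ hk e
  obtain ⟨rfl, e⟩ := (Edge.mk.injEq ..).mp e
  rw [h p n k hn hk e]

/-- Permute all names. -/
def permute (π : Equiv.Perm Name) (G : Expr S Name) : Expr S Name := G.rename fun _ => π

theorem mem_edges_permute {π : Equiv.Perm Name} {G : Expr S Name} {p : Pol} {n : Name} :
    (⟨p, n⟩ : Edge Name) ∈ (G.permute π).edges ↔ ⟨p, π.symm n⟩ ∈ G.edges := by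
  rw [permute, edges_rename, List.mem_map]
  constructor
  · rintro ⟨e, he, h⟩
    obtain ⟨rfl, rfl⟩ := (Edge.mk.injEq ..).mp h
    simpa using he
  · exact fun h => ⟨_, h, by simp⟩

theorem isFree_permute {π : Equiv.Perm Name} {G : Expr S Name} {p : Pol} {n : Name} :
    (G.permute π).IsFree ⟨p, n⟩ ↔ G.IsFree ⟨p, π.symm n⟩ := by
  simp only [IsFree, Edge.flip, mem_edges_permute]

theorem isBound_permute {π : Equiv.Perm Name} {G : Expr S Name} {n : Name} :
    (G.permute π).IsBound n ↔ G.IsBound (π.symm n) := by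
  simp only [IsBound, mem_edges_permute]

theorem WF.permute {G : Expr S Name} (hG : G.WF) (π : Equiv.Perm Name) : (G.permute π).WF :=
  hG.rename fun _ _ _ _ _ h => π.injective h

theorem permute_permute (π τ : Equiv.Perm Name) (G : Expr S Name) :
    (G.permute π).permute τ = G.permute (τ * π) :=
  rename_rename ..

theorem permute_congr {π τ : Equiv.Perm Name} {G : Expr S Name}
    (h : ∀ e ∈ G.edges, π e.name = τ e.name) : G.permute π = G.permute τ :=
  rename_congr h

theorem permute_eq_self {π : Equiv.Perm Name} {G : Expr S Name}
    (h : ∀ e ∈ G.edges, π e.name = e.name) : G.permute π = G :=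
  rename_eq_self h

/-- An edge of an expression is free, or its name is bound. -/
theorem isFree_or_isBound {G : Expr S Name} {e : Edge Name} (h : e ∈ G.edges) :
    G.IsFree e ∨ G.IsBound e.name := by
  by_cases h' : e.flip ∈ G.edges
  · obtain ⟨_ | _, n⟩ := e
    · exact .inr ⟨h, h'⟩
    · exact .inr ⟨h', h⟩
  · exact .inl ⟨h, h'⟩

theorem IsBound.mem {G : Expr S Name} {n : Name} (h : G.IsBound n) (p : Pol) :
    (⟨p, n⟩ : Edge Name) ∈ G.edges := by
  cases p
  exacts [h.1, h.2]

theorem IsBound.not_isFree {G : Expr S Name} {n : Name} (h : G.IsBound n) (p : Pol) :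
    ¬ G.IsFree ⟨p, n⟩ :=
  fun h' => h'.2 (h.mem _)

open Classical in
theorem substName_eq_permute {G : Expr S Name} {a b : Name}
    (hb : ∀ p, (⟨p, b⟩ : Edge Name) ∉ G.edges) :
    G.substName a b = G.permute (Equiv.swap a b) := by
  refine rename_congr fun e he => ?_
  have : e.name ≠ b := fun h => hb e.pol (h ▸ he)
  rw [Equiv.swap_apply_def]
  simp only [this, if_false]

theorem wf_mul {G H : Expr S Name} :
    (mul G H).WF ↔ G.WF ∧ H.WF ∧ ∀ e ∈ G.edges, e ∉ H.edges := by
  simp only [WF, AritiesMatch, edges, List.nodup_append]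
  constructor
  · rintro ⟨⟨h₁, h₂⟩, h₃, h₄, h₅⟩
    exact ⟨⟨h₁, h₃⟩, ⟨h₂, h₄⟩, fun e he he' => h₅ e he e he' rfl⟩
  · rintro ⟨⟨h₁, h₂⟩, ⟨h₃, h₄⟩, h₅⟩
    exact ⟨⟨h₁, h₃⟩, h₂, h₄, fun e he e' he' h => h₅ e he (h ▸ he')⟩

/-- The identity tensor that changes the name of the edge `e` to `a`, when the two are multiplied
with an expression in which `e` is free. -/
def wire (e : Edge Name) (a : Name) : Expr S Name :=
  match e with
  | ⟨.out, b⟩ => ident a b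
  | ⟨.inp, b⟩ => ident b a

theorem mem_edges_wire {e f : Edge Name} {a : Name} :
    f ∈ (wire e a : Expr S Name).edges ↔ f = e.flip ∨ f = ⟨e.pol, a⟩ := by
  obtain ⟨_ | _, n⟩ := e <;> simp [wire, edges, Edge.flip, Pol.flip, or_comm]

theorem mem_edges_substEdge {G : Expr S Name} {e f : Edge Name} {a : Name} (he : e ∈ G.edges) :
    f ∈ (G.substEdge e a).edges ↔ (f ∈ G.edges ∧ f ≠ e) ∨ f = ⟨e.pol, a⟩ := by
  classical
  rw [substEdge, edges_rename, List.mem_map]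
  constructor
  · rintro ⟨e', he', rfl⟩
    by_cases h : e' = e
    · subst h
      exact .inr (by simp)
    · refine .inl ?_
      rw [if_neg h]
      exact ⟨he', h⟩
  · rintro (⟨h, h'⟩ | rfl)
    · exact ⟨f, h, by rw [if_neg h']⟩
    · exact ⟨e, he, by simp⟩

theorem wf_substEdge {G : Expr S Name} {e : Edge Name} {a : Name} (hG : (mul G (wire e a)).WF) :
    (G.substEdge e a).WF := by
  classical
  rw [wf_mul] at hG
  refine hG.1.rename fun p n k hn hk h => ?_
  have ha : (⟨e.pol, a⟩ : Edge Name) ∉ G.edges :=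
    fun h => hG.2.2 _ h (mem_edges_wire.2 (.inr rfl))
  split_ifs at h with h₁ h₂ h₂
  · rw [← h₂] at h₁
    exact ((Edge.mk.injEq ..).mp h₁).2
  · subst h h₁; exact (ha hk).elim
  · subst h h₂; exact (ha hn).elim
  · exact h

theorem isFree_substEdge {G : Expr S Name} {e f : Edge Name} {a : Name}
    (hG : (mul G (wire e a)).WF) (he : G.IsFree e) :
    (mul G (wire e a)).IsFree f ↔ (G.substEdge e a).IsFree f := by
  rw [wf_mul] at hG
  have ha : (⟨e.pol, a⟩ : Edge Name) ∉ G.edges :=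
    fun h => hG.2.2 _ h (mem_edges_wire.2 (.inr rfl))
  simp only [IsFree, mem_edges_substEdge he.1, edges, List.mem_append, mem_edges_wire]
  obtain ⟨he, he'⟩ := he
  obtain ⟨p, n⟩ := e
  obtain ⟨q, k⟩ := f
  cases p <;> cases q <;> simp only [Edge.flip, Pol.flip, Edge.mk.injEq, reduceCtorEq, false_and,
    true_and, ne_eq, or_false, false_or] at * <;> by_cases h₁ : k = n <;> by_cases h₂ : k = a <;>
    simp_all

theorem Equiv.wf_and_free {G H : Expr S Name} (h : Equiv G H) :
    G.WF ∧ H.WF ∧ ∀ e, G.IsFree e ↔ H.IsFree e := by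
  classical
  induction h with
  | refl h => exact ⟨h, h, fun _ => .rfl⟩
  | symm _ ih => exact ⟨ih.2.1, ih.1, fun e => (ih.2.2 e).symm⟩
  | trans _ _ ih ih' => exact ⟨ih.1, ih'.2.1, fun e => (ih.2.2 e).trans (ih'.2.2 e)⟩
  | @mul_congr G H K _ hG hH ih =>
    refine ⟨hG, hH, ?_⟩
    have key {G H : Expr S Name} (hG : (mul G K).WF) (hH : (mul H K).WF)
        (hf : ∀ e, G.IsFree e ↔ H.IsFree e) (e : Edge Name) (h : (mul G K).IsFree e) :
        (mul H K).IsFree e := by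
      rw [wf_mul] at hG hH
      simp only [IsFree, edges, List.mem_append, not_or] at h ⊢
      obtain ⟨h | h, h₁, h₂⟩ := h
      · have := (hf e).1 ⟨h, h₁⟩
        exact ⟨.inl this.1, this.2, h₂⟩
      · refine ⟨.inr h, fun h' => ?_, h₂⟩
        rcases isFree_or_isBound h' with h' | h'
        · exact h₁ ((hf _).2 h').1
        · exact hH.2.2 _ (h'.mem e.pol) h
    exact fun e => ⟨key hG hH ih.2.2 e, key hH hG (fun e => (ih.2.2 e).symm) e⟩
  | assoc h =>
    simp only [wf_mul, edges, List.mem_append] at h ⊢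
    exact ⟨h, ⟨h.1.1, ⟨h.1.2.1, h.2.1, fun e he => h.2.2 e (.inr he)⟩, fun e he h' =>
      h'.elim (h.1.2.2 e he) (h.2.2 e (.inl he))⟩, fun e => by simp [IsFree, edges]⟩
  | comm h =>
    refine ⟨h, ?_, fun e => by simp [IsFree, edges, or_comm]⟩
    rw [wf_mul] at h ⊢
    exact ⟨h.2.1, h.1, fun e he he' => h.2.2 e he' he⟩
  | mul_one h =>
    refine ⟨wf_mul.2 ⟨h, ⟨trivial, List.nodup_nil⟩, fun e _ => List.not_mem_nil⟩, h, ?_⟩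
    simp [IsFree, edges]
  | @rename_bound G a b h ha hb =>
    rw [substName_eq_permute hb]
    refine ⟨h, h.permute _, ?_⟩
    rintro ⟨p, n⟩
    rw [isFree_permute]
    by_cases h₁ : n = a
    · subst h₁
      exact iff_of_false (ha.not_isFree p) fun h => hb p (by simpa using h.1)
    · by_cases h₂ : n = b
      · subst h₂
        refine iff_of_false (fun h => hb p h.1) ?_
        simpa using ha.not_isFree p
      · rw [Equiv.symm_swap, Equiv.swap_apply_of_ne_of_ne h₁ h₂]
  | @contract_inp G a b h hb =>
    exact ⟨h, wf_substEdge (e := ⟨.inp, b⟩) h, fun e => isFree_substEdge (e := ⟨.inp, b⟩) h hb⟩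
  | @contract_out G a b h hb =>
    exact ⟨h, wf_substEdge (e := ⟨.out, b⟩) h, fun e => isFree_substEdge (e := ⟨.out, b⟩) h hb⟩

theorem Equiv.wf {G H : Expr S Name} (h : Equiv G H) : G.WF := h.wf_and_free.1
theorem Equiv.wf' {G H : Expr S Name} (h : Equiv G H) : H.WF := h.wf_and_free.2.1
theorem Equiv.isFree_iff {G H : Expr S Name} (h : Equiv G H) (e : Edge Name) :
    G.IsFree e ↔ H.IsFree e := h.wf_and_free.2.2 e

theorem Equiv.contract {G : Expr S Name} {e : Edge Name} {a : Name} (h : (mul G (wire e a)).WF)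
    (he : G.IsFree e) : Equiv (mul G (wire e a)) (G.substEdge e a) := by
  obtain ⟨_ | _, b⟩ := e
  · exact .contract_out h he
  · exact .contract_inp h he

theorem permute_substEdge (π : Equiv.Perm Name) (G : Expr S Name) (p : Pol) (n a : Name) :
    (G.substEdge ⟨p, n⟩ a).permute π = (G.permute π).substEdge ⟨p, π n⟩ (π a) := by
  classical
  simp only [substEdge, permute, rename_rename]
  refine rename_congr fun e _ => ?_
  simp only [Edge.mk.injEq, π.injective.eq_iff]
  split_ifs <;> rfl

theorem Equiv.permute {G H : Expr S Name} (h : Equiv G H) (π : Equiv.Perm Name) :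
    Equiv (G.permute π) (H.permute π) := by
  induction h with
  | refl h => exact .refl (h.permute π)
  | symm _ ih => exact .symm ih
  | trans _ _ ih ih' => exact .trans ih ih'
  | mul_congr _ hG hH ih => exact .mul_congr ih (hG.permute π) (hH.permute π)
  | assoc h => exact .assoc (h.permute π)
  | comm h => exact .comm (h.permute π)
  | mul_one h => exact .mul_one (h.permute π)
  | @rename_bound G a b h ha hb =>
    classical
    have hb' (p : Pol) : (⟨p, π b⟩ : Edge Name) ∉ (G.permute π).edges := by
      simpa [mem_edges_permute] using hb p
    have := Equiv.rename_bound (h.permute π) (isBound_permute.2 (by simpa using ha)) hb'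
      (a := π a)
    rwa [substName_eq_permute hb', permute_permute, ← Equiv.mul_swap_eq_swap_mul,
      ← permute_permute, ← substName_eq_permute hb] at this
  | @contract_inp G a b h hb =>
    rw [permute_substEdge]
    exact .contract_inp (h.permute π) (isFree_permute.2 (by simpa using hb))
  | @contract_out G a b h hb =>
    rw [permute_substEdge]
    exact .contract_out (h.permute π) (isFree_permute.2 (by simpa using hb))

/-! ### Bound names are arbitrary -/

/-- The permutations of names that are products of transpositions of names outside of `V`. -/
inductive Moves (V : Set Name) : Equiv.Perm Name → Prop
  | one : Moves V 1
  | swap_mul [DecidableEq Name] {a b : Name} {π : Equiv.Perm Name} :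
      a ∉ V → b ∉ V → Moves V π → Moves V (Equiv.swap a b * π)

theorem Moves.apply_eq {V : Set Name} {π : Equiv.Perm Name} (h : Moves V π) {n : Name}
    (hn : n ∈ V) : π n = n := by
  induction h with
  | one => rfl
  | swap_mul ha hb _ ih =>
    rw [Equiv.Perm.mul_apply, ih]
    exact Equiv.swap_apply_of_ne_of_ne (fun h => ha (h ▸ hn)) (fun h => hb (h ▸ hn))

theorem Moves.symm_apply_eq {V : Set Name} {π : Equiv.Perm Name} (h : Moves V π) {n : Name}
    (hn : n ∈ V) : π.symm n = n := by
  rw [Equiv.symm_apply_eq, h.apply_eq hn]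

theorem Moves.mono {V W : Set Name} {π : Equiv.Perm Name} (h : Moves V π) (hW : W ⊆ V) :
    Moves W π := by
  induction h with
  | one => exact .one
  | swap_mul ha hb _ ih => exact .swap_mul (fun h => ha (hW h)) (fun h => hb (hW h)) ih

theorem exists_moves {V : Set Name} {l m : List Name} (hl : l.Nodup) (hm : m.Nodup)
    (h : l.length = m.length) (hlV : ∀ n ∈ l, n ∉ V) (hmV : ∀ n ∈ m, n ∉ V) :
    ∃ π, Moves V π ∧ l.map π = m := by
  classical
  induction l generalizing m with
  | nil =>
    cases m with
    | nil => exact ⟨1, .one, rfl⟩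
    | cons => simp at h
  | cons a l ih =>
    cases m with
    | nil => simp at h
    | cons b m =>
      simp only [List.nodup_cons, List.length_cons, Nat.add_right_cancel_iff, List.forall_mem_cons]
        at hl hm h hlV hmV
      obtain ⟨π, hπ, rfl⟩ := ih hl.2 hm.2 h hlV.2 hmV.2
      have ha : π a ∉ V := fun h => hlV.1 (by
        have := hπ.symm_apply_eq h
        rw [Equiv.symm_apply_apply] at this
        rwa [this])
      refine ⟨Equiv.swap (π a) b * π, .swap_mul ha hmV.1 hπ, ?_⟩
      simp only [List.map_cons, Equiv.Perm.mul_apply, Equiv.swap_apply_left, List.cons.injEq,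
        true_and, List.map_inj_left]
      intro n hn
      refine Equiv.swap_apply_of_ne_of_ne (fun h => hl.1 (π.injective h ▸ hn)) fun h => ?_
      exact hm.1 (h ▸ List.mem_map_of_mem hn)

/-- Distinct fresh names for the elements of a list. -/
theorem exists_fresh [Infinite Name] {α : Type*} (l : List α) {V : Set Name} (hV : V.Finite) :
    ∃ r : α → Name, (∀ a ∈ l, ∀ b ∈ l, r a = r b → a = b) ∧ ∀ a, r a ∉ V := by
  classical
  obtain ⟨y⟩ : Nonempty (ℕ ↪ (Vᶜ : Set Name)) :=
    ⟨hV.infinite_compl.natEmbedding⟩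
  refine ⟨fun a => y (l.idxOf a), fun a ha b _ h => ?_, fun a => (y _).2⟩
  exact (List.idxOf_inj ha).1 (y.injective (Subtype.ext h))

/-- The names that occur in an expression. -/
def names (G : Expr S Name) : Set Name := {n | ∃ p, (⟨p, n⟩ : Edge Name) ∈ G.edges}

theorem finite_names (G : Expr S Name) : G.names.Finite := by
  refine (G.edges.map Edge.name).finite_toSet.subset ?_
  rintro n ⟨p, h⟩
  exact List.mem_map_of_mem (f := Edge.name) h

theorem mem_names {G : Expr S Name} {e : Edge Name} (h : e ∈ G.edges) : e.name ∈ G.names :=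
  ⟨e.pol, h⟩

/-- The names of the free edges of an expression. -/
def freeNames (G : Expr S Name) : Set Name := {n | ∃ p, G.IsFree ⟨p, n⟩}

theorem freeNames_subset (G : Expr S Name) : G.freeNames ⊆ G.names := fun _ ⟨p, h⟩ => ⟨p, h.1⟩

theorem Equiv.freeNames_eq {G H : Expr S Name} (h : Equiv G H) : G.freeNames = H.freeNames := by
  ext n
  exact exists_congr fun p => h.isFree_iff _

theorem IsBound.notMem_freeNames {G : Expr S Name} {n : Name} (h : G.IsBound n) :
    n ∉ G.freeNames := fun ⟨p, h'⟩ => h.not_isFree p h'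

theorem mem_freeNames_or_isBound {G : Expr S Name} {n : Name} (h : n ∈ G.names) :
    n ∈ G.freeNames ∨ G.IsBound n := by
  obtain ⟨p, h⟩ := h
  exact (isFree_or_isBound h).imp_left fun h => ⟨p, h⟩

theorem Equiv.of_swap [Infinite Name] [DecidableEq Name] {G : Expr S Name} (hG : G.WF) {a b : Name}
    (ha : a ∉ G.freeNames) (hb : b ∉ G.freeNames) : Equiv G (G.permute (Equiv.swap a b)) := by
  -- transposing a bound name with a name that does not occur is a renaming of a bound name
  have key {G : Expr S Name} (hG : G.WF) {a b : Name} (ha : G.IsBound a) (hb : b ∉ G.names) :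
      Equiv G (G.permute (Equiv.swap a b)) := by
    have hb' (p : Pol) : (⟨p, b⟩ : Edge Name) ∉ G.edges := fun h => hb ⟨p, h⟩
    have := Equiv.rename_bound hG ha hb'
    rw [substName_eq_permute hb'] at this
    convert this
  by_cases ha' : a ∈ G.names
  · have ha₁ := (mem_freeNames_or_isBound ha').resolve_left ha
    by_cases hb' : b ∈ G.names
    · have hb₁ := (mem_freeNames_or_isBound hb').resolve_left hb
      by_cases hab : a = b
      · subst hab
        rw [Equiv.swap_self]
        exact (permute_eq_self (π := _root_.Equiv.refl _) (G := G) fun _ _ => rfl).symm ▸ .refl hG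
      -- two bound names are transposed through a third name
      · obtain ⟨c, hc⟩ := G.finite_names.infinite_compl.nonempty
        have hca : c ≠ a := fun h => hc (h ▸ ha')
        have hcb : c ≠ b := fun h => hc (h ▸ hb')
        have e₁ := key hG ha₁ hc
        have m₁ (n : Name) : n ∈ (G.permute (Equiv.swap a c)).names ↔
            Equiv.swap a c n ∈ G.names := by
          simp [names, mem_edges_permute]
        have e₂ := key e₁.wf' (a := b) (b := a) (by
          rw [isBound_permute, Equiv.symm_swap, Equiv.swap_apply_of_ne_of_ne (Ne.symm hab) hcb.symm]
          exact hb₁) (by rw [m₁, Equiv.swap_apply_left]; exact hc)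
        have m₂ (n : Name) : n ∈ ((G.permute (Equiv.swap a c)).permute (Equiv.swap b a)).names ↔
            Equiv.swap a c (Equiv.swap b a n) ∈ G.names := by
          simp [names, mem_edges_permute]
        have e₃ := key e₂.wf' (a := c) (b := b) (by
          rw [isBound_permute, isBound_permute, Equiv.symm_swap, Equiv.symm_swap,
            Equiv.swap_apply_of_ne_of_ne hcb hca, Equiv.swap_apply_right]
          exact ha₁) (by rw [m₂, Equiv.swap_apply_left, Equiv.swap_apply_left]; exact hc)
        refine (e₁.trans (e₂.trans e₃)).trans ?_
        rw [permute_permute, permute_permute, permute_congr (τ := Equiv.swap a b)]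
        · exact .refl (hG.permute _)
        · intro e he
          have hec : e.name ≠ c := fun h => hc (h ▸ mem_names he)
          simp only [Equiv.Perm.mul_apply, Equiv.swap_apply_def]
          grind
    · exact key hG ha₁ hb'
  · by_cases hb' : b ∈ G.names
    · rw [Equiv.swap_comm]
      exact key hG ((mem_freeNames_or_isBound hb').resolve_left hb) ha'
    · rw [permute_eq_self]
      · exact .refl hG
      · intro e he
        exact Equiv.swap_apply_of_ne_of_ne (fun h => ha' (h ▸ mem_names he))
          fun h => hb' (h ▸ mem_names he)

/-- Bound names may be permuted at will. -/
theorem Equiv.of_moves [Infinite Name] {G : Expr S Name} (hG : G.WF) {π : Equiv.Perm Name}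
    (hπ : Moves G.freeNames π) : Equiv G (G.permute π) := by
  induction hπ with
  | one => exact (permute_eq_self (π := 1) (G := G) fun _ _ => rfl).symm ▸ .refl hG
  | swap_mul ha hb _ ih =>
    rw [ih.freeNames_eq] at ha hb
    rw [← permute_permute]
    exact ih.trans (.of_swap ih.wf' ha hb)

/-- The bound names can be moved away from any finite set of names. -/
theorem exists_freshen [Infinite Name] {G : Expr S Name} {V : Set Name} (hV : V.Finite) :
    ∃ π, Moves G.freeNames π ∧ ∀ n, (G.permute π).IsBound n → n ∉ V := by
  classical
  let B := ((G.edges.map Edge.name).filter fun n => G.IsBound n).dedup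
  have mem (n : Name) : n ∈ B ↔ G.IsBound n := by
    simp only [B, List.mem_dedup, List.mem_filter, decide_eq_true_eq, and_iff_right_iff_imp]
    exact fun h => List.mem_map_of_mem (f := Edge.name) h.1
  obtain ⟨r, hr, hrV⟩ := exists_fresh B (hV.union G.finite_names)
  obtain ⟨π, hπ, e⟩ := exists_moves (V := G.freeNames) (l := B) (m := B.map r)
    (List.nodup_dedup _) (List.Nodup.map_on hr (List.nodup_dedup _)) (by simp)
    (fun n hn => ((mem n).1 hn).notMem_freeNames) (by
      simp only [List.mem_map]
      rintro _ ⟨n, -, rfl⟩ h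
      exact hrV n (.inr (G.freeNames_subset h)))
  refine ⟨π, hπ, fun n hn => ?_⟩
  rw [isBound_permute, ← mem] at hn
  have := List.map_inj_left.1 e _ hn
  rw [Equiv.apply_symm_apply] at this
  rw [this]
  exact fun h => hrV _ (.inl h)

/-! ### Products of tensor expressions -/

theorem wf_mul_of_free {G G' H : Expr S Name} (h : (mul G H).WF) (hG : Equiv G G')
    (hb : ∀ n, G'.IsBound n → n ∉ H.names) : (mul G' H).WF := by
  rw [wf_mul] at h ⊢
  refine ⟨hG.wf', h.2.1, fun e he he' => ?_⟩
  rcases isFree_or_isBound he with h' | h'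
  · exact h.2.2 e ((hG.isFree_iff e).2 h').1 he'
  · exact hb _ h' (mem_names he')

theorem wf_mul_comm {G H : Expr S Name} (h : (mul G H).WF) : (mul H G).WF := by
  rw [wf_mul] at h ⊢
  exact ⟨h.2.1, h.1, fun e he he' => h.2.2 e he' he⟩

theorem Equiv.mul [Infinite Name] {G H K L : Expr S Name} (hGH : Equiv G H) (hKL : Equiv K L)
    (hGK : (mul G K).WF) (hHL : (mul H L).WF) : Equiv (mul G K) (mul H L) := by
  obtain ⟨π, hπ, hb⟩ := exists_freshen (G := H) (K.finite_names.union L.finite_names)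
  have e := Equiv.of_moves hGH.wf' hπ
  have h₁ := wf_mul_of_free hGK (hGH.trans e) fun n hn h => hb n hn (.inl h)
  have h₂ := wf_mul_of_free hHL e fun n hn h => hb n hn (.inr h)
  refine (Equiv.mul_congr (hGH.trans e) hGK h₁).trans ?_
  refine (Equiv.comm h₁).trans ?_
  refine (Equiv.mul_congr hKL (wf_mul_comm h₁) (wf_mul_comm h₂)).trans ?_
  exact (Equiv.comm (wf_mul_comm h₂)).trans (.mul_congr e.symm h₂ hHL)

/-- The atoms of an expression other than the empty tensor. -/
def factors : Expr S Name → List (Expr S Name)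
  | one => []
  | ident a b => [ident a b]
  | gen φ es => [gen φ es]
  | mul G H => G.factors ++ H.factors

/-- The product of a list of expressions. -/
def prod (l : List (Expr S Name)) : Expr S Name := l.foldr mul one

theorem edges_prod (l : List (Expr S Name)) : (prod l).edges = l.flatMap edges := by
  induction l with
  | nil => rfl
  | cons G l ih => exact congrArg (G.edges ++ ·) ih

theorem aritiesMatch_prod {l : List (Expr S Name)} :
    (prod l).AritiesMatch ↔ ∀ G ∈ l, G.AritiesMatch := by
  induction l with
  | nil => simp [prod, AritiesMatch]
  | cons G l ih =>
    rw [List.forall_mem_cons, ← ih]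
    rfl

theorem wf_prod_perm {l m : List (Expr S Name)} (h : l.Perm m) : (prod l).WF ↔ (prod m).WF := by
  simp only [WF, aritiesMatch_prod, edges_prod, h.mem_iff]
  exact and_congr_right fun _ => (h.flatMap_right _).nodup_iff

theorem edges_prod_factors (G : Expr S Name) : (prod G.factors).edges = G.edges := by
  rw [edges_prod]
  induction G with
  | one => rfl
  | ident a b => rfl
  | gen φ es => simp [factors, edges]
  | mul G H ihG ihH => simp [factors, edges, ihG, ihH]

theorem aritiesMatch_prod_factors {G : Expr S Name} :
    (prod G.factors).AritiesMatch ↔ G.AritiesMatch := by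
  rw [aritiesMatch_prod]
  induction G with
  | one => simp [factors, AritiesMatch]
  | ident a b => simp [factors]
  | gen φ es => simp [factors]
  | mul G H ihG ihH => simp [factors, AritiesMatch, ← ihG, ← ihH, or_imp, forall_and]

theorem wf_prod_factors {G : Expr S Name} : (prod G.factors).WF ↔ G.WF := by
  rw [WF, WF, edges_prod_factors, aritiesMatch_prod_factors]

theorem wf_of_perm {G H : Expr S Name} (h : G.factors.Perm H.factors) (hG : G.WF) : H.WF :=
  wf_prod_factors.1 ((wf_prod_perm h).1 (wf_prod_factors.2 hG))

theorem Equiv.mul_right [Infinite Name] {G H K : Expr S Name} (h : Equiv H K)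
    (h₁ : (Expr.mul G H).WF) (h₂ : (Expr.mul G K).WF) : Equiv (.mul G H) (.mul G K) :=
  .mul (.refl (wf_mul.1 h₁).1) h h₁ h₂

theorem Equiv.prod_append [Infinite Name] {l m : List (Expr S Name)}
    (h : (prod (l ++ m)).WF) : Equiv (prod (l ++ m)) (.mul (prod l) (prod m)) := by
  induction l with
  | nil =>
    refine .trans (.symm (.mul_one h)) (.comm ?_)
    exact wf_mul.2 ⟨h, ⟨trivial, List.nodup_nil⟩, fun e _ => List.not_mem_nil⟩
  | cons G l ih =>
    have h' : (Expr.mul G (prod (l ++ m))).WF := h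
    have e := ih (wf_mul.1 h').2.1
    have h₁ : (Expr.mul (Expr.mul G (prod l)) (prod m)).WF := by
      simp only [wf_mul, edges_prod, edges, List.flatMap_append, List.mem_append] at h' ⊢
      have := wf_mul.1 e.wf'
      rw [edges_prod, edges_prod] at this
      exact ⟨⟨h'.1, this.1, fun e he h => h'.2.2 e he (.inl h)⟩, this.2.1, fun e he h =>
        he.elim (fun he => h'.2.2 e he (.inr h)) fun he => this.2.2 e he h⟩
    exact (Equiv.mul_right e h' (Equiv.assoc h₁).wf').trans (Equiv.assoc h₁).symm

theorem Equiv.prod_perm [Infinite Name] {l m : List (Expr S Name)} (h : l.Perm m)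
    (hl : (prod l).WF) : Equiv (prod l) (prod m) := by
  induction h with
  | nil => exact .refl hl
  | @cons G l m h ih =>
    exact .mul_right (ih (wf_mul.1 hl).2.1) hl ((wf_prod_perm (h.cons G)).1 hl)
  | swap G H l =>
    have h₁ : (Expr.mul (Expr.mul H G) (prod l)).WF := by
      refine wf_of_perm (G := prod (H :: G :: l)) ?_ hl
      simp [prod, factors]
    have h₂ : (Expr.mul (Expr.mul G H) (prod l)).WF := by
      refine wf_of_perm ?_ h₁
      simpa [factors] using List.perm_append_comm_assoc ..
    exact (Equiv.assoc h₁).symm.trans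
      ((Equiv.mul_congr (.comm (wf_mul.1 h₁).1) h₁ h₂).trans (.assoc h₂))
  | trans h _ ih ih' => exact (ih hl).trans (ih' ((wf_prod_perm h).1 hl))

theorem Equiv.prod_factors [Infinite Name] {G : Expr S Name} (h : G.WF) :
    Equiv G (prod G.factors) := by
  induction G with
  | one => exact .refl h
  | ident a b => exact .symm (.mul_one h)
  | gen φ es => exact .symm (.mul_one h)
  | mul G H ihG ihH =>
    have h₁ : (prod (G.factors ++ H.factors)).WF := wf_prod_factors.2 h
    have e := Equiv.prod_append h₁
    exact (Equiv.mul (ihG (wf_mul.1 h).1) (ihH (wf_mul.1 h).2.1) h e.wf').trans e.symm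

/-- Expressions with the same atoms, in any order and with any bracketing, are equivalent. -/
theorem Equiv.of_perm [Infinite Name] {G H : Expr S Name} (hG : G.WF)
    (h : G.factors.Perm H.factors) : Equiv G H :=
  (Equiv.prod_factors hG).trans ((Equiv.prod_perm h (wf_prod_factors.2 hG)).trans
    (Equiv.prod_factors (wf_of_perm h hG)).symm)

/-! ### Products of identity tensors -/

/-- The product of the identity tensors that connect `r e` to `s e`, for the labels `e` in `l`. The
edge `r e` is on the side of the source and so occurs with the direction opposite to that of `e`. -/
def wires {M : Type*} (r s : Edge M → Name) (l : List (Edge M)) : Expr S Name :=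
  prod (l.map fun e => wire ⟨e.pol, r e⟩ (s e))

theorem mem_edges_wires {M : Type*} {r s : Edge M → Name} {l : List (Edge M)} {f : Edge Name} :
    f ∈ (wires r s l : Expr S Name).edges ↔
      ∃ e ∈ l, f = ⟨e.pol.flip, r e⟩ ∨ f = ⟨e.pol, s e⟩ := by
  simp only [wires, edges_prod, List.mem_flatMap, List.mem_map]
  constructor
  · rintro ⟨_, ⟨e, he, rfl⟩, h⟩
    exact ⟨e, he, mem_edges_wire.1 h⟩
  · rintro ⟨e, he, h⟩
    exact ⟨_, ⟨e, he, rfl⟩, mem_edges_wire.2 h⟩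

theorem factors_wire (e : Edge Name) (a : Name) :
    (wire e a : Expr S Name).factors = [wire e a] := by
  obtain ⟨_ | _, n⟩ := e <;> rfl

theorem factors_wires {M : Type*} (r s : Edge M → Name) (l : List (Edge M)) :
    (wires r s l : Expr S Name).factors = l.map fun e => wire ⟨e.pol, r e⟩ (s e) := by
  induction l with
  | nil => rfl
  | cons e l ih => exact congrArg₂ (· ++ ·) (factors_wire ..) ih

theorem wires_cons {M : Type*} (r s : Edge M → Name) (e : Edge M) (l : List (Edge M)) :
    (wires r s (e :: l) : Expr S Name) = mul (wire ⟨e.pol, r e⟩ (s e)) (wires r s l) := rfl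

theorem wf_wire {e : Edge Name} {a : Name} : (wire e a : Expr S Name).WF := by
  obtain ⟨_ | _, n⟩ := e <;> exact ⟨trivial, by simp [wire, edges]⟩

/-- Multiplying with identity tensors renames free edges. -/
theorem Equiv.contract_wires [Infinite Name] {M : Type*} {r s : Edge M → Name} {l : List (Edge M)}
    {G : Expr S Name} {t : Pol → Name → Name} (h : (Expr.mul G (wires r s l)).WF)
    (hf : ∀ e ∈ l, G.IsFree ⟨e.pol, r e⟩) (ht : ∀ e ∈ l, t e.pol (r e) = s e)
    (ht' : ∀ e ∈ G.edges, (∀ f ∈ l, e ≠ ⟨f.pol, r f⟩) → t e.pol e.name = e.name) :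
    Equiv (.mul G (wires r s l)) (G.rename t) := by
  classical
  induction l generalizing G t with
  | nil =>
    rw [rename_eq_self fun e he => ht' e he fun _ h => by simp at h]
    exact .mul_one (wf_mul.1 h).1
  | cons m l ih =>
    rw [wires_cons] at h
    simp only [List.forall_mem_cons] at hf ht ht'
    set w : Expr S Name := wire ⟨m.pol, r m⟩ (s m) with hw
    have h₁ : (Expr.mul (Expr.mul G w) (wires r s l)).WF :=
      wf_of_perm (by simp [factors]) h
    have h₂ := (wf_mul.1 h₁).1
    set G' := G.substEdge ⟨m.pol, r m⟩ (s m) with hG'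
    have e₁ : Equiv (Expr.mul G w) G' := Equiv.contract h₂ hf.1
    have hmem {e : Edge Name} : e ∈ G'.edges ↔
        (e ∈ G.edges ∧ e ≠ ⟨m.pol, r m⟩) ∨ e = ⟨m.pol, s m⟩ := mem_edges_substEdge hf.1.1
    obtain ⟨-, hW, hdisj⟩ := wf_mul.1 h₁
    obtain ⟨-, -, hdisj'⟩ := wf_mul.1 h₂
    have hs : (⟨m.pol, s m⟩ : Edge Name) ∈ w.edges := mem_edges_wire.2 (.inr rfl)
    have hr : (⟨m.pol.flip, r m⟩ : Edge Name) ∈ w.edges := mem_edges_wire.2 (.inl rfl)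
    have hGw {e : Edge Name} : e ∈ (Expr.mul G w).edges ↔ e ∈ G.edges ∨ e ∈ w.edges :=
      List.mem_append
    have h₃ : (Expr.mul G' (wires r s l)).WF := by
      refine wf_mul.2 ⟨e₁.wf', hW, fun e he => hdisj e (hGw.2 ?_)⟩
      rcases hmem.1 he with he | rfl
      exacts [.inl he.1, .inr hs]
    have hflip {e : Edge M} (he : e ∈ l) :
        (⟨e.pol.flip, r e⟩ : Edge Name) ∈ (wires r s l : Expr S Name).edges :=
      mem_edges_wires.2 ⟨e, he, .inl rfl⟩
    have hne {e : Edge M} (he : e ∈ l) : (⟨e.pol, r e⟩ : Edge Name) ≠ ⟨m.pol, r m⟩ := by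
      intro h
      obtain ⟨h₄, h₅⟩ := (Edge.mk.injEq ..).mp h
      refine hdisj _ (hGw.2 (.inr hr)) ?_
      rw [← h₄, ← h₅]
      exact hflip he
    have key : G'.rename (fun p n => if p = m.pol ∧ n = s m then n else t p n) = G.rename t := by
      rw [hG', substEdge, rename_rename]
      refine rename_congr fun e he => ?_
      by_cases h : e = ⟨m.pol, r m⟩
      · subst h
        simp [ht.1]
      · have h' : (⟨e.pol, e.name⟩ : Edge Name) ≠ ⟨m.pol, r m⟩ := h
        simp only [if_neg h']
        rw [if_neg]
        rintro ⟨h₄, h₅⟩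
        refine hdisj' _ he ?_
        have : e = ⟨m.pol, s m⟩ := by rw [← h₄, ← h₅]
        rwa [this]
    rw [← key]
    refine (Equiv.of_perm h (H := Expr.mul (Expr.mul G w) (wires r s l)) ?_).trans
      ((Equiv.mul_congr e₁ h₁ h₃).trans (ih h₃ ?_ ?_ ?_))
    · simp [factors, w]
    · intro e he
      refine ⟨hmem.2 (.inl ⟨(hf.2 e he).1, hne he⟩), fun h => ?_⟩
      rcases hmem.1 h with h | h
      · exact (hf.2 e he).2 h.1
      · exact hdisj _ (hGw.2 (.inr hs)) (h ▸ hflip he)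
    · intro e he
      rw [if_neg, ht.2 e he]
      rintro ⟨h, h'⟩
      refine hdisj' _ (hf.2 e he).1 ?_
      rw [h, h']
      exact hs
    · intro e he hel
      split_ifs with h
      · rfl
      · rcases hmem.1 he with he | rfl
        · exact ht' e he.1 ⟨he.2, hel⟩
        · exact (h ⟨rfl, rfl⟩).elim

end Expr

/-! ### The point of a tensor expression -/

section Sound

variable {S : Signature.{u}} {Name : Type v}

open Mor

theorem Contr.map {N N' : Type*} (g : N → N') {l m : List (Edge N)} {f : Mor S}
    (h : Contr l m f) :
    Contr (l.map fun e => (⟨e.pol, g e.name⟩ : Edge N')) (m.map fun e => ⟨e.pol, g e.name⟩) f := by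
  induction h with
  | id l => simpa [Function.comp_def] using Contr.id (S := S) (l.map fun e => ⟨e.pol, g e.name⟩)
  | symm l m =>
    simpa [Function.comp_def] using Contr.symm (S := S) (l.map fun e => ⟨e.pol, g e.name⟩)
      (m.map fun e => ⟨e.pol, g e.name⟩)
  | cap a => exact .cap (g a)
  | comp _ _ ih ih' => exact .comp ih ih'
  | tens _ _ ih ih' => simpa using Contr.tens ih ih'

theorem freeIn_append {A L K l : List (Edge Name)} (h : (A ++ (L ++ K)).Nodup)
    (hl : ∀ e, e ∈ l ↔ FreeIn L e) (e : Edge Name) :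
    FreeIn (A ++ (l ++ K)) e ↔ FreeIn (A ++ (L ++ K)) e := by
  have h₁ : ∀ e ∈ L, e ∉ A ∧ e ∉ K := by
    intro e he
    simp only [List.nodup_append, List.mem_append] at h
    exact ⟨fun h' => h.2.2 e h' e (.inl he) rfl, fun h' => h.2.1.2.2 e he e h' rfl⟩
  have h₂ := h₁ e
  have h₃ := h₁ e.flip
  have h₄ := hl e
  have h₅ := hl e.flip
  simp only [FreeIn, List.mem_append, Edge.flip_flip] at *
  tauto

theorem nodup_append_free {A L K l : List (Edge Name)} (h : (A ++ (L ++ K)).Nodup)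
    (hl : l.Nodup) (hl' : ∀ e, e ∈ l ↔ FreeIn L e) : (A ++ (l ++ K)).Nodup := by
  simp only [List.nodup_append, List.mem_append] at h ⊢
  have h' : ∀ e ∈ l, e ∈ L := fun e he => ((hl' e).1 he).1
  refine ⟨h.1, ⟨hl, h.2.1.2.1, fun a ha => h.2.1.2.2 a (h' a ha)⟩, fun a ha b hb => ?_⟩
  exact h.2.2 a ha b (hb.imp_left (h' b))

/-- Contracting a part of the wires first makes no difference: if two morphisms agree after
contraction, so do their tensor products with other morphisms. -/
theorem Contr.comp_congr {A L L' K l m : List (Edge Name)} {f k p q c₀ c₀' c c' : Mor S}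
    (hf : f.cod = A.map Edge.pol)
    (hp : p.cod = L.map Edge.pol) (hq : q.cod = L'.map Edge.pol)
    (hL : (A ++ (L ++ K)).Nodup) (hL' : (A ++ (L' ++ K)).Nodup)
    (hl : l.Nodup) (hlL : ∀ e, e ∈ l ↔ FreeIn L e)
    (h₀ : Contr L l c₀) (h₀' : Contr L' l c₀') (e₀ : p ≫ₘ c₀ = q ≫ₘ c₀')
    (hm : m.Nodup) (hmL : ∀ e, e ∈ m ↔ FreeIn (A ++ (L ++ K)) e)
    (hc : Contr (A ++ (L ++ K)) m c) (hc' : Contr (A ++ (L' ++ K)) m c') :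
    (f ⊗ₘ p ⊗ₘ k) ≫ₘ c = (f ⊗ₘ q ⊗ₘ k) ≫ₘ c' := by
  obtain ⟨c₁, h₁⟩ := exists_contr (S := S) (nodup_append_free hL hl hlL) hm
    fun e => (hmL e).trans (freeIn_append hL hlL e).symm
  rw [hc.unique hL ((Contr.tens (.id A) (.tens h₀ (.id K))).comp h₁),
    hc'.unique hL' ((Contr.tens (.id A) (.tens h₀' (.id K))).comp h₁), ← Mor.assoc, ← Mor.assoc,
    interchange (by simp [hf]), interchange (by simp [hp, h₀.dom]), interchange (by simp [hf]),
    interchange (by simp [hq, h₀'.dom]), e₀]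

/-- The wire that leads from an input through a cup and a cap to the new input is straightened. -/
theorem exists_contr_snake_inp (L₁ L₂ : List (Edge Name)) (a b : Name) :
    ∃ c : Mor S, Contr ((L₁ ++ ⟨.inp, b⟩ :: L₂) ++ [⟨.out, b⟩, ⟨.inp, a⟩])
        (L₁ ++ ⟨.inp, a⟩ :: L₂) c ∧
      (Mor.id ((L₁ ++ ⟨.inp, b⟩ :: L₂).map Edge.pol) ⊗ₘ Mor.cup) ≫ₘ c =
        Mor.id ((L₁ ++ ⟨.inp, b⟩ :: L₂).map Edge.pol) := by
  refine ⟨Mor.id (L₁.map Edge.pol) ⊗ₘ ((Mor.id [.inp] ⊗ₘ Mor.symm (L₂.map Edge.pol) [.out, .inp]) ≫ₘ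
    (Mor.cap ⊗ₘ Mor.id (.inp :: L₂.map Edge.pol))), ?_, ?_⟩
  · have h := (Contr.id (S := S) L₁).tens (((Contr.id [⟨.inp, b⟩]).tens
      (.symm L₂ [⟨.out, b⟩, ⟨.inp, a⟩])).comp ((Contr.cap b).tens (.id (⟨.inp, a⟩ :: L₂))))
    simpa using h
  · have e₁ : (Mor.id (.inp :: L₂.map Edge.pol) : Mor S) =
        Mor.id [.inp] ⊗ₘ Mor.id (L₂.map Edge.pol) := (Mor.tens_id [_] _).symm
    have e₂ := symm_natural_right (S := S) (c := L₂.map Edge.pol) Mor.cup dom_cup cod_cup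
    rw [symm_nil, id_comp (by simp)] at e₂
    rw [List.map_append, List.map_cons, ← Mor.tens_id, e₁, Mor.tens_assoc, Mor.tens_assoc,
      interchange (by simp), ← Mor.assoc, interchange (by simp), e₂, ← Mor.tens_assoc,
      ← Mor.tens_assoc, interchange (by simp), id_comp (by simp),
      id_comp (dom_id [Pol.inp]), snake', id_comp (by simp)]

/-- The wire that leads from an output through a cap and a cup to the new output is
straightened. -/
theorem exists_contr_snake_out (L₁ L₂ : List (Edge Name)) (a b : Name) :
    ∃ c : Mor S, Contr ((L₁ ++ ⟨.out, b⟩ :: L₂) ++ [⟨.out, a⟩, ⟨.inp, b⟩])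
        (L₁ ++ ⟨.out, a⟩ :: L₂) c ∧
      (Mor.id ((L₁ ++ ⟨.out, b⟩ :: L₂).map Edge.pol) ⊗ₘ Mor.cup) ≫ₘ c =
        Mor.id ((L₁ ++ ⟨.out, b⟩ :: L₂).map Edge.pol) := by
  refine ⟨Mor.id (L₁.map Edge.pol) ⊗ₘ (Mor.symm (.out :: L₂.map Edge.pol) [.out, .inp] ≫ₘ
    (Mor.id [.out] ⊗ₘ Mor.cap ⊗ₘ Mor.id (L₂.map Edge.pol))), ?_, ?_⟩
  · have h := (Contr.id (S := S) L₁).tens ((Contr.symm (⟨.out, b⟩ :: L₂)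
      [⟨.out, a⟩, ⟨.inp, b⟩]).comp ((Contr.id [⟨.out, a⟩]).tens ((Contr.cap b).tens (.id L₂))))
    simpa using h
  · have e₁ : (Mor.id (.out :: L₂.map Edge.pol) : Mor S) =
        Mor.id [.out] ⊗ₘ Mor.id (L₂.map Edge.pol) := (Mor.tens_id [_] _).symm
    have e₂ := symm_natural_right (S := S) (c := .out :: L₂.map Edge.pol) Mor.cup dom_cup cod_cup
    rw [symm_nil, id_comp (by simp)] at e₂
    rw [List.map_append, List.map_cons, ← Mor.tens_id, Mor.tens_assoc, interchange (by simp),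
      ← Mor.assoc]
    erw [e₂]
    rw [e₁, ← Mor.tens_assoc, ← Mor.tens_assoc, interchange (by simp), snake, id_comp (by simp),
      id_comp (by simp)]

namespace Expr

theorem base_rename (r : Pol → Name → Name) (G : Expr S Name) : (G.rename r).base = G.base := by
  induction G with
  | one => rfl
  | ident a b => rfl
  | gen φ es => rfl
  | mul G H ihG ihH => exact congrArg₂ Term.tens ihG ihH

theorem dom_base {G : Expr S Name} (hG : G.AritiesMatch) : (Mor.mk G.base).dom = [] :=
  (hasType_base G hG).dom_eq

theorem cod_base {G : Expr S Name} (hG : G.AritiesMatch) :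
    (Mor.mk G.base).cod = G.edges.map Edge.pol :=
  (hasType_base G hG).cod_eq

theorem edges_substEdge {G : Expr S Name} {e : Edge Name} {L₁ L₂ : List (Edge Name)}
    (hG : G.edges.Nodup) (h : G.edges = L₁ ++ e :: L₂) (a : Name) :
    (G.substEdge e a).edges = L₁ ++ ⟨e.pol, a⟩ :: L₂ := by
  classical
  rw [h, List.nodup_middle, List.nodup_cons, List.mem_append, not_or] at hG
  have key (L : List (Edge Name)) (hL : e ∉ L) : L.map (fun f => (⟨f.pol,
      if (⟨f.pol, f.name⟩ : Edge Name) = e then a else f.name⟩ : Edge Name)) = L := by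
    refine (List.map_congr_left fun f hf => ?_).trans (List.map_id L)
    have : f ≠ e := fun h => hL (h ▸ hf)
    rw [if_neg this]
    rfl
  rw [substEdge, edges_rename, h, List.map_append, List.map_cons, key L₁ hG.1.1, key L₂ hG.1.2]
  simp

theorem sound_contract {G : Expr S Name} {e : Edge Name} {a : Name} {L₁ L₂ l : List (Edge Name)}
    {f c c' s : Mor S} {t : List (Edge Name)}
    (hG : G.AritiesMatch) (hL : G.edges = L₁ ++ e :: L₂) (hnd : (G.edges ++ t).Nodup)
    (hf : f.dom = [])
    (hs : Contr ((L₁ ++ e :: L₂) ++ t) (L₁ ++ ⟨e.pol, a⟩ :: L₂) s)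
    (hs' : (Mor.id ((L₁ ++ e :: L₂).map Edge.pol) ⊗ₘ f) ≫ₘ s =
      Mor.id ((L₁ ++ e :: L₂).map Edge.pol))
    (hc : Contr (G.edges ++ t) l c) (hc' : Contr (G.substEdge e a).edges l c') :
    (Mor.mk G.base ⊗ₘ f) ≫ₘ c = Mor.mk (G.substEdge e a).base ≫ₘ c' := by
  have hnd' := (List.nodup_append.1 hnd).1
  rw [edges_substEdge hnd' hL] at hc'
  have hbase : (G.substEdge e a).base = G.base := base_rename ..
  have hd := cod_base hG
  rw [hL] at hc hnd hd
  rw [hbase, hc.unique hnd (hs.comp hc'), ← Mor.assoc, tens_eq_comp _ _ hd hf, tens_unit, Mor.assoc, Mor.assoc,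
    ← Mor.assoc (Mor.id _ ⊗ₘ f), hs', ← Mor.assoc, comp_id hd]

/-- Equivalent expressions have the same point. -/
theorem Equiv.sound {G H : Expr S Name} (h : Equiv G H) : ∀ {l : List (Edge Name)} {c c' : Mor S},
    l.Nodup → (∀ e, e ∈ l ↔ G.IsFree e) → Contr G.edges l c → Contr H.edges l c' →
    Mor.mk G.base ≫ₘ c = Mor.mk H.base ≫ₘ c' := by
  induction h with
  | refl h =>
    intro l c c' _ _ hc hc'
    rw [hc.unique h.2 hc']
  | symm h ih =>
    intro l c c' hl hf hc hc'
    exact (ih hl (fun e => (hf e).trans (h.isFree_iff e).symm) hc' hc).symm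
  | trans h h' ih ih' =>
    intro l c c' hl hf hc hc'
    have hf' := fun e => (hf e).trans (h.isFree_iff e)
    obtain ⟨d, hd⟩ := exists_contr (S := S) h.wf'.2 hl hf'
    exact (ih hl hf hc hd).trans (ih' hl hf' hd hc')
  | @mul_congr G H K h hG hH ih =>
    classical
    intro l c c' hl hf hc hc'
    -- the free edges of `G` and `H`, in some order
    let g := G.edges.filter fun e => e.flip ∉ G.edges
    have hg : g.Nodup := hG.2.of_append_left.filter _
    have hgf : ∀ e, e ∈ g ↔ G.IsFree e := by simp [g, IsFree]
    have hgf' := fun e => (hgf e).trans (h.isFree_iff e)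
    obtain ⟨d, hd⟩ := exists_contr (S := S) h.wf.2 hg hgf
    obtain ⟨d', hd'⟩ := exists_contr (S := S) h.wf'.2 hg hgf'
    have := Contr.comp_congr (f := Mor.id []) (k := Mor.mk K.base) (A := []) rfl (cod_base hG.1.1)
      (cod_base hH.1.1) hG.2 hH.2 hg hgf hd hd' (ih hg hgf hd hd') hl hf hc hc'
    rwa [unit_tens, unit_tens] at this
  | @assoc G H K h =>
    intro l c c' _ _ hc hc'
    have e : (Expr.mul (Expr.mul G H) K).edges = (Expr.mul G (Expr.mul H K)).edges :=
      List.append_assoc ..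
    rw [← e] at hc'
    rw [hc.unique h.2 hc']
    exact congrArg (· ≫ₘ c') (Mor.tens_assoc (Mor.mk G.base) (Mor.mk H.base) (Mor.mk K.base))
  | @comm G H h =>
    intro l c c' _ _ hc hc'
    rw [hc.unique h.2 ((Contr.symm _ _).comp hc'), ← Mor.assoc]
    refine congrArg (· ≫ₘ c') ?_
    refine (symm_natural (Mor.mk G.base) (Mor.mk H.base) (cod_base h.1.1) (cod_base h.1.2)
      (dom_base h.1.1) (dom_base h.1.2)).trans ?_
    rw [symm_nil, id_comp]
    · rfl
    · rw [dom_tens, dom_base h.1.1, dom_base h.1.2]; rfl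
  | @mul_one G h =>
    intro l c c' _ _ hc hc'
    have e : (Expr.mul G one).edges = G.edges := List.append_nil _
    rw [e] at hc
    rw [hc.unique h.2 hc']
    exact congrArg (· ≫ₘ c') (tens_unit (Mor.mk G.base))
  | @rename_bound G a b h ha hb =>
    classical
    intro l c c' _ hf hc hc'
    have e : (G.substName a b).base = G.base := base_rename ..
    rw [e]
    congr 1
    have hc₁ := hc.map fun n => if n = a then b else n
    refine Contr.unique (m := l) ?_ ?_ hc'
    · exact (Equiv.rename_bound h ha hb).wf'.2
    · rw [substName, edges_rename]
      convert hc₁ using 1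
      refine (List.map_id l).symm.trans (List.map_congr_left fun e he => ?_)
      have : e.name ≠ a := fun h => ha.not_isFree e.pol (h ▸ (hf e).1 he)
      rw [if_neg this]
      rfl
  | @contract_inp G a b h hb =>
    intro l c c' _ _ hc hc'
    obtain ⟨L₁, L₂, hL⟩ := List.append_of_mem hb.1
    obtain ⟨s, hs, hs'⟩ := exists_contr_snake_inp (S := S) L₁ L₂ a b
    exact sound_contract h.1.1 hL h.2 rfl hs hs' hc hc'
  | @contract_out G a b h hb =>
    intro l c c' _ _ hc hc'
    obtain ⟨L₁, L₂, hL⟩ := List.append_of_mem hb.1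
    obtain ⟨s, hs, hs'⟩ := exists_contr_snake_out (S := S) L₁ L₂ a b
    exact sound_contract h.1.1 hL h.2 rfl hs hs' hc hc'

/-- Equivalent expressions whose inputs `A` have been bent down denote the same morphism. -/
theorem Equiv.sound_tens {G H : Expr S Name} (h : Equiv G H) {A l : List (Edge Name)} {c c' : Mor S}
    (hG : (A ++ G.edges).Nodup) (hH : (A ++ H.edges).Nodup)
    (hl : l.Nodup) (hf : ∀ e, e ∈ l ↔ FreeIn (A ++ G.edges) e)
    (hc : Contr (A ++ G.edges) l c) (hc' : Contr (A ++ H.edges) l c') :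
    (Mor.id (A.map Edge.pol) ⊗ₘ Mor.mk G.base) ≫ₘ c =
      (Mor.id (A.map Edge.pol) ⊗ₘ Mor.mk H.base) ≫ₘ c' := by
  classical
  let g := G.edges.filter fun e => e.flip ∉ G.edges
  have hg : g.Nodup := h.wf.2.filter _
  have hgf : ∀ e, e ∈ g ↔ G.IsFree e := by simp [g, IsFree]
  have hgf' := fun e => (hgf e).trans (h.isFree_iff e)
  obtain ⟨d, hd⟩ := exists_contr (S := S) h.wf.2 hg hgf
  obtain ⟨d', hd'⟩ := exists_contr (S := S) h.wf'.2 hg hgf'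
  have := Contr.comp_congr (k := Mor.id []) (K := []) (A := A) (f := Mor.id (A.map Edge.pol))
    rfl (cod_base h.wf.1) (cod_base h.wf'.1) (by simpa using hG) (by simpa using hH) hg hgf hd hd'
    (h.sound hg hgf hd hd') hl (by simpa using hf) (by simpa using hc) (by simpa using hc')
  rwa [tens_unit, tens_unit] at this

end Expr

end Sound

/-! ### The tensors that represent a morphism -/

namespace Expr

variable {S : Signature.{u}} {Name : Type v}

/-- The edge with the direction of the label `e` and the name `r e`. -/
def relabel {M : Type*} (r : Edge M → Name) (e : Edge M) : Edge Name := ⟨e.pol, r e⟩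

/-- The names of the edges are distinct. -/
def DistinctNames (A : List (Edge Name)) : Prop := (A.map Edge.name).Nodup

theorem distinctNames_append {A B : List (Edge Name)} :
    DistinctNames (A ++ B) ↔
      DistinctNames A ∧ DistinctNames B ∧ ∀ a ∈ A, ∀ b ∈ B, a.name ≠ b.name := by
  simp [DistinctNames, List.nodup_append]

theorem DistinctNames.eq {A : List (Edge Name)} (h : DistinctNames A) {a b : Edge Name}
    (ha : a ∈ A) (hb : b ∈ A) (e : a.name = b.name) : a = b :=
  List.inj_on_of_nodup_map h ha hb e

theorem DistinctNames.perm {A B : List (Edge Name)} (h : DistinctNames A) (hp : A.Perm B) :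
    DistinctNames B := ((hp.map _).nodup_iff).1 h

theorem DistinctNames.flip_notMem {A : List (Edge Name)} (h : DistinctNames A) {a : Edge Name}
    (ha : a ∈ A) : a.flip ∉ A :=
  fun h' => Edge.flip_ne a (h.eq h' ha rfl)

/-- `Rep f A B K` : the tensor `K`, with the free edges `B` and the opposites of `A`, represents the
morphism `f` from the word of `A` to the word of `B`. The names in `A` and `B` are distinct. A
composite is represented by a product in which the edges in the middle have become bound. -/
def Rep : Term S → List (Edge Name) → List (Edge Name) → Expr S Name → Prop
  | .id a, A, B, K => DistinctNames (A ++ B) ∧ ∃ l : List (Edge (Name × Name)),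
      l.map Edge.pol = a ∧ A = l.map (relabel fun e => e.name.1) ∧
      B = l.map (relabel fun e => e.name.2) ∧
      Equiv K (wires (fun e => e.name.1) (fun e => e.name.2) l)
  | .comp f g, A, C, K => DistinctNames (A ++ C) ∧ ∃ B F G,
      Rep f A B F ∧ Rep g B C G ∧ (mul F G).WF ∧ Equiv K (mul F G)
  | .tens f g, A, B, K => DistinctNames (A ++ B) ∧ ∃ A₁ A₂ B₁ B₂ F G,
      A = A₁ ++ A₂ ∧ B = B₁ ++ B₂ ∧ Rep f A₁ B₁ F ∧ Rep g A₂ B₂ G ∧ (mul F G).WF ∧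
      Equiv K (mul F G)
  | .symm a b, A, B, K => DistinctNames (A ++ B) ∧ ∃ l m : List (Edge (Name × Name)),
      l.map Edge.pol = a ∧ m.map Edge.pol = b ∧ A = (l ++ m).map (relabel fun e => e.name.1) ∧
      B = (m ++ l).map (relabel fun e => e.name.2) ∧
      Equiv K (wires (fun e => e.name.1) (fun e => e.name.2) (l ++ m))
  | .cup, A, B, K => DistinctNames (A ++ B) ∧ ∃ a b,
      A = [] ∧ B = [⟨.out, a⟩, ⟨.inp, b⟩] ∧ Equiv K (ident a b)
  | .cap, A, B, K => DistinctNames (A ++ B) ∧ ∃ a b,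
      A = [⟨.inp, a⟩, ⟨.out, b⟩] ∧ B = [] ∧ Equiv K (ident a b)
  | .gen φ, A, B, K => DistinctNames (A ++ B) ∧
      A = [] ∧ B.map Edge.pol = S.arity φ ∧ Equiv K (gen φ B)

variable {f g : Term S} {A B C : List (Edge Name)} {F G H K : Expr S Name}

theorem Rep.distinct (h : Rep f A B K) : DistinctNames (A ++ B) := by
  cases f <;> exact h.1

theorem Rep.wf (h : Rep f A B K) : K.WF := by
  cases f
  · obtain ⟨-, l, -, -, -, h⟩ := h; exact h.wf
  · obtain ⟨-, _, _, _, -, -, -, h⟩ := h; exact h.wf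
  · obtain ⟨-, _, _, _, _, _, _, -, -, -, -, -, h⟩ := h; exact h.wf
  · obtain ⟨-, _, _, -, -, -, -, h⟩ := h; exact h.wf
  · obtain ⟨-, _, _, -, -, h⟩ := h; exact h.wf
  · obtain ⟨-, _, _, -, -, h⟩ := h; exact h.wf
  · obtain ⟨-, -, -, h⟩ := h; exact h.wf

theorem Rep.congr (h : Rep f A B K) (e : Equiv K H) : Rep f A B H := by
  cases f
  · obtain ⟨h₁, l, h₂, h₃, h₄, h⟩ := h
    exact ⟨h₁, l, h₂, h₃, h₄, e.symm.trans h⟩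
  · obtain ⟨h₁, B, F, G, h₂, h₃, h₄, h⟩ := h
    exact ⟨h₁, B, F, G, h₂, h₃, h₄, e.symm.trans h⟩
  · obtain ⟨h₁, A₁, A₂, B₁, B₂, F, G, h₂, h₃, h₄, h₅, h₆, h⟩ := h
    exact ⟨h₁, A₁, A₂, B₁, B₂, F, G, h₂, h₃, h₄, h₅, h₆, e.symm.trans h⟩
  · obtain ⟨h₁, l, m, h₂, h₃, h₄, h₅, h⟩ := h
    exact ⟨h₁, l, m, h₂, h₃, h₄, h₅, e.symm.trans h⟩
  · obtain ⟨h₁, a, b, h₂, h₃, h⟩ := h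
    exact ⟨h₁, a, b, h₂, h₃, e.symm.trans h⟩
  · obtain ⟨h₁, a, b, h₂, h₃, h⟩ := h
    exact ⟨h₁, a, b, h₂, h₃, e.symm.trans h⟩
  · obtain ⟨h₁, h₂, h₃, h⟩ := h
    exact ⟨h₁, h₂, h₃, e.symm.trans h⟩

theorem map_pol_relabel {M : Type*} (r : Edge M → Name) (l : List (Edge M)) :
    (l.map (relabel r)).map Edge.pol = l.map Edge.pol := by
  simp [relabel, Function.comp_def]

theorem Rep.hasType (h : Rep f A B K) : HasType f (A.map Edge.pol) (B.map Edge.pol) := by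
  induction f generalizing A B K with
  | id a =>
    obtain ⟨-, l, rfl, rfl, rfl, -⟩ := h
    simpa only [map_pol_relabel] using HasType.id _
  | comp f g ihf ihg =>
    obtain ⟨-, B, F, G, hF, hG, -⟩ := h
    exact .comp (ihf hF) (ihg hG)
  | tens f g ihf ihg =>
    obtain ⟨-, A₁, A₂, B₁, B₂, F, G, rfl, rfl, hF, hG, -⟩ := h
    simpa using HasType.tens (ihf hF) (ihg hG)
  | symm a b =>
    obtain ⟨-, l, m, rfl, rfl, rfl, rfl, -⟩ := h
    simpa only [map_pol_relabel, List.map_append] using HasType.symm _ _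
  | cup =>
    obtain ⟨-, a, b, rfl, rfl, -⟩ := h
    exact .cup
  | cap =>
    obtain ⟨-, a, b, rfl, rfl, -⟩ := h
    exact .cap
  | gen φ =>
    obtain ⟨-, rfl, h, -⟩ := h
    exact h ▸ .gen φ

theorem isFree_mul (h : (mul F G).WF) (e : Edge Name) : (mul F G).IsFree e ↔
    (F.IsFree e ∧ ¬ G.IsFree e.flip) ∨ (G.IsFree e ∧ ¬ F.IsFree e.flip) := by
  have h₁ := (wf_mul.1 h).2.2 e
  simp only [IsFree, edges, List.mem_append, Edge.flip_flip]
  tauto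

theorem isFree_of_mem_edges (h : DistinctNames (A ++ B))
    (hK : ∀ e, e ∈ K.edges ↔ e.flip ∈ A ∨ e ∈ B) (e : Edge Name) :
    K.IsFree e ↔ e.flip ∈ A ∨ e ∈ B := by
  rw [IsFree, hK, hK, Edge.flip_flip, and_iff_left_iff_imp]
  rw [distinctNames_append] at h
  rintro (h₁ | h₁) (h₂ | h₂)
  · exact h.1.flip_notMem h₂ h₁
  · exact h.2.2 _ h₁ _ h₂ rfl
  · exact h.2.2 _ h₂ _ h₁ rfl
  · exact h.2.1.flip_notMem h₁ h₂

theorem mem_edges_wires' {M : Type*} {r s : Edge M → Name} {l : List (Edge M)} {e : Edge Name} :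
    e ∈ (wires r s l : Expr S Name).edges ↔
      e.flip ∈ l.map (relabel r) ∨ e ∈ l.map (relabel s) := by
  rw [mem_edges_wires, List.mem_map, List.mem_map]
  have (m : Edge M) : e = ⟨m.pol.flip, r m⟩ ↔ relabel r m = e.flip := by
    obtain ⟨p, n⟩ := e
    obtain ⟨q, k⟩ := m
    cases p <;> cases q <;> simp [relabel, Edge.flip, Pol.flip, eq_comm]
  simp only [this, and_or_left, exists_or]
  simp only [relabel, eq_comm]

theorem Rep.isFree_iff (h : Rep f A B K) (e : Edge Name) :
    K.IsFree e ↔ e.flip ∈ A ∨ e ∈ B := by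
  induction f generalizing A B K e with
  | id a =>
    obtain ⟨h, l, rfl, rfl, rfl, h'⟩ := h
    rw [h'.isFree_iff]
    exact isFree_of_mem_edges h (fun e => mem_edges_wires') e
  | comp f g ihf ihg =>
    obtain ⟨h, C, F, G, hF, hG, hFG, h'⟩ := h
    rw [h'.isFree_iff, isFree_mul hFG, ihf hF, ihg hG, ihf hF, ihg hG, Edge.flip_flip]
    have h₁ := hF.distinct
    have h₂ := hG.distinct
    rw [distinctNames_append] at h h₁ h₂
    have a₁ := fun h h' => h₁.2.2 e.flip h e h' rfl
    have a₂ := fun h' h'' => h.2.2 e.flip h' e.flip h'' rfl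
    have a₃ := fun h' h'' => h.2.2 e h' e h'' rfl
    have a₄ := fun h h' => h₂.2.2 e.flip h e h' rfl
    tauto
  | tens f g ihf ihg =>
    obtain ⟨h, A₁, A₂, B₁, B₂, F, G, rfl, rfl, hF, hG, hFG, h'⟩ := h
    rw [h'.isFree_iff, isFree_mul hFG, ihf hF, ihg hG, ihf hF, ihg hG, Edge.flip_flip]
    simp only [distinctNames_append, List.mem_append] at h ⊢
    obtain ⟨⟨-, -, hA⟩, ⟨-, -, hB⟩, hAB⟩ := h
    have a₁ := fun h h' => hA e.flip h e h' rfl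
    have a₂ := fun h h' => hA e h e.flip h' rfl
    have a₃ := fun h h' => hB e.flip h e h' rfl
    have a₄ := fun h h' => hB e h e.flip h' rfl
    have a₅ := fun h h' => hAB e h e h' rfl
    have a₆ := fun h h' => hAB e.flip h e.flip h' rfl
    clear hA hB hAB ihf ihg hF hG hFG h'
    grind
  | symm a b =>
    obtain ⟨h, l, m, rfl, rfl, rfl, rfl, h'⟩ := h
    rw [h'.isFree_iff]
    refine isFree_of_mem_edges h (fun e => ?_) e
    simp only [mem_edges_wires', List.map_append, List.mem_append]
    tauto
  | cup =>
    obtain ⟨h, a, b, rfl, rfl, h'⟩ := h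
    rw [h'.isFree_iff]
    exact isFree_of_mem_edges h (fun e => by simp [edges]) e
  | cap =>
    obtain ⟨h, a, b, rfl, rfl, h'⟩ := h
    rw [h'.isFree_iff]
    refine isFree_of_mem_edges h (fun e => ?_) e
    obtain ⟨_ | _, n⟩ := e <;> simp [edges, Edge.flip, Pol.flip]
  | gen φ =>
    obtain ⟨h, rfl, -, h'⟩ := h
    rw [h'.isFree_iff]
    exact isFree_of_mem_edges h (fun e => by simp [edges]) e

theorem rename_wire (u : Pol → Name → Name) (e : Edge Name) (a : Name) :
    (wire e a : Expr S Name).rename u = wire ⟨e.pol, u e.pol.flip e.name⟩ (u e.pol a) := by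
  obtain ⟨_ | _, n⟩ := e <;> rfl

theorem rename_wires {M : Type*} (u : Pol → Name → Name) (r s : Edge M → Name)
    (l : List (Edge M)) : (wires r s l : Expr S Name).rename u =
      wires (fun e => u e.pol.flip (r e)) (fun e => u e.pol (s e)) l := by
  induction l with
  | nil => rfl
  | cons e l ih => rw [wires_cons, wires_cons, rename, ih, rename_wire]

theorem wires_congr {M : Type*} {r r' s s' : Edge M → Name} {l : List (Edge M)}
    (hr : ∀ e ∈ l, r e = r' e) (hs : ∀ e ∈ l, s e = s' e) :
    (wires r s l : Expr S Name) = wires r' s' l := by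
  rw [wires, wires, List.map_congr_left fun e he => by rw [hr e he, hs e he]]

theorem wires_map {M M' : Type*} (r s : Edge M' → Name) (g : Edge M → Edge M')
    (hg : ∀ e, (g e).pol = e.pol) (l : List (Edge M)) :
    (wires r s (l.map g) : Expr S Name) = wires (r ∘ g) (s ∘ g) l := by
  simp [wires, Function.comp_def, hg]

theorem wf_wires {M : Type*} {r s : Edge M → Name} {l : List (Edge M)}
    (h : DistinctNames (l.map (relabel r) ++ l.map (relabel s))) :
    (wires r s l : Expr S Name).WF := by
  induction l with
  | nil => exact ⟨trivial, List.nodup_nil⟩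
  | cons e l ih =>
    rw [distinctNames_append] at h
    simp only [List.map_cons, List.forall_mem_cons] at h
    obtain ⟨h₁, h₂, ⟨-, h₃⟩, h₄⟩ := h
    have h₁' := List.nodup_cons.1 h₁
    have h₂' := List.nodup_cons.1 h₂
    have h₅ := fun a ha => (h₄ a ha).2
    rw [wires_cons]
    refine wf_mul.2 ⟨wf_wire, ih (distinctNames_append.2 ⟨h₁'.2, h₂'.2, h₅⟩), fun f hf hf' => ?_⟩
    rw [mem_edges_wires'] at hf'
    rcases mem_edges_wire.1 hf with rfl | rfl
    · rw [Edge.flip_flip] at hf'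
      rcases hf' with hf' | hf'
      · exact h₁'.1 (List.mem_map_of_mem hf')
      · exact h₃ _ hf' rfl
    · rcases hf' with hf' | hf'
      · exact (h₄ _ hf').1 rfl
      · exact h₂'.1 (List.mem_map_of_mem hf')

/-- Permute the name of an edge. -/
def permuteEdge (π : Equiv.Perm Name) (e : Edge Name) : Edge Name := ⟨e.pol, π e.name⟩

theorem DistinctNames.permute {A : List (Edge Name)} (h : DistinctNames A) (π : Equiv.Perm Name) :
    DistinctNames (A.map (permuteEdge π)) := by
  have : (A.map (permuteEdge π)).map Edge.name = (A.map Edge.name).map π := by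
    simp [permuteEdge, Function.comp_def]
  rw [DistinctNames, this]
  exact h.map π.injective

theorem Rep.permute (h : Rep f A B K) (π : Equiv.Perm Name) :
    Rep f (A.map (permuteEdge π)) (B.map (permuteEdge π)) (K.permute π) := by
  have key {A B : List (Edge Name)} (h : DistinctNames (A ++ B)) :
      DistinctNames (A.map (permuteEdge π) ++ B.map (permuteEdge π)) := by
    simpa using h.permute π
  induction f generalizing A B K with
  | id a =>
    obtain ⟨h, l, rfl, rfl, rfl, h'⟩ := h
    refine ⟨key h, l.map fun e => ⟨e.pol, (π e.name.1, π e.name.2)⟩, by simp [Function.comp_def],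
      by simp [Function.comp_def, relabel, permuteEdge],
      by simp [Function.comp_def, relabel, permuteEdge], ?_⟩
    have := h'.permute π
    rw [Expr.permute, Expr.permute, rename_wires] at this
    rw [wires_map _ _ (fun e : Edge (Name × Name) =>
      (⟨e.pol, (π e.name.1, π e.name.2)⟩ : Edge (Name × Name))) fun _ => rfl]
    exact this
  | comp f g ihf ihg =>
    obtain ⟨h, B, F, G, hF, hG, hFG, h'⟩ := h
    exact ⟨key h, _, _, _, ihf hF, ihg hG, hFG.permute π, h'.permute π⟩
  | tens f g ihf ihg =>
    obtain ⟨h, A₁, A₂, B₁, B₂, F, G, rfl, rfl, hF, hG, hFG, h'⟩ := h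
    exact ⟨key h, _, _, _, _, _, _, List.map_append, List.map_append, ihf hF, ihg hG,
      hFG.permute π, h'.permute π⟩
  | symm a b =>
    obtain ⟨h, l, m, rfl, rfl, rfl, rfl, h'⟩ := h
    refine ⟨key h, l.map fun e => ⟨e.pol, (π e.name.1, π e.name.2)⟩,
      m.map fun e => ⟨e.pol, (π e.name.1, π e.name.2)⟩, by simp [Function.comp_def],
      by simp [Function.comp_def],
      by simp [Function.comp_def, relabel, permuteEdge],
      by simp [Function.comp_def, relabel, permuteEdge], ?_⟩
    have := h'.permute π
    rw [Expr.permute, Expr.permute, rename_wires] at this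
    rw [← List.map_append, wires_map _ _ (fun e : Edge (Name × Name) =>
      (⟨e.pol, (π e.name.1, π e.name.2)⟩ : Edge (Name × Name))) fun _ => rfl]
    exact this
  | cup =>
    obtain ⟨h, a, b, rfl, rfl, h'⟩ := h
    exact ⟨key h, _, _, rfl, rfl, h'.permute π⟩
  | cap =>
    obtain ⟨h, a, b, rfl, rfl, h'⟩ := h
    exact ⟨key h, _, _, rfl, rfl, h'.permute π⟩
  | gen φ =>
    obtain ⟨h, rfl, h₁, h'⟩ := h
    refine ⟨key h, rfl, ?_, h'.permute π⟩
    rw [← h₁]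
    simp [permuteEdge, Function.comp_def]

theorem permuteEdge_eq_self {π : Equiv.Perm Name} {A : List (Edge Name)}
    (h : ∀ e ∈ A, π e.name = e.name) : A.map (permuteEdge π) = A := by
  refine (List.map_congr_left fun e he => ?_).trans (List.map_id A)
  rw [permuteEdge, h e he]
  rfl

/-- A list of edges is determined by the directions and the names. -/
theorem ext_pol_name (h₁ : A.map Edge.pol = B.map Edge.pol) (h₂ : A.map Edge.name = B.map Edge.name) :
    A = B := by
  induction A generalizing B with
  | nil => simpa using h₁.symm
  | cons a A ih =>
    cases B with
    | nil => simp at h₁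
    | cons b B =>
      simp only [List.map_cons, List.cons.injEq] at h₁ h₂
      obtain ⟨p, n⟩ := a
      obtain ⟨q, k⟩ := b
      rw [ih h₁.2 h₂.2]
      simp only at h₁ h₂
      rw [h₁.1, h₂.1]

/-- Any two lists of edges with the same directions are related by a permutation of the names. -/
theorem exists_moves_edges {V : Set Name} (hA : DistinctNames A) (hB : DistinctNames B)
    (h : A.map Edge.pol = B.map Edge.pol) (hAV : ∀ e ∈ A, e.name ∉ V) (hBV : ∀ e ∈ B, e.name ∉ V) :
    ∃ π, Moves V π ∧ A.map (permuteEdge π) = B := by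
  obtain ⟨π, hπ, e⟩ := exists_moves hA hB (by simpa using congrArg List.length h)
    (by simpa using hAV) (by simpa using hBV)
  refine ⟨π, hπ, ext_pol_name ?_ ?_⟩
  · rw [← h]
    simp [permuteEdge, Function.comp_def]
  · rw [← e]
    simp [permuteEdge, Function.comp_def]

theorem ext_pairs {l m : List (Edge (Name × Name))}
    (h₁ : l.map (relabel fun e => e.name.1) = m.map (relabel fun e => e.name.1))
    (h₂ : l.map (relabel fun e => e.name.2) = m.map (relabel fun e => e.name.2)) : l = m := by
  induction l generalizing m with
  | nil => simpa using h₁.symm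
  | cons a l ih =>
    cases m with
    | nil => simp at h₁
    | cons b m =>
      simp only [List.map_cons, List.cons.injEq, relabel, Edge.mk.injEq] at h₁ h₂
      rw [ih h₁.2 h₂.2]
      obtain ⟨p, n⟩ := a
      obtain ⟨q, k⟩ := b
      simp only at h₁ h₂
      rw [h₁.1.1, Prod.ext h₁.1.2 h₂.1.2]

theorem exists_pairs (h : A.map Edge.pol = B.map Edge.pol) : ∃ l : List (Edge (Name × Name)),
    A = l.map (relabel fun e => e.name.1) ∧ B = l.map (relabel fun e => e.name.2) := by
  induction A generalizing B with
  | nil => exact ⟨[], rfl, by simpa using h.symm⟩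
  | cons a A ih =>
    cases B with
    | nil => simp at h
    | cons b B =>
      simp only [List.map_cons, List.cons.injEq] at h
      obtain ⟨l, rfl, rfl⟩ := ih h.2
      refine ⟨⟨a.pol, (a.name, b.name)⟩ :: l, rfl, ?_⟩
      rw [h.1]
      rfl

theorem append_inj_of_pol {A A' B B' : List (Edge Name)} (h : A ++ B = A' ++ B')
    (h' : A.map Edge.pol = A'.map Edge.pol) : A = A' ∧ B = B' :=
  List.append_inj h (by simpa using congrArg List.length h')

theorem hasType_unique {a b a' b' : List Pol} (h : HasType f a b) (h' : HasType f a' b') :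
    a = a' ∧ b = b' :=
  ⟨h.dom_eq.symm.trans h'.dom_eq, h.cod_eq.symm.trans h'.cod_eq⟩

theorem Rep.freeNames_eq (h : Rep f A B K) {n : Name} (hn : n ∈ K.freeNames) :
    ∃ e ∈ A ++ B, e.name = n := by
  obtain ⟨p, h'⟩ := hn
  rcases (h.isFree_iff _).1 h' with h' | h'
  · exact ⟨_, List.mem_append_left _ h', rfl⟩
  · exact ⟨_, List.mem_append_right _ h', rfl⟩

/-- The tensor that represents a morphism is determined up to equivalence. -/
theorem Rep.unique [Infinite Name] (hK : Rep f A B K) (hH : Rep f A B H) : Equiv K H := by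
  induction f generalizing A B K H with
  | id a =>
    obtain ⟨-, l, -, rfl, rfl, h⟩ := hK
    obtain ⟨-, l', -, h₁, h₂, h'⟩ := hH
    rw [ext_pairs h₁ h₂] at h
    exact h.trans h'.symm
  | comp f g ihf ihg =>
    have hK' := hK
    obtain ⟨h, C, F, G, hF, hG, hFG, e⟩ := hK
    obtain ⟨-, C', F', G', hF', hG', hFG', e'⟩ := hH
    have h₁ := distinctNames_append.1 hF.distinct
    have h₂ := distinctNames_append.1 hG.distinct
    have h₁' := distinctNames_append.1 hF'.distinct
    have h₂' := distinctNames_append.1 hG'.distinct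
    -- rename the edges in the middle, which are bound
    obtain ⟨π, hπ, rfl⟩ := exists_moves_edges (V := {n | ∃ e ∈ A ++ B, e.name = n}) h₂.1 h₂'.1
      (hasType_unique hF.hasType hF'.hasType).2 (by
        rintro a ha ⟨b, hb, hab⟩
        rcases List.mem_append.1 hb with hb | hb
        exacts [h₁.2.2 _ hb _ ha hab, h₂.2.2 _ ha _ hb hab.symm]) (by
        rintro a ha ⟨b, hb, hab⟩
        rcases List.mem_append.1 hb with hb | hb
        exacts [h₁'.2.2 _ hb _ ha hab, h₂'.2.2 _ ha _ hb hab.symm])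
    have hA : A.map (permuteEdge π) = A :=
      permuteEdge_eq_self fun a ha => hπ.apply_eq ⟨a, List.mem_append_left _ ha, rfl⟩
    have hB : B.map (permuteEdge π) = B :=
      permuteEdge_eq_self fun a ha => hπ.apply_eq ⟨a, List.mem_append_right _ ha, rfl⟩
    have e₁ := Equiv.of_moves hFG (hπ.mono fun n hn => hK'.freeNames_eq (e.freeNames_eq ▸ hn))
    have hF₁ := hF.permute π
    have hG₁ := hG.permute π
    rw [hA] at hF₁
    rw [hB] at hG₁
    exact e.trans (e₁.trans ((Equiv.mul (ihf hF₁ hF') (ihg hG₁ hG') e₁.wf' hFG').trans e'.symm))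
  | tens f g ihf ihg =>
    obtain ⟨-, A₁, A₂, B₁, B₂, F, G, rfl, rfl, hF, hG, hFG, h⟩ := hK
    obtain ⟨-, A₁', A₂', B₁', B₂', F', G', hA, hB, hF', hG', hFG', h'⟩ := hH
    have ht := hasType_unique hF.hasType hF'.hasType
    obtain ⟨rfl, rfl⟩ := append_inj_of_pol hA ht.1
    obtain ⟨rfl, rfl⟩ := append_inj_of_pol hB ht.2
    exact h.trans ((Equiv.mul (ihf hF hF') (ihg hG hG') hFG hFG').trans h'.symm)
  | symm a b =>
    obtain ⟨-, l, m, rfl, rfl, rfl, rfl, h⟩ := hK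
    obtain ⟨-, l', m', hl, hm, h₁, h₂, h'⟩ := hH
    rw [List.map_append, List.map_append] at h₁ h₂
    obtain ⟨h₃, h₄⟩ := append_inj_of_pol h₁ (by rw [map_pol_relabel, map_pol_relabel, hl])
    obtain ⟨h₅, h₆⟩ := append_inj_of_pol h₂ (by rw [map_pol_relabel, map_pol_relabel, hm])
    rw [ext_pairs h₃ h₆, ext_pairs h₄ h₅] at h
    exact h.trans h'.symm
  | cup =>
    obtain ⟨-, a, b, -, rfl, h⟩ := hK
    obtain ⟨-, a', b', -, h₁, h'⟩ := hH
    simp only [List.cons.injEq, Edge.mk.injEq, true_and, and_true] at h₁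
    rw [h₁.1, h₁.2] at h
    exact h.trans h'.symm
  | cap =>
    obtain ⟨-, a, b, rfl, -, h⟩ := hK
    obtain ⟨-, a', b', h₁, -, h'⟩ := hH
    simp only [List.cons.injEq, Edge.mk.injEq, true_and, and_true] at h₁
    rw [h₁.1, h₁.2] at h
    exact h.trans h'.symm
  | gen φ =>
    obtain ⟨-, -, -, h⟩ := hK
    obtain ⟨-, -, -, h'⟩ := hH
    exact h.trans h'.symm

/-- The bound names of a representing tensor can be chosen outside of a finite set. -/
theorem Rep.exists_freshen [Infinite Name] (h : Rep f A B K) {V : Set Name} (hV : V.Finite) :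
    ∃ H, Rep f A B H ∧ ∀ n, H.IsBound n → n ∉ V := by
  obtain ⟨π, hπ, hb⟩ := Expr.exists_freshen (G := K) hV
  exact ⟨_, h.congr (Equiv.of_moves h.wf hπ), hb⟩

theorem finite_edgeNames (A : List (Edge Name)) : {n | ∃ e ∈ A, e.name = n}.Finite := by
  refine (A.map Edge.name).finite_toSet.subset ?_
  rintro n ⟨e, he, rfl⟩
  exact List.mem_map_of_mem he

/-- Two expressions can be multiplied if their bound names are fresh and their free edges are
different. -/
theorem wf_mul_of_fresh (hF : F.WF) (hG : G.WF) (h : ∀ e, F.IsFree e → ¬ G.IsFree e)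
    (hF' : ∀ n, F.IsBound n → n ∉ G.freeNames) (hG' : ∀ n, G.IsBound n → n ∉ F.names) :
    (mul F G).WF := by
  refine wf_mul.2 ⟨hF, hG, fun e he he' => ?_⟩
  rcases isFree_or_isBound he' with h₁ | h₁
  · rcases isFree_or_isBound he with h₂ | h₂
    · exact h e h₂ h₁
    · exact hF' _ h₂ ⟨_, h₁⟩
  · exact hG' _ h₁ (mem_names he)

/-- Every well-typed expression is represented by a tensor. -/
theorem exists_rep [Infinite Name] {a b : List Pol} (h : HasType f a b) {A B : List (Edge Name)}
    (hA : A.map Edge.pol = a) (hB : B.map Edge.pol = b) (hAB : DistinctNames (A ++ B)) :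
    ∃ K : Expr S Name, Rep f A B K := by
  induction h generalizing A B with
  | id a =>
    obtain ⟨l, rfl, rfl⟩ := exists_pairs (hA.trans hB.symm)
    rw [map_pol_relabel] at hA
    exact ⟨_, hAB, l, hA, rfl, rfl, .refl (wf_wires hAB)⟩
  | @comp f g a b c hf hg ihf ihg =>
    have hAB' := distinctNames_append.1 hAB
    obtain ⟨C, hC, hCD, hCV⟩ : ∃ C : List (Edge Name), C.map Edge.pol = b ∧ DistinctNames C ∧
        ∀ e ∈ C, ∀ e' ∈ A ++ B, e.name ≠ e'.name := by
      obtain ⟨r, hr, hr'⟩ := exists_fresh (List.finRange b.length) (finite_edgeNames (A ++ B))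
      refine ⟨(List.finRange b.length).map fun i => ⟨b[i], r i⟩, ?_, ?_, ?_⟩
      · simp [Function.comp_def]
      · rw [DistinctNames, List.map_map]
        exact List.Nodup.map_on hr (List.nodup_finRange _)
      · simp only [List.mem_map]
        rintro _ ⟨i, -, rfl⟩ e he h
        exact hr' i ⟨e, he, h.symm⟩
    have hAC : DistinctNames (A ++ C) := distinctNames_append.2 ⟨hAB'.1, hCD, fun a ha c hc h =>
      hCV c hc a (List.mem_append_left _ ha) h.symm⟩
    have hCB : DistinctNames (C ++ B) := distinctNames_append.2 ⟨hCD, hAB'.2.1, fun c hc b hb h =>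
      hCV c hc b (List.mem_append_right _ hb) h⟩
    obtain ⟨F₀, hF₀⟩ := ihf hA hC hAC
    obtain ⟨G₀, hG₀⟩ := ihg hC hB hCB
    obtain ⟨F, hF, hF'⟩ := hF₀.exists_freshen (finite_edgeNames (C ++ B))
    obtain ⟨G, hG, hG'⟩ := hG₀.exists_freshen F.finite_names
    have hAC' := distinctNames_append.1 hAC
    have hCB' := distinctNames_append.1 hCB
    have hFG : (mul F G).WF := by
      refine wf_mul_of_fresh hF.wf hG.wf (fun e h h' => ?_)
        (fun n hn h => hF' n hn (hG.freeNames_eq h)) hG'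
      rw [hF.isFree_iff] at h
      rw [hG.isFree_iff] at h'
      rcases h with h | h <;> rcases h' with h' | h'
      · exact hAC'.2.2 _ h _ h' rfl
      · exact hAB'.2.2 _ h _ h' rfl
      · exact hCD.flip_notMem h h'
      · exact hCB'.2.2 _ h _ h' rfl
    exact ⟨_, hAB, C, F, G, hF, hG, hFG, .refl hFG⟩
  | @tens f g a b a' b' hf hg ihf ihg =>
    obtain ⟨A₁, A₂, rfl, hA₁, hA₂⟩ := List.map_eq_append_iff.1 hA
    obtain ⟨B₁, B₂, rfl, hB₁, hB₂⟩ := List.map_eq_append_iff.1 hB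
    have h₁ := hAB
    simp only [distinctNames_append, List.mem_append] at h₁
    obtain ⟨⟨hA₁', hA₂', hA'⟩, ⟨hB₁', hB₂', hB'⟩, hAB'⟩ := h₁
    obtain ⟨F₀, hF₀⟩ := ihf hA₁ hB₁ (distinctNames_append.2 ⟨hA₁', hB₁', fun a ha b hb =>
      hAB' a (.inl ha) b (.inl hb)⟩)
    obtain ⟨G₀, hG₀⟩ := ihg hA₂ hB₂ (distinctNames_append.2 ⟨hA₂', hB₂', fun a ha b hb =>
      hAB' a (.inr ha) b (.inr hb)⟩)
    obtain ⟨F, hF, hF'⟩ := hF₀.exists_freshen (finite_edgeNames (A₂ ++ B₂))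
    obtain ⟨G, hG, hG'⟩ := hG₀.exists_freshen F.finite_names
    have hFG : (mul F G).WF := by
      refine wf_mul_of_fresh hF.wf hG.wf (fun e h h' => ?_)
        (fun n hn h => hF' n hn (hG.freeNames_eq h)) hG'
      rw [hF.isFree_iff] at h
      rw [hG.isFree_iff] at h'
      rcases h with h | h <;> rcases h' with h' | h'
      · exact hA' _ h _ h' rfl
      · exact hAB' _ (.inl h) _ (.inr h') rfl
      · exact hAB' _ (.inr h') _ (.inl h) rfl
      · exact hB' _ h _ h' rfl
    exact ⟨_, hAB, A₁, A₂, B₁, B₂, F, G, rfl, rfl, hF, hG, hFG, .refl hFG⟩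
  | symm a b =>
    obtain ⟨A₁, A₂, rfl, hA₁, hA₂⟩ := List.map_eq_append_iff.1 hA
    obtain ⟨B₂, B₁, rfl, hB₂, hB₁⟩ := List.map_eq_append_iff.1 hB
    obtain ⟨l, rfl, rfl⟩ := exists_pairs (hA₁.trans hB₁.symm)
    obtain ⟨m, rfl, rfl⟩ := exists_pairs (hA₂.trans hB₂.symm)
    rw [map_pol_relabel] at hA₁ hA₂
    refine ⟨_, hAB, l, m, hA₁, hA₂, List.map_append.symm, List.map_append.symm, .refl (wf_wires ?_)⟩
    refine hAB.perm ?_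
    rw [List.map_append, List.map_append]
    exact List.perm_append_comm.append_left _
  | cup =>
    obtain rfl := List.map_eq_nil_iff.1 hA
    obtain ⟨⟨p, a⟩, l, rfl, h, hB⟩ := List.map_eq_cons_iff.1 hB
    obtain ⟨⟨q, b⟩, l, rfl, h', hB⟩ := List.map_eq_cons_iff.1 hB
    obtain rfl := List.map_eq_nil_iff.1 hB
    simp only at h h'
    subst h h'
    exact ⟨_, hAB, a, b, rfl, rfl, .refl ⟨trivial, by simp [edges]⟩⟩
  | cap =>
    obtain rfl := List.map_eq_nil_iff.1 hB
    obtain ⟨⟨p, a⟩, l, rfl, h, hA⟩ := List.map_eq_cons_iff.1 hA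
    obtain ⟨⟨q, b⟩, l, rfl, h', hA⟩ := List.map_eq_cons_iff.1 hA
    obtain rfl := List.map_eq_nil_iff.1 hA
    simp only at h h'
    subst h h'
    exact ⟨_, hAB, a, b, rfl, rfl, .refl ⟨trivial, by simp [edges]⟩⟩
  | gen φ =>
    obtain rfl := List.map_eq_nil_iff.1 hA
    exact ⟨_, hAB, rfl, hB, .refl ⟨hB, List.Nodup.of_map _ hAB⟩⟩

end Expr

/-! ### Composition with identity tensors -/

namespace Expr

variable {S : Signature.{u}} {Name : Type v}
variable {f g : Term S} {A B C : List (Edge Name)} {F G H K : Expr S Name}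

theorem exists_subst {M : Type*} {r s : Edge M → Name} {l : List (Edge M)}
    (h : ∀ e ∈ l, ∀ e' ∈ l, relabel r e = relabel r e' → s e = s e') :
    ∃ t : Pol → Name → Name, (∀ e ∈ l, t e.pol (r e) = s e) ∧
      ∀ p n, (∀ e ∈ l, (⟨p, n⟩ : Edge Name) ≠ ⟨e.pol, r e⟩) → t p n = n := by
  classical
  refine ⟨fun p n => if h : ∃ e ∈ l, (⟨p, n⟩ : Edge Name) = relabel r e then s h.choose else n,
    fun e he => ?_, fun p n hn => ?_⟩
  · have h' : ∃ e' ∈ l, (⟨e.pol, r e⟩ : Edge Name) = relabel r e' := ⟨e, he, rfl⟩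
    exact (dif_pos h').trans (h e he _ h'.choose_spec.1 h'.choose_spec.2).symm
  · refine dif_neg ?_
    rintro ⟨e, he, h'⟩
    exact hn e he h'

theorem DistinctNames.relabel_inj {M : Type*} {r : Edge M → Name} {l : List (Edge M)}
    (h : DistinctNames (l.map (relabel r))) {e e' : Edge M} (he : e ∈ l) (he' : e' ∈ l)
    (h' : r e = r e') : e = e' := by
  have : ((l.map (relabel r)).map Edge.name) = l.map r := by simp [relabel, Function.comp_def]
  rw [DistinctNames, this] at h
  exact List.inj_on_of_nodup_map h he he' h'

/-- Multiplying with identity tensors for some of the free edges amounts to a permutation of the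
names, if the new names are fresh. -/
theorem exists_permute_of_wires [Infinite Name] {M : Type*} {r s : Edge M → Name}
    {l : List (Edge M)} {V : Set Name} (hF : (mul F (wires r s l)).WF)
    (hf : ∀ e ∈ l, F.IsFree ⟨e.pol, r e⟩) (hr : DistinctNames (l.map (relabel r)))
    (hs : DistinctNames (l.map (relabel s))) (hrV : ∀ e ∈ l, r e ∉ V) (hsV : ∀ e ∈ l, s e ∉ V)
    (hsF : ∀ e ∈ l, s e ∉ F.names) :
    ∃ π : Equiv.Perm Name, (∀ n ∈ V, π n = n) ∧
      (l.map (relabel r)).map (permuteEdge π) = l.map (relabel s) ∧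
      Equiv (mul F (wires r s l)) (F.permute π) := by
  obtain ⟨π, hπ, e⟩ := exists_moves_edges (V := V ∪ {n | n ∈ F.names ∧ ∀ e ∈ l, r e ≠ n}) hr hs
    (by rw [map_pol_relabel, map_pol_relabel])
    (by
      simp only [List.mem_map]
      rintro _ ⟨e, he, rfl⟩ (h | h)
      exacts [hrV e he h, h.2 e he rfl])
    (by
      simp only [List.mem_map]
      rintro _ ⟨e, he, rfl⟩ (h | h)
      exacts [hsV e he h, hsF e he h.1])
  refine ⟨π, fun n hn => hπ.apply_eq (.inl hn), e, ?_⟩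
  obtain ⟨t, ht, ht'⟩ := exists_subst (r := r) (s := s) (l := l) fun e he e' he' h =>
    congrArg s (hr.relabel_inj he he' (congrArg Edge.name h))
  have hF' := Equiv.contract_wires hF hf ht fun e _ h => ht' _ _ h
  rw [rename_congr (s := fun _ => π)] at hF'
  · exact hF'
  · intro a ha
    by_cases h : ∃ e ∈ l, r e = a.name
    · obtain ⟨e', he', h⟩ := h
      have ha' : a = ⟨e'.pol, r e'⟩ := by
        obtain ⟨p, n⟩ := a
        simp only at h
        subst h
        have := (hf e' he').2
        by_cases hp : p = e'.pol
        · rw [hp]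
        · refine (this ?_).elim
          convert ha using 1
          revert hp
          cases p <;> cases h : e'.pol <;> simp [Edge.flip, Pol.flip]
      rw [ha', ht e' he']
      rw [List.map_map, List.map_inj_left] at e
      exact (congrArg Edge.name (e e' he')).symm
    · push Not at h
      rw [hπ.apply_eq (.inr ⟨mem_names ha, h⟩)]
      refine ht' _ _ fun e he h' => ?_
      exact h e he (congrArg Edge.name h').symm

/-- A name outside of the boundary that occurs in a representing tensor is bound. -/
theorem Rep.isBound_of_mem_names (h : Rep f A B K) {n : Name} (hn : n ∈ K.names)
    (hA : ∀ a ∈ A, a.name ≠ n) (hB : ∀ b ∈ B, b.name ≠ n) : K.IsBound n := by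
  refine (mem_freeNames_or_isBound hn).resolve_left fun h' => ?_
  obtain ⟨e, he, rfl⟩ := h.freeNames_eq h'
  rcases List.mem_append.1 he with he | he
  exacts [hA e he rfl, hB e he rfl]

theorem Rep.comp_wires [Infinite Name] {M : Type*} {r s : Edge M → Name} {l : List (Edge M)}
    (h : Rep f A (l.map (relabel r)) F) (hF : (mul F (wires r s l)).WF)
    (hs : DistinctNames (A ++ l.map (relabel s))) (hrs : ∀ e ∈ l, ∀ e' ∈ l, r e ≠ s e') :
    Rep f A (l.map (relabel s)) (mul F (wires r s l)) := by
  have h₁ := distinctNames_append.1 h.distinct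
  have h₂ := distinctNames_append.1 hs
  obtain ⟨π, hπ, e, hF'⟩ := exists_permute_of_wires (V := {n | ∃ e ∈ A, e.name = n}) hF
    (fun e he => (h.isFree_iff _).2 (.inr (List.mem_map_of_mem he))) h₁.2.1 h₂.2.1
    (fun e he ⟨a, ha, h⟩ => h₁.2.2 a ha _ (List.mem_map_of_mem he) h)
    (fun e he ⟨a, ha, h⟩ => h₂.2.2 a ha _ (List.mem_map_of_mem he) h) (fun e he he' => by
      have := h.isBound_of_mem_names he'
        (fun a ha h => h₂.2.2 a ha _ (List.mem_map_of_mem he) h) (by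
          simp only [List.mem_map]
          rintro _ ⟨e', h', rfl⟩
          exact hrs e' h' e he)
      exact (wf_mul.1 hF).2.2 _ (this.mem e.pol) (mem_edges_wires.2 ⟨e, he, .inr rfl⟩))
  have := h.permute π
  rw [e, permuteEdge_eq_self fun a ha => hπ _ ⟨a, ha, rfl⟩] at this
  exact this.congr hF'.symm

theorem relabel_flip {M : Type*} (r : Edge M → Name) (l : List (Edge M)) :
    (l.map Edge.flip).map (relabel fun e => r e.flip) = (l.map (relabel r)).map Edge.flip := by
  rw [List.map_map, List.map_map]
  refine List.map_congr_left fun e _ => ?_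
  simp only [Function.comp, relabel, Edge.flip_flip]
  rfl

theorem wires_flip {M : Type*} (r s : Edge M → Name) (l : List (Edge M)) :
    (wires r s l : Expr S Name) =
      wires (fun e => s e.flip) (fun e => r e.flip) (l.map Edge.flip) := by
  rw [wires, wires, List.map_map]
  congr 1
  refine List.map_congr_left fun e _ => ?_
  obtain ⟨_ | _, n⟩ := e <;> rfl

theorem DistinctNames.flip (h : DistinctNames A) : DistinctNames (A.map Edge.flip) := by
  have : (A.map Edge.flip).map Edge.name = A.map Edge.name := by simp [Function.comp_def]
  rwa [DistinctNames, this]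

theorem Rep.wires_comp [Infinite Name] {M : Type*} {r s : Edge M → Name} {l : List (Edge M)}
    (h : Rep f (l.map (relabel s)) B F) (hF : (mul (wires r s l) F).WF)
    (hr : DistinctNames (l.map (relabel r) ++ B)) (hrs : ∀ e ∈ l, ∀ e' ∈ l, r e ≠ s e') :
    Rep f (l.map (relabel r)) B (mul (wires r s l) F) := by
  have h₁ := distinctNames_append.1 h.distinct
  have h₂ := distinctNames_append.1 hr
  have hF₁ := wf_mul_comm hF
  have hl {e : Edge _} (he : e ∈ l.map Edge.flip) : e.flip ∈ l := by
    obtain ⟨e, he, rfl⟩ := List.mem_map.1 he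
    rwa [Edge.flip_flip]
  rw [wires_flip] at hF₁
  obtain ⟨π, hπ, e, hF'⟩ := exists_permute_of_wires (V := {n | ∃ e ∈ B, e.name = n}) hF₁
    (fun e he => (h.isFree_iff _).2 (.inl (by
      refine List.mem_map.2 ⟨e.flip, hl he, ?_⟩
      simp [relabel, Edge.flip]))) (by rw [relabel_flip]; exact h₁.1.flip)
    (by rw [relabel_flip]; exact h₂.1.flip)
    (fun e he ⟨a, ha, h⟩ => h₁.2.2 _ (List.mem_map_of_mem (hl he)) a ha h.symm)
    (fun e he ⟨a, ha, h⟩ => h₂.2.2 _ (List.mem_map_of_mem (hl he)) a ha h.symm) (fun e he he' => by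
      have := h.isBound_of_mem_names he' (by
          simp only [List.mem_map]
          rintro _ ⟨e', h', rfl⟩
          exact (hrs _ (hl he) e' h').symm)
        (fun a ha h => h₂.2.2 _ (List.mem_map_of_mem (hl he)) a ha h.symm)
      exact (wf_mul.1 hF₁).2.2 _ (this.mem e.pol) (mem_edges_wires.2 ⟨e, he, .inr rfl⟩))
  have := h.permute π
  rw [permuteEdge_eq_self fun a ha => hπ _ ⟨a, ha, rfl⟩] at this
  have e' : (l.map (relabel s)).map (permuteEdge π) = l.map (relabel r) := by
    rw [relabel_flip, relabel_flip] at e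
    have := congrArg (List.map Edge.flip) e
    simp only [List.map_map, List.map_inj_left, Function.comp, Edge.flip_flip] at this ⊢
    intro e he
    rw [← this e he]
    exact (Edge.flip_flip _).symm
  rw [e'] at this
  refine this.congr (hF'.symm.trans ?_)
  rw [← wires_flip]
  exact Equiv.comm (wf_mul_comm hF)

theorem not_isBound_wires {M : Type*} {r s : Edge M → Name} {l : List (Edge M)}
    (h : DistinctNames (l.map (relabel r) ++ l.map (relabel s))) (n : Name) :
    ¬ (wires r s l : Expr S Name).IsBound n := fun hn =>
  hn.not_isFree .out <| (isFree_of_mem_edges h (fun _ => mem_edges_wires') _).2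
    (mem_edges_wires'.1 (hn.mem .out))

theorem wf_mul_wires {M : Type*} {r s : Edge M → Name} {l : List (Edge M)}
    (h : DistinctNames (l.map (relabel r) ++ l.map (relabel s))) (hF : (mul F G).WF)
    (e : Equiv G (wires r s l)) : (mul F (wires r s l)).WF :=
  wf_mul_comm (wf_mul_of_free (wf_mul_comm hF) e fun n hn => (not_isBound_wires h n hn).elim)

theorem wf_wires_mul {M : Type*} {r s : Edge M → Name} {l : List (Edge M)}
    (h : DistinctNames (l.map (relabel r) ++ l.map (relabel s))) (hF : (mul G F).WF)
    (e : Equiv G (wires r s l)) : (mul (wires r s l) F).WF :=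
  wf_mul_comm (wf_mul_wires h (wf_mul_comm hF) e)

/-! ### Rewirings are represented by identity tensors -/

/-- A permutation of wires is represented by the product of the identity tensors that connect the
wires with the same label. -/
theorem rep_rewiring [Infinite Name] {M : Type*} {l m : List (Edge M)} {σ : Term S}
    (h : Rewiring l m σ) {r s : Edge M → Name}
    (hd : DistinctNames (l.map (relabel r) ++ m.map (relabel s))) :
    Rep σ (l.map (relabel r)) (m.map (relabel s)) (wires r s l) := by
  -- the labels as pairs of names
  let c (r s : Edge M → Name) (e : Edge M) : Edge (Name × Name) := ⟨e.pol, (r e, s e)⟩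
  have hc (r s : Edge M → Name) (l : List (Edge M)) : (l.map (c r s)).map Edge.pol = l.map Edge.pol ∧
      (l.map (c r s)).map (relabel fun e => e.name.1) = l.map (relabel r) ∧
      (l.map (c r s)).map (relabel fun e => e.name.2) = l.map (relabel s) ∧
      (wires (fun e => e.name.1) (fun e => e.name.2) (l.map (c r s)) : Expr S Name) =
        wires r s l := by
    refine ⟨by simp [c, Function.comp_def], by simp [c, Function.comp_def, relabel],
      by simp [c, Function.comp_def, relabel], ?_⟩
    rw [wires_map _ _ (c r s) fun _ => rfl]
    rfl
  have hw {l m : List (Edge M)} {r s : Edge M → Name} (hp : l.Perm m)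
      (hd : DistinctNames (l.map (relabel r) ++ m.map (relabel s))) :
      (wires r s l : Expr S Name).WF :=
    wf_wires (hd.perm ((hp.symm.map _).append_left _))
  induction h generalizing r s with
  | id l =>
    obtain ⟨h₁, h₂, h₃, h₄⟩ := hc r s l
    exact ⟨hd, l.map (c r s), h₁, h₂.symm, h₃.symm, h₄.symm ▸ .refl (hw (.refl l) hd)⟩
  | symm l m =>
    refine ⟨hd, l.map (c r s), m.map (c r s), (hc r s l).1, (hc r s m).1, ?_, ?_, ?_⟩
    · rw [← List.map_append, (hc r s _).2.1]
    · rw [← List.map_append, (hc r s _).2.2.1]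
    · rw [← List.map_append, (hc r s _).2.2.2]
      exact .refl (hw List.perm_append_comm hd)
  | @comp l m n σ τ hσ hτ ihσ ihτ =>
    have hlm := hσ.wiring.perm
    have hmn := hτ.wiring.perm
    obtain ⟨t, ht, htV⟩ := exists_fresh l
      (finite_edgeNames (l.map (relabel r) ++ n.map (relabel s)))
    have hd' := distinctNames_append.1 hd
    have htl : DistinctNames (l.map (relabel t)) := by
      have hl : l.Nodup := List.Nodup.of_map _ (List.Nodup.of_map _ hd'.1)
      rw [DistinctNames, List.map_map]
      exact List.Nodup.map_on ht hl
    have htm : DistinctNames (m.map (relabel t)) := htl.perm (hlm.map _)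
    have htV' {e e' : Edge M} (he' : e' ∈ l) : r e' ≠ t e ∧ t e ≠ s e' := by
      refine ⟨fun h => htV e ⟨_, List.mem_append_left _ (List.mem_map_of_mem he'), h⟩, fun h =>
        htV e ⟨_, List.mem_append_right _ (List.mem_map_of_mem ?_), h.symm⟩⟩
      exact (hlm.trans hmn).mem_iff.1 he'
    have h₁ : DistinctNames (l.map (relabel r) ++ m.map (relabel t)) := by
      refine distinctNames_append.2 ⟨hd'.1, htm, ?_⟩
      simp only [List.mem_map]
      rintro _ ⟨e, he, rfl⟩ _ ⟨e', -, rfl⟩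
      exact (htV' he).1
    have h₂ : DistinctNames (m.map (relabel t) ++ n.map (relabel s)) := by
      refine distinctNames_append.2 ⟨htm, hd'.2.1, ?_⟩
      simp only [List.mem_map]
      rintro _ ⟨e, -, rfl⟩ _ ⟨e', he', rfl⟩
      exact (htV' ((hlm.trans hmn).mem_iff.2 he')).2
    have hrs : ∀ e ∈ l, ∀ e' ∈ l, r e ≠ s e' := fun e he e' he' =>
      hd'.2.2 _ (List.mem_map_of_mem he) _
        (List.mem_map_of_mem ((hlm.trans hmn).mem_iff.1 he'))
    have hwt : (mul (wires r t l) (wires t s m) : Expr S Name).WF := by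
      refine wf_mul.2 ⟨hw hlm h₁, hw hmn h₂, ?_⟩
      simp only [mem_edges_wires]
      rintro e ⟨f, hf, rfl | rfl⟩ ⟨f', hf', h | h⟩ <;> have hf' := hlm.mem_iff.2 hf'
      · exact (htV' hf).1 (congrArg Edge.name h)
      · exact hrs _ hf _ hf' (congrArg Edge.name h)
      · obtain rfl := ht f hf f' hf' (congrArg Edge.name h)
        have := congrArg Edge.pol h
        revert this
        cases f.pol <;> simp [Pol.flip]
      · exact (htV' hf').2 (congrArg Edge.name h)
    have hp : (mul (wires r t l) (wires t s m) : Expr S Name).factors.Perm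
        (mul (wires r t l) (wires t s l)).factors := by
      simp only [factors, factors_wires]
      exact (hlm.symm.map _).append_left _
    refine ⟨hd, m.map (relabel t), _, _, ihσ h₁, ihτ h₂, hwt,
      Equiv.symm ((Equiv.of_perm hwt hp).trans ?_)⟩
    obtain ⟨u, hu, hu'⟩ := exists_subst (r := t) (s := s) (l := l) fun e he e' he' h =>
      congrArg s (ht e he e' he' (congrArg Edge.name h))
    have h₃ : DistinctNames (l.map (relabel r) ++ l.map (relabel t)) :=
      h₁.perm ((hlm.symm.map _).append_left _)
    have := Equiv.contract_wires (t := u) (wf_of_perm hp hwt) (fun e he =>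
      (isFree_of_mem_edges h₃ (fun _ => mem_edges_wires') _).2
        (.inr (List.mem_map_of_mem he))) hu fun e _ h => hu' _ _ h
    rwa [rename_wires, wires_congr (fun e he => hu' _ _ fun e' he' h =>
      (htV' he).1 (congrArg Edge.name h)) hu] at this
  | @tens l m l' m' σ τ hσ hτ ihσ ihτ =>
    have hd₁ := hd
    simp only [List.map_append, distinctNames_append, List.mem_append] at hd
    obtain ⟨⟨h₁, h₂, -⟩, ⟨h₄, h₅, -⟩, h₇⟩ := hd
    have hW := hw (hσ.wiring.perm.append hτ.wiring.perm) hd₁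
    have hp : (wires r s (l ++ m) : Expr S Name).factors.Perm
        (mul (wires r s l) (wires r s m)).factors := by
      simp [factors, factors_wires]
    exact ⟨hd₁, _, _, _, _, _, _, List.map_append, List.map_append,
      ihσ (distinctNames_append.2 ⟨h₁, h₄, fun a ha b hb => h₇ a (.inl ha) b (.inl hb)⟩),
      ihτ (distinctNames_append.2 ⟨h₂, h₅, fun a ha b hb => h₇ a (.inr ha) b (.inr hb)⟩),
      wf_of_perm hp hW, Equiv.of_perm hW hp⟩

end Expr

/-! ### The axioms hold for tensors -/

namespace Expr

variable {S : Signature.{u}} {Name : Type v}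
variable {f g h : Term S} {A B C : List (Edge Name)} {F G H K : Expr S Name}

/-- Tensors that represent a given morphism exist and are equivalent, so one implication is enough. -/
theorem Rep.iff_of_imp [Infinite Name] {a b : List Pol} (hf : HasType f a b)
    (hg : HasType g a b)
    (h : ∀ (A B : List (Edge Name)) (K : Expr S Name), Rep f A B K → Rep g A B K) :
    Rep f A B K ↔ Rep g A B K := by
  refine ⟨h A B K, fun hK => ?_⟩
  obtain ⟨rfl, rfl⟩ := hasType_unique hg hK.hasType
  obtain ⟨H, hH⟩ := exists_rep hf rfl rfl hK.distinct
  exact hH.congr ((h A B H hH).unique hK)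

/-- One common representing tensor for each choice of names is enough. -/
theorem Rep.iff_of_exists [Infinite Name] {a b : List Pol} (hf : HasType f a b)
    (hg : HasType g a b)
    (h : ∀ A B : List (Edge Name), A.map Edge.pol = a → B.map Edge.pol = b →
      DistinctNames (A ++ B) → ∃ K : Expr S Name, Rep f A B K ∧ Rep g A B K) :
    Rep f A B K ↔ Rep g A B K := by
  refine Rep.iff_of_imp hf hg fun A B K hK => ?_
  obtain ⟨rfl, rfl⟩ := hasType_unique hf hK.hasType
  obtain ⟨H, h₁, h₂⟩ := h A B rfl rfl hK.distinct
  exact h₂.congr (h₁.unique hK)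

theorem Rep.mem_freeNames (h : Rep f A B K) {e : Edge Name} (he : e ∈ A ∨ e ∈ B) :
    e.name ∈ K.freeNames := by
  rcases he with he | he
  · exact ⟨e.pol.flip, (h.isFree_iff _).2 (.inl ((Edge.flip_flip e).symm ▸ he))⟩
  · exact ⟨e.pol, (h.isFree_iff _).2 (.inr he)⟩

theorem Rep.mem_names (h : Rep f A B K) {e : Edge Name} (he : e ∈ A ∨ e ∈ B) :
    e.name ∈ K.names := freeNames_subset _ (h.mem_freeNames he)

theorem Rep.isBound_comp (hF : Rep f A C F) (hG : Rep g C B G) {e : Edge Name} (he : e ∈ C) :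
    (mul F G).IsBound e.name := by
  have h₁ := ((hF.isFree_iff e).2 (.inr he)).1
  have h₂ := ((hG.isFree_iff e.flip).2 (.inl ((Edge.flip_flip e).symm ▸ he))).1
  obtain ⟨_ | _, n⟩ := e
  · exact ⟨List.mem_append_left _ h₁, List.mem_append_right _ h₂⟩
  · exact ⟨List.mem_append_right _ h₂, List.mem_append_left _ h₁⟩

/-- A tensor that represents a composite factors, with bound names outside of a finite set. -/
theorem Rep.exists_comp [Infinite Name] (hK : Rep (.comp f g) A B K) {V : Set Name}
    (hV : V.Finite) : ∃ C F G, Rep f A C F ∧ Rep g C B G ∧ (mul F G).WF ∧ Equiv K (mul F G) ∧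
      ∀ n, (mul F G).IsBound n → n ∉ V := by
  have hK' := hK
  obtain ⟨-, C, F, G, hF, hG, hFG, e⟩ := hK
  obtain ⟨π, hπ, hb⟩ := Expr.exists_freshen (G := mul F G) hV
  have fix {D : List (Edge Name)} (hD : ∀ a ∈ D, a ∈ A ∨ a ∈ B) :
      D.map (permuteEdge π) = D := permuteEdge_eq_self fun a ha =>
    hπ.apply_eq (e.freeNames_eq ▸ hK'.mem_freeNames (hD a ha))
  have hF' := hF.permute π
  have hG' := hG.permute π
  rw [fix fun a => .inl] at hF'
  rw [fix fun a => .inr] at hG'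
  exact ⟨_, _, _, hF', hG', hFG.permute π, e.trans (.of_moves hFG hπ), hb⟩

/-- A tensor that represents a tensor product factors, with bound names outside of a finite set. -/
theorem Rep.exists_tens [Infinite Name] (hK : Rep (.tens f g) A B K) {V : Set Name}
    (hV : V.Finite) : ∃ A₁ A₂ B₁ B₂ F G, A = A₁ ++ A₂ ∧ B = B₁ ++ B₂ ∧ Rep f A₁ B₁ F ∧
      Rep g A₂ B₂ G ∧ (mul F G).WF ∧ Equiv K (mul F G) ∧ ∀ n, (mul F G).IsBound n → n ∉ V := by
  have hK' := hK
  obtain ⟨-, A₁, A₂, B₁, B₂, F, G, rfl, rfl, hF, hG, hFG, e⟩ := hK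
  obtain ⟨π, hπ, hb⟩ := Expr.exists_freshen (G := mul F G) hV
  have fix {D : List (Edge Name)} (hD : ∀ a ∈ D, a ∈ A₁ ++ A₂ ∨ a ∈ B₁ ++ B₂) :
      D.map (permuteEdge π) = D := permuteEdge_eq_self fun a ha =>
    hπ.apply_eq (e.freeNames_eq ▸ hK'.mem_freeNames (hD a ha))
  have hF' := hF.permute π
  have hG' := hG.permute π
  rw [fix fun a h => .inl (List.mem_append_left _ h),
    fix fun a h => .inr (List.mem_append_left _ h)] at hF'
  rw [fix fun a h => .inl (List.mem_append_right _ h),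
    fix fun a h => .inr (List.mem_append_right _ h)] at hG'
  exact ⟨_, _, _, _, _, _, rfl, rfl, hF', hG', hFG.permute π, e.trans (.of_moves hFG hπ), hb⟩

theorem Rep.ne_of_distinct {M : Type*} {r s : Edge M → Name} {l : List (Edge M)}
    (h : DistinctNames (l.map (relabel r) ++ l.map (relabel s))) {e e' : Edge M} (he : e ∈ l)
    (he' : e' ∈ l) : r e ≠ s e' :=
  (distinctNames_append.1 h).2.2 _ (List.mem_map_of_mem he) _ (List.mem_map_of_mem he')

theorem Rep.of_id_comp [Infinite Name] {a : List Pol} (hK : Rep (.comp (.id a) f) A B K) :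
    Rep f A B K := by
  obtain ⟨hAB, C, W, F, ⟨hAC, l, -, rfl, rfl, hW⟩, hF, hWF, e⟩ := hK
  have hWF' := wf_wires_mul hAC hWF hW
  exact (hF.wires_comp hWF' hAB fun _ he _ he' => Rep.ne_of_distinct hAC he he').congr
    (e.trans (.mul_congr hW hWF hWF')).symm

theorem Rep.of_comp_id [Infinite Name] {b : List Pol} (hK : Rep (.comp f (.id b)) A B K) :
    Rep f A B K := by
  obtain ⟨hAB, C, F, W, hF, ⟨hCB, l, -, rfl, rfl, hW⟩, hFW, e⟩ := hK
  have hFW' := wf_mul_wires hCB hFW hW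
  exact (hF.comp_wires hFW' hAB fun _ he _ he' => Rep.ne_of_distinct hCB he he').congr
    (e.trans (.mul_right hW hFW hFW')).symm

theorem Rep.of_assoc [Infinite Name] (hK : Rep (.comp (.comp f g) h) A B K) :
    Rep (.comp f (.comp g h)) A B K := by
  obtain ⟨hAB, D, P, H, hP, hH, hPH, e⟩ := hK
  obtain ⟨C, F, G, hF, hG, hFG, e', hb⟩ := hP.exists_comp H.finite_names
  have h₁ := wf_mul_of_free hPH e' hb
  have hp : (mul (mul F G) H).factors.Perm (mul F (mul G H)).factors := by simp [factors]
  have h₂ := wf_of_perm hp h₁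
  refine ⟨hAB, C, F, mul G H, hF, ⟨?_, D, G, H, hG, hH, (wf_mul.1 h₂).2.1,
    .refl (wf_mul.1 h₂).2.1⟩, h₂, e.trans ((Equiv.mul_congr e' hPH h₁).trans (.of_perm h₁ hp))⟩
  refine distinctNames_append.2 ⟨(distinctNames_append.1 hG.distinct).1,
    (distinctNames_append.1 hH.distinct).2.1, fun c hc b hb' heq => ?_⟩
  exact hb _ (hF.isBound_comp hG hc) (heq ▸ hH.mem_names (.inr hb'))

theorem Rep.of_tens_id [Infinite Name] {a b : List Pol}
    (hK : Rep (.tens (.id a) (.id b)) A B K) : Rep (.id (a ++ b)) A B K := by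
  obtain ⟨hAB, A₁, A₂, B₁, B₂, F, G, rfl, rfl, ⟨-, l, rfl, rfl, rfl, hF⟩,
    ⟨-, m, rfl, rfl, rfl, hG⟩, hFG, e⟩ := hK
  have hW : (wires (fun e => e.name.1) (fun e => e.name.2) (l ++ m) : Expr S Name).WF :=
    wf_wires (by simpa only [List.map_append] using hAB)
  have hp : (wires (fun e => e.name.1) (fun e => e.name.2) (l ++ m) : Expr S Name).factors.Perm
      (mul (wires (fun e => e.name.1) (fun e => e.name.2) l)
        (wires (fun e => e.name.1) (fun e => e.name.2) m)).factors := by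
    simp [factors, factors_wires]
  exact ⟨hAB, l ++ m, List.map_append, List.map_append.symm, List.map_append.symm,
    e.trans ((Equiv.mul hF hG hFG (wf_of_perm hp hW)).trans (Equiv.of_perm hW hp).symm)⟩

theorem Rep.of_interchange [Infinite Name] {f' g' : Term S}
    (hK : Rep (.tens (.comp f g) (.comp f' g')) A B K) :
    Rep (.comp (.tens f f') (.tens g g')) A B K := by
  obtain ⟨hAB, A₁, A₂, B₁, B₂, P, P', rfl, rfl, hP, hP', hPP, e⟩ := hK
  obtain ⟨C₁, F, G, hF, hG, hFG, e₁, hb₁⟩ := hP.exists_comp P'.finite_names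
  have h₁ := wf_mul_of_free hPP e₁ hb₁
  obtain ⟨C₂, F', G', hF', hG', hFG', e₂, hb₂⟩ := hP'.exists_comp (mul F G).finite_names
  have h₂ := wf_mul_comm (wf_mul_of_free (wf_mul_comm h₁) e₂ hb₂)
  have hp : (mul (mul F G) (mul F' G')).factors.Perm (mul (mul F F') (mul G G')).factors := by
    simp only [factors, List.append_assoc]
    exact (List.perm_append_comm_assoc _ _ _).append_left _
  have h₃ := wf_of_perm hp h₂
  have h₄ := wf_mul.1 h₃
  simp only [distinctNames_append, List.mem_append] at hAB
  obtain ⟨⟨dA₁, dA₂, dA⟩, ⟨dB₁, dB₂, dB⟩, dAB⟩ := hAB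
  have d₁ := distinctNames_append.1 hF.distinct
  have d₂ := distinctNames_append.1 hG.distinct
  have d₁' := distinctNames_append.1 hF'.distinct
  have d₂' := distinctNames_append.1 hG'.distinct
  -- the names in the middle are bound, and so different from the names of the other factor
  have n₁ {c a : Edge Name} (hc : c ∈ C₁) (ha : a ∈ A₂ ∨ a ∈ B₂) (heq : c.name = a.name) : False :=
    hb₁ _ (hF.isBound_comp hG hc) (heq ▸ hP'.mem_names ha)
  have hFG₁ {n : Name} (hn : n ∈ F.names ∨ n ∈ G.names) : n ∈ (mul F G).names := by
    rcases hn with ⟨p, hn⟩ | ⟨p, hn⟩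
    exacts [⟨p, List.mem_append_left _ hn⟩, ⟨p, List.mem_append_right _ hn⟩]
  have n₂ {c : Edge Name} {n : Name} (hc : c ∈ C₂) (hn : n ∈ F.names ∨ n ∈ G.names)
      (heq : c.name = n) : False :=
    hb₂ _ (hF'.isBound_comp hG' hc) (heq ▸ hFG₁ hn)
  have dC : DistinctNames (C₁ ++ C₂) := distinctNames_append.2 ⟨d₂.1, d₂'.1, fun c hc c' hc' heq =>
    n₂ hc' (.inl (hF.mem_names (.inr hc))) heq.symm⟩
  have dAC : DistinctNames (A₁ ++ A₂ ++ (C₁ ++ C₂)) := by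
    refine distinctNames_append.2 ⟨distinctNames_append.2 ⟨dA₁, dA₂, dA⟩, dC, fun a ha c hc heq => ?_⟩
    rcases List.mem_append.1 ha with ha | ha <;> rcases List.mem_append.1 hc with hc | hc
    · exact d₁.2.2 a ha c hc heq
    · exact n₂ hc (.inl (hF.mem_names (.inl ha))) heq.symm
    · exact n₁ hc (.inl ha) heq.symm
    · exact d₁'.2.2 a ha c hc heq
  have dCB : DistinctNames (C₁ ++ C₂ ++ (B₁ ++ B₂)) := by
    refine distinctNames_append.2 ⟨dC, distinctNames_append.2 ⟨dB₁, dB₂, dB⟩, fun c hc b hb heq => ?_⟩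
    rcases List.mem_append.1 hb with hb | hb <;> rcases List.mem_append.1 hc with hc | hc
    · exact d₂.2.2 c hc b hb heq
    · exact n₂ hc (.inr (hG.mem_names (.inr hb))) heq
    · exact n₁ hc (.inr hb) heq
    · exact d₂'.2.2 c hc b hb heq
  refine ⟨?_, C₁ ++ C₂, mul F F', mul G G',
    ⟨dAC, _, _, _, _, F, F', rfl, rfl, hF, hF', h₄.1, .refl h₄.1⟩,
    ⟨dCB, _, _, _, _, G, G', rfl, rfl, hG, hG', h₄.2.1, .refl h₄.2.1⟩, h₃, ?_⟩
  · simp only [distinctNames_append, List.mem_append]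
    exact ⟨⟨dA₁, dA₂, dA⟩, ⟨dB₁, dB₂, dB⟩, dAB⟩
  · exact e.trans ((Equiv.mul e₁ e₂ hPP h₂).trans (.of_perm h₂ hp))

theorem Rep.of_tens_assoc [Infinite Name] (hK : Rep (.tens (.tens f g) h) A B K) :
    Rep (.tens f (.tens g h)) A B K := by
  obtain ⟨hAB, A', A₃, B', B₃, P, H, rfl, rfl, hP, hH, hPH, e⟩ := hK
  obtain ⟨A₁, A₂, B₁, B₂, F, G, rfl, rfl, hF, hG, hFG, e', hb⟩ := hP.exists_tens H.finite_names
  have h₁ := wf_mul_of_free hPH e' hb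
  have hp : (mul (mul F G) H).factors.Perm (mul F (mul G H)).factors := by simp [factors]
  have h₂ := wf_of_perm hp h₁
  refine ⟨hAB, A₁, A₂ ++ A₃, B₁, B₂ ++ B₃, F, mul G H, List.append_assoc .., List.append_assoc ..,
    hF, ⟨?_, A₂, A₃, B₂, B₃, G, H, rfl, rfl, hG, hH, (wf_mul.1 h₂).2.1, .refl (wf_mul.1 h₂).2.1⟩,
    h₂, e.trans ((Equiv.mul_congr e' hPH h₁).trans (.of_perm h₁ hp))⟩
  refine List.Nodup.sublist (List.Sublist.map _ ?_) hAB
  simp only [List.append_assoc]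
  refine (List.Sublist.append_left ?_ _).trans (List.sublist_append_right A₁ _)
  exact List.Sublist.append_left (List.sublist_append_right B₁ _) _

theorem Rep.of_unit_tens [Infinite Name] (hK : Rep (.tens (.id []) f) A B K) : Rep f A B K := by
  obtain ⟨-, A₁, A₂, B₁, B₂, W, F, rfl, rfl, ⟨-, l, hl, rfl, rfl, hW⟩, hF, hWF, e⟩ := hK
  obtain rfl := List.map_eq_nil_iff.1 hl
  have h₁ : (mul one F).WF := wf_mul.2 ⟨⟨trivial, List.nodup_nil⟩, hF.wf,
    fun _ h => (List.not_mem_nil h).elim⟩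
  simp only [List.map_nil, List.nil_append]
  exact hF.congr (e.trans ((Equiv.mul_congr hW hWF h₁).trans
    (Equiv.of_perm (H := F) h₁ (.refl _)))).symm

theorem Rep.of_tens_unit [Infinite Name] (hK : Rep (.tens f (.id [])) A B K) : Rep f A B K := by
  obtain ⟨-, A₁, A₂, B₁, B₂, F, W, rfl, rfl, hF, ⟨-, l, hl, rfl, rfl, hW⟩, hFW, e⟩ := hK
  obtain rfl := List.map_eq_nil_iff.1 hl
  have h₁ : (mul F one).WF := wf_mul.2 ⟨hF.wf, ⟨trivial, List.nodup_nil⟩,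
    fun _ _ => List.not_mem_nil⟩
  simp only [List.map_nil, List.append_nil]
  exact hF.congr (e.trans ((Equiv.mul_right hW hFW h₁).trans (.mul_one hF.wf))).symm

theorem Rep.tens_swap [Infinite Name] {A₁ A₂ B₁ B₂ : List (Edge Name)} {a' : List Pol}
    (hf : HasType f (A₁.map Edge.pol) a') (hB : B₁.map Edge.pol = a')
    (hK : Rep (.tens f g) (A₁ ++ A₂) (B₁ ++ B₂) K) : Rep (.tens g f) (A₂ ++ A₁) (B₂ ++ B₁) K := by
  obtain ⟨hd, A₁', A₂', B₁', B₂', F, G, hA, hB', hF, hG, hFG, e⟩ := hK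
  obtain ⟨h₁, h₂⟩ := hasType_unique hf hF.hasType
  obtain ⟨rfl, rfl⟩ := append_inj_of_pol hA h₁
  obtain ⟨rfl, rfl⟩ := append_inj_of_pol hB' (hB.trans h₂)
  exact ⟨hd.perm (List.perm_append_comm.append List.perm_append_comm), _, _, _, _, _, _, rfl, rfl,
    hG, hF, wf_mul_comm hFG, e.trans (.comm hFG)⟩

theorem Rep.exists_of_comp_symm [Infinite Name] {a b : List Pol}
    (hK : Rep (.comp f (.symm a b)) A B K) : ∃ B₁ B₂, B = B₂ ++ B₁ ∧ B₁.map Edge.pol = a ∧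
      B₂.map Edge.pol = b ∧ Rep f A (B₁ ++ B₂) K := by
  obtain ⟨hAB, C, F, W, hF, ⟨hCB, l, m, rfl, rfl, rfl, rfl, hW⟩, hFW, e⟩ := hK
  have hp : ((m ++ l).map (relabel fun e => e.name.2)).Perm
      ((l ++ m).map (relabel fun e => e.name.2)) := List.perm_append_comm.map _
  have hCB' := hCB.perm (hp.append_left _)
  have hFW' := wf_mul_wires hCB' hFW hW
  refine ⟨l.map (relabel fun e => e.name.2), m.map (relabel fun e => e.name.2),
    List.map_append, map_pol_relabel .., map_pol_relabel .., ?_⟩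
  rw [← List.map_append]
  exact (hF.comp_wires hFW' (hAB.perm (hp.append_left _)) fun _ he _ he' =>
    Rep.ne_of_distinct hCB' he he').congr (e.trans (.mul_right hW hFW hFW')).symm

theorem Rep.exists_of_symm_comp [Infinite Name] {a b : List Pol}
    (hK : Rep (.comp (.symm a b) f) A B K) : ∃ A₁ A₂, A = A₁ ++ A₂ ∧ A₁.map Edge.pol = a ∧
      A₂.map Edge.pol = b ∧ Rep f (A₂ ++ A₁) B K := by
  obtain ⟨hAB, C, W, F, ⟨hAC, l, m, rfl, rfl, rfl, rfl, hW⟩, hF, hWF, e⟩ := hK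
  have hp₁ {r : Edge (Name × Name) → Name} :
      ((l ++ m).map (relabel r)).Perm ((m ++ l).map (relabel r)) := List.perm_append_comm.map _
  have hAC' := hAC.perm (hp₁.append_right _)
  have hp : (wires (fun e => e.name.1) (fun e => e.name.2) (l ++ m) : Expr S Name).factors.Perm
      (wires (fun e => e.name.1) (fun e => e.name.2) (m ++ l)).factors := by
    rw [factors_wires, factors_wires]
    exact List.perm_append_comm.map _
  have hW' := hW.trans (.of_perm hW.wf' hp)
  have hWF' := wf_wires_mul hAC' hWF hW'
  refine ⟨l.map (relabel fun e => e.name.1), m.map (relabel fun e => e.name.1),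
    List.map_append, map_pol_relabel .., map_pol_relabel .., ?_⟩
  rw [← List.map_append]
  exact (hF.wires_comp hWF' (hAB.perm (hp₁.append_right _)) fun _ he _ he' =>
    Rep.ne_of_distinct hAC' he he').congr (e.trans (.mul_congr hW' hWF hWF')).symm

theorem Rep.iff_symm_natural [Infinite Name] {a b a' b' : List Pol} (hf : HasType f a a')
    (hg : HasType g b b') : Rep (.comp (.tens f g) (.symm a' b')) A B K ↔
      Rep (.comp (.symm a b) (.tens g f)) A B K := by
  have ht : HasType (.comp (.symm a b) (.tens g f)) (a ++ b) (b' ++ a') :=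
    .comp (.symm a b) (.tens hg hf)
  refine Rep.iff_of_exists (.comp (.tens hf hg) (.symm a' b')) ht fun A B hA hB hd => ?_
  obtain ⟨K, hK⟩ := exists_rep (HasType.comp (.tens hf hg) (.symm a' b')) hA hB hd
  obtain ⟨H, hH⟩ := exists_rep ht hA hB hd
  refine ⟨K, hK, hH.congr ?_⟩
  obtain ⟨B₁, B₂, rfl, hB₁, hB₂, hK'⟩ := hK.exists_of_comp_symm
  obtain ⟨A₁, A₂, rfl, hA₁, hA₂, hH'⟩ := hH.exists_of_symm_comp
  exact hH'.unique (hK'.tens_swap (hA₁.symm ▸ hf) hB₁)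

theorem Rep.iff_symm_symm [Infinite Name] (a b : List Pol) :
    Rep (.comp (.symm a b) (.symm b a)) A B K ↔ Rep (.id (a ++ b)) A B K := by
  refine Rep.iff_of_exists (.comp (.symm _ _) (.symm _ _)) (.id _) fun A B hA hB hd => ?_
  obtain ⟨l, rfl, rfl⟩ := exists_pairs (hA.trans hB.symm)
  rw [map_pol_relabel] at hA
  obtain ⟨l₁, l₂, rfl, rfl, rfl⟩ := List.map_eq_append_iff.1 hA
  refine ⟨_, rep_rewiring (.comp (.symm l₁ l₂) (.symm l₂ l₁)) hd, ?_⟩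
  rw [← List.map_append]
  exact rep_rewiring (.id (l₁ ++ l₂)) hd

theorem Rep.iff_hexagon [Infinite Name] (a b c : List Pol) :
    Rep (.symm a (b ++ c)) A B K ↔
      Rep (.comp (.tens (.symm a b) (.id c)) (.tens (.id b) (.symm a c))) A B K := by
  refine Rep.iff_of_exists (.symm _ _) (Eqv.hexagon a b c).hasType.2 fun A B hA hB hd => ?_
  obtain ⟨A₁, A₂, rfl, hA₁, hA₂⟩ := List.map_eq_append_iff.1 hA
  obtain ⟨B₂, B₁, rfl, hB₂, hB₁⟩ := List.map_eq_append_iff.1 hB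
  obtain ⟨l₁, rfl, rfl⟩ := exists_pairs (hA₁.trans hB₁.symm)
  obtain ⟨l, rfl, rfl⟩ := exists_pairs (hA₂.trans hB₂.symm)
  rw [map_pol_relabel] at hA₁ hA₂
  obtain ⟨l₂, l₃, rfl, rfl, rfl⟩ := List.map_eq_append_iff.1 hA₂
  obtain rfl := hA₁
  simp only [← List.map_append] at hd ⊢
  refine ⟨wires (fun e => e.name.1) (fun e => e.name.2) (l₁ ++ (l₂ ++ l₃)), ?_, ?_⟩
  · exact rep_rewiring (.symm l₁ (l₂ ++ l₃)) hd
  · refine rep_rewiring (.comp (m := l₂ ++ l₁ ++ l₃) ?_ ?_) hd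
    · simpa only [List.append_assoc] using Rewiring.tens (.symm (S := S) l₁ l₂) (.id l₃)
    · simpa only [List.append_assoc] using Rewiring.tens (.id (S := S) l₂) (.symm l₁ l₃)

theorem Equiv.ident_comp {a b c : Name} (hab : a ≠ b)
    (h : (Expr.mul (ident a b) (ident c a) : Expr S Name).WF) :
    Equiv (Expr.mul (ident a b) (ident c a)) (ident c b : Expr S Name) := by
  have := Equiv.contract_out h ⟨by simp [edges], by simp [edges, Edge.flip, Pol.flip, hab]⟩
  simpa [substEdge, rename] using this

/-- A chain of four identity tensors contracts to one. -/
theorem Equiv.ident_chain [Infinite Name] {a b c d e : Name} (h : [a, b, c, d, e].Nodup) :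
    (Expr.mul (Expr.mul (Expr.mul (ident a b) (ident c a)) (ident d c))
      (ident e d) : Expr S Name).WF ∧
    Equiv (Expr.mul (Expr.mul (Expr.mul (ident a b) (ident c a)) (ident d c)) (ident e d))
      (ident e b : Expr S Name) := by
  simp only [List.nodup_cons, List.mem_cons, List.not_mem_nil, or_false, not_or] at h
  obtain ⟨⟨hab, hac, had, hae⟩, ⟨hbc, hbd, hbe⟩, ⟨hcd, hce⟩, hde, -⟩ := h
  have w₁ : (Expr.mul (Expr.mul (Expr.mul (ident a b) (ident c a)) (ident d c))
      (ident e d) : Expr S Name).WF := by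
    refine ⟨by simp [AritiesMatch], ?_⟩
    simp only [edges, List.cons_append, List.nil_append, List.nodup_cons, List.mem_cons,
      Edge.mk.injEq, reduceCtorEq, false_and, true_and, List.not_mem_nil, List.nodup_nil]
    grind
  have w₂ : (Expr.mul (Expr.mul (ident c b) (ident d c)) (ident e d) : Expr S Name).WF := by
    refine ⟨by simp [AritiesMatch], ?_⟩
    simp only [edges, List.cons_append, List.nil_append, List.nodup_cons, List.mem_cons,
      Edge.mk.injEq, reduceCtorEq, false_and, true_and, List.not_mem_nil, List.nodup_nil]
    grind
  have w₃ : (Expr.mul (ident d b) (ident e d) : Expr S Name).WF := by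
    refine ⟨by simp [AritiesMatch], ?_⟩
    simp only [edges, List.cons_append, List.nil_append, List.nodup_cons, List.mem_cons,
      Edge.mk.injEq, reduceCtorEq, false_and, true_and, List.not_mem_nil, List.nodup_nil]
    grind
  have w₁' := (wf_mul.1 w₁).1
  have w₂' := (wf_mul.1 w₂).1
  refine ⟨w₁, ?_⟩
  refine (Equiv.mul_congr (.mul_congr (.ident_comp hab (wf_mul.1 w₁').1) w₁' w₂') w₁ w₂).trans ?_
  exact (Equiv.mul_congr (.ident_comp (Ne.symm hbc) w₂') w₂ w₃).trans (.ident_comp (Ne.symm hbd) w₃)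

/-- The names that the snake equations need: two given ones and three fresh ones. -/
theorem exists_chain_names [Infinite Name] {a b : Name} (h : a ≠ b) :
    ∃ c d e : Name, [a, b, c, d, e].Nodup := by
  obtain ⟨r, hr, hV⟩ := exists_fresh (Name := Name) [0, 1, 2] (V := {a, b}) (by simp)
  refine ⟨r 0, r 1, r 2, ?_⟩
  have h₀ := hV 0
  have h₁ := hV 1
  have h₂ := hV 2
  have h₀₁ := mt (hr 0 (by simp) 1 (by simp)) (by simp)
  have h₀₂ := mt (hr 0 (by simp) 2 (by simp)) (by simp)
  have h₁₂ := mt (hr 1 (by simp) 2 (by simp)) (by simp)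
  simp only [Set.mem_insert_iff, Set.mem_singleton_iff, not_or] at h₀ h₁ h₂
  simp only [List.nodup_cons, List.mem_cons, List.not_mem_nil, or_false, not_or]
  tauto

theorem Rep.iff_snake [Infinite Name] :
    Rep (.comp (.tens .cup (.id [.out])) (.tens (.id [.out]) .cap)) A B K ↔
      Rep (.id [.out]) A B K := by
  refine Rep.iff_of_exists (Eqv.snake (S := S)).hasType.1 (.id _) fun A B hA hB hd => ?_
  obtain ⟨⟨_, a⟩, rfl, rfl⟩ := List.map_eq_singleton_iff.1 hA
  obtain ⟨⟨_, b⟩, rfl, rfl⟩ := List.map_eq_singleton_iff.1 hB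
  have hab : a ≠ b := by simpa [DistinctNames] using hd
  obtain ⟨c, d, e, h⟩ := exists_chain_names hab
  have h' : [e, a, d, c, b].Nodup := by
    simp only [List.nodup_cons, List.mem_cons, List.not_mem_nil, or_false, not_or] at h ⊢
    grind
  obtain ⟨w, hw⟩ := Equiv.ident_chain (S := S) h'
  simp only [List.nodup_cons, List.mem_cons, List.not_mem_nil, or_false, not_or] at h
  let W (a b : Name) : Expr S Name := wires (fun e => e.name.1) (fun e => e.name.2)
    [(⟨.out, (a, b)⟩ : Edge (Name × Name))]
  have hp : (mul (mul (mul (ident e a) (ident d e)) (ident c d)) (ident b c) :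
      Expr S Name).factors.Perm (mul (mul (ident c d) (W a e)) (mul (W c b) (ident d e))).factors :=
    List.perm_append_comm (l₁ := [ident e a, ident d e]) (l₂ := [ident c d, ident b c]) |>.trans
      (.cons _ (.swap _ _ _))
  have hw' := wf_of_perm hp w
  have h₁ := (wf_mul.1 hw').1
  have h₂ := (wf_mul.1 hw').2.1
  refine ⟨W a b, ⟨hd, [⟨.out, c⟩, ⟨.inp, d⟩, ⟨.out, e⟩], mul (ident c d) (W a e),
    mul (W c b) (ident d e), ⟨?_, [], [⟨.out, a⟩], [⟨.out, c⟩, ⟨.inp, d⟩], [⟨.out, e⟩],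
      ident c d, W a e, rfl, rfl, ⟨?_, c, d, rfl, rfl, .refl (wf_mul.1 h₁).1⟩,
      ⟨?_, [⟨.out, (a, e)⟩], rfl, rfl, rfl, .refl (wf_mul.1 h₁).2.1⟩, h₁, .refl h₁⟩,
    ⟨?_, [⟨.out, c⟩], [⟨.inp, d⟩, ⟨.out, e⟩], [⟨.out, b⟩], [], W c b, ident d e, rfl, rfl,
      ⟨?_, [⟨.out, (c, b)⟩], rfl, rfl, rfl, .refl (wf_mul.1 h₂).1⟩,
      ⟨?_, d, e, rfl, rfl, .refl (wf_mul.1 h₂).2.1⟩, h₂, .refl h₂⟩, hw', ?_⟩,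
    hd, [⟨.out, (a, b)⟩], rfl, rfl, rfl, .refl ?_⟩
  rotate_right
  · exact wf_wires hd
  rotate_right
  · exact (Equiv.mul_one hw.wf').trans (hw.symm.trans (.of_perm w hp))
  all_goals
    simp only [DistinctNames, List.map_cons, List.map_nil, List.cons_append, List.nil_append,
      List.append_nil, List.nodup_cons, List.mem_cons, List.not_mem_nil, or_false, not_or,
      List.nodup_nil]
    grind

theorem Rep.iff_snake' [Infinite Name] :
    Rep (.comp (.tens (.id [.inp]) .cup) (.tens .cap (.id [.inp]))) A B K ↔
      Rep (.id [.inp]) A B K := by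
  refine Rep.iff_of_exists (Eqv.snake' (S := S)).hasType.1 (.id _) fun A B hA hB hd => ?_
  obtain ⟨⟨_, a⟩, rfl, rfl⟩ := List.map_eq_singleton_iff.1 hA
  obtain ⟨⟨_, b⟩, rfl, rfl⟩ := List.map_eq_singleton_iff.1 hB
  have hab : a ≠ b := by simpa [DistinctNames] using hd
  obtain ⟨c, d, e, h⟩ := exists_chain_names hab
  have h' : [e, b, d, c, a].Nodup := by
    simp only [List.nodup_cons, List.mem_cons, List.not_mem_nil, or_false, not_or] at h ⊢
    grind
  obtain ⟨w, hw⟩ := Equiv.ident_chain (S := S) h'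
  simp only [List.nodup_cons, List.mem_cons, List.not_mem_nil, or_false, not_or] at h
  let W (a b : Name) : Expr S Name := wires (fun e => e.name.1) (fun e => e.name.2)
    [(⟨.inp, (a, b)⟩ : Edge (Name × Name))]
  have hp : (mul (mul (mul (ident e b) (ident d e)) (ident c d)) (ident a c) :
      Expr S Name).factors.Perm (mul (mul (W a c) (ident d e)) (mul (ident c d) (W e b))).factors :=
    List.perm_append_comm (l₁ := [ident e b, ident d e, ident c d]) (l₂ := [ident a c]) |>.trans
      (List.Perm.cons _ (List.perm_append_comm (l₁ := [ident e b])
        (l₂ := [ident d e, ident c d])))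
  have hw' := wf_of_perm hp w
  have h₁ := (wf_mul.1 hw').1
  have h₂ := (wf_mul.1 hw').2.1
  refine ⟨W a b, ⟨hd, [⟨.inp, c⟩, ⟨.out, d⟩, ⟨.inp, e⟩], mul (W a c) (ident d e),
    mul (ident c d) (W e b), ⟨?_, [⟨.inp, a⟩], [], [⟨.inp, c⟩], [⟨.out, d⟩, ⟨.inp, e⟩],
      W a c, ident d e, rfl, rfl, ⟨?_, [⟨.inp, (a, c)⟩], rfl, rfl, rfl, .refl (wf_mul.1 h₁).1⟩,
      ⟨?_, d, e, rfl, rfl, .refl (wf_mul.1 h₁).2.1⟩, h₁, .refl h₁⟩,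
    ⟨?_, [⟨.inp, c⟩, ⟨.out, d⟩], [⟨.inp, e⟩], [], [⟨.inp, b⟩], ident c d, W e b, rfl, rfl,
      ⟨?_, c, d, rfl, rfl, .refl (wf_mul.1 h₂).1⟩,
      ⟨?_, [⟨.inp, (e, b)⟩], rfl, rfl, rfl, .refl (wf_mul.1 h₂).2.1⟩, h₂, .refl h₂⟩, hw', ?_⟩,
    hd, [⟨.inp, (a, b)⟩], rfl, rfl, rfl, .refl ?_⟩
  rotate_right
  · exact wf_wires hd
  rotate_right
  · exact (Equiv.mul_one hw.wf').trans (hw.symm.trans (.of_perm w hp))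
  all_goals
    simp only [DistinctNames, List.map_cons, List.map_nil, List.cons_append, List.nil_append,
      List.append_nil, List.nodup_cons, List.mem_cons, List.not_mem_nil, or_false, not_or,
      List.nodup_nil]
    grind

/-- Equal morphisms are represented by the same tensors. -/
theorem rep_iff_of_eqv [Infinite Name] {a b : List Pol} (e : Eqv a b f g) :
    Rep f A B K ↔ Rep g A B K := by
  induction e generalizing A B K with
  | refl => rfl
  | sym _ ih => exact ih.symm
  | trans _ _ ih₁ ih₂ => exact ih₁.trans ih₂
  | comp_congr _ _ ih₁ ih₂ => simp only [Rep, ih₁, ih₂]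
  | tens_congr _ _ ih₁ ih₂ => simp only [Rep, ih₁, ih₂]
  | id_comp h => exact Rep.iff_of_imp (.comp (.id _) h) h fun _ _ _ => .of_id_comp
  | comp_id h => exact Rep.iff_of_imp (.comp h (.id _)) h fun _ _ _ => .of_comp_id
  | assoc h₁ h₂ h₃ =>
    exact Rep.iff_of_imp (.comp (.comp h₁ h₂) h₃) (.comp h₁ (.comp h₂ h₃)) fun _ _ _ => .of_assoc
  | tens_id a b =>
    exact Rep.iff_of_imp (.tens (.id a) (.id b)) (.id _) fun _ _ _ => .of_tens_id
  | interchange h₁ h₂ h₃ h₄ =>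
    exact (Rep.iff_of_imp (.tens (.comp h₁ h₂) (.comp h₃ h₄)) (.comp (.tens h₁ h₃) (.tens h₂ h₄))
      fun _ _ _ => .of_interchange).symm
  | tens_assoc h₁ h₂ h₃ =>
    have e := (Eqv.tens_assoc h₁ h₂ h₃).hasType
    exact Rep.iff_of_imp e.1 e.2 fun _ _ _ => .of_tens_assoc
  | unit_tens h =>
    exact Rep.iff_of_imp (Eqv.unit_tens h).hasType.1 h fun _ _ _ => .of_unit_tens
  | tens_unit h =>
    exact Rep.iff_of_imp (Eqv.tens_unit h).hasType.1 h fun _ _ _ => .of_tens_unit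
  | symm_natural hf hg => exact Rep.iff_symm_natural hf hg
  | symm_symm a b => exact Rep.iff_symm_symm a b
  | hexagon a b c => exact Rep.iff_hexagon a b c
  | snake => exact Rep.iff_snake
  | snake' => exact Rep.iff_snake'

end Expr

/-! ### Morphisms are determined by the tensors that represent them -/

namespace Expr

variable {S : Signature.{u}} {Name : Type v}
variable {f g h : Term S} {A B C : List (Edge Name)} {F G H K : Expr S Name}

theorem Rep.nodup_append (h : Rep f A B K) : (A ++ K.edges).Nodup := by
  refine List.nodup_append.2 ⟨List.Nodup.of_map _ (distinctNames_append.1 h.distinct).1, h.wf.2, ?_⟩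
  rintro a ha _ hb rfl
  exact ((h.isFree_iff a.flip).2 (.inl ((Edge.flip_flip a).symm ▸ ha))).2
    ((Edge.flip_flip a).symm ▸ hb)

theorem Rep.freeIn_iff (h : Rep f A B K) (e : Edge Name) : e ∈ B ↔ FreeIn (A ++ K.edges) e := by
  have h₁ := h.isFree_iff e
  have h₂ := h.isFree_iff e.flip
  have h₃ := distinctNames_append.1 h.distinct
  have h₄ := fun h h' => h₃.2.2 e.flip h e h' rfl
  have h₅ := fun h h' => h₃.2.2 e h e h' rfl
  rw [Edge.flip_flip] at h₂
  simp only [FreeIn, List.mem_append, IsFree, Edge.flip_flip] at h₁ h₂ ⊢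
  tauto

theorem Rep.nodup_right (h : Rep f A B K) : B.Nodup :=
  List.Nodup.of_map _ (distinctNames_append.1 h.distinct).2.1

theorem Rep.exists_contr (h : Rep f A B K) : ∃ c : Mor S, Contr (A ++ K.edges) B c :=
  TensorCC.exists_contr h.nodup_append h.nodup_right h.freeIn_iff

/-- In recovering a morphism, the representing tensor may be replaced by an equivalent one. -/
theorem Rep.eq_of_equiv (hK : Rep f A B K) (e : Equiv K H) {c c' : Mor S}
    (hc' : Contr (A ++ H.edges) B c')
    (h : Mor.mk f = (Mor.id (A.map Edge.pol) ⊗ₘ Mor.mk H.base) ≫ₘ c')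
    (hc : Contr (A ++ K.edges) B c) :
    Mor.mk f = (Mor.id (A.map Edge.pol) ⊗ₘ Mor.mk K.base) ≫ₘ c :=
  h.trans (e.sound_tens hK.nodup_append (hK.congr e).nodup_append
    hK.nodup_right hK.freeIn_iff hc hc').symm

theorem _root_.TensorCC.Mor.tens_comp_tens_id_comp (x y c d : Mor S) {w : Mor S} {a : List Pol}
    (h : w.cod = a) :
    (x ⊗ₘ y ⊗ₘ w) ≫ₘ (c ⊗ₘ Mor.id a) ≫ₘ d = (((x ⊗ₘ y) ≫ₘ c) ⊗ₘ w) ≫ₘ d := by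
  rw [← Mor.assoc, ← Mor.tens_assoc, Mor.interchange' h, Mor.comp_id h]

theorem aritiesMatch_wires {M : Type*} (r s : Edge M → Name) (l : List (Edge M)) :
    (wires r s l : Expr S Name).AritiesMatch := by
  induction l with
  | nil => trivial
  | cons e l ih => exact ⟨wf_wire.1, ih⟩

/-- Bending the wires around the cups of identity tensors and back does nothing. -/
theorem exists_contr_wires {M : Type*} (r s : Edge M → Name) (l : List (Edge M))
    (P : List (Edge Name)) : ∃ c : Mor S,
      Contr (P ++ l.map (relabel r) ++ (wires r s l : Expr S Name).edges)
        (P ++ l.map (relabel s)) c ∧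
      (Mor.id ((P ++ l.map (relabel r)).map Edge.pol) ⊗ₘ Mor.mk (wires r s l).base) ≫ₘ c =
        Mor.id ((P ++ l.map (relabel r)).map Edge.pol) := by
  induction l generalizing P with
  | nil =>
    refine ⟨Mor.id (P.map Edge.pol), ?_, ?_⟩
    · change Contr (P ++ [] ++ []) (P ++ []) _
      simpa only [List.append_nil] using Contr.id (S := S) P
    · change (Mor.id ((P ++ []).map Edge.pol) ⊗ₘ Mor.id []) ≫ₘ _ = Mor.id ((P ++ []).map Edge.pol)
      rw [Mor.tens_unit, List.append_nil]
      exact Mor.comp_id rfl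
  | cons e l ih =>
    obtain ⟨c₁, h₁, e₁⟩ : ∃ c : Mor S, Contr ((P ++ relabel r e :: l.map (relabel r)) ++
        (wire ⟨e.pol, r e⟩ (s e) : Expr S Name).edges)
        (P ++ relabel s e :: l.map (relabel r)) c ∧
      (Mor.id ((P ++ relabel r e :: l.map (relabel r)).map Edge.pol) ⊗ₘ Mor.cup) ≫ₘ c =
        Mor.id ((P ++ relabel r e :: l.map (relabel r)).map Edge.pol) := by
      obtain ⟨_ | _, n⟩ := e
      · exact exists_contr_snake_out _ _ _ _
      · exact exists_contr_snake_inp _ _ _ _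
    obtain ⟨c₂, h₂, e₂⟩ := ih (P ++ [relabel s e])
    have hb : Mor.mk (wires r s (e :: l) : Expr S Name).base =
        Mor.cup ⊗ₘ Mor.mk (wires r s l : Expr S Name).base := by
      obtain ⟨_ | _, n⟩ := e <;> rfl
    have hw := cod_base (aritiesMatch_wires (S := S) r s l)
    refine ⟨(c₁ ⊗ₘ Mor.id ((wires r s l : Expr S Name).edges.map Edge.pol)) ≫ₘ c₂, ?_, ?_⟩
    · have := (h₁.tens (.id (wires r s l : Expr S Name).edges)).comp
        (n := P ++ [relabel s e] ++ l.map (relabel s)) (by simpa using h₂)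
      simpa [wires_cons, edges] using this
    · rw [hb, List.map_cons, Mor.tens_comp_tens_id_comp _ _ _ _ hw, e₁]
      simpa [relabel] using e₂

/-- A morphism is recovered from a tensor that represents it: bend the inputs to the bottom, and
contract. -/
theorem Rep.eq_contr [Infinite Name] (hK : Rep f A B K) {c : Mor S}
    (hc : Contr (A ++ K.edges) B c) :
    Mor.mk f = (Mor.id (A.map Edge.pol) ⊗ₘ Mor.mk K.base) ≫ₘ c := by
  induction f generalizing A B K c with
  | id a =>
    obtain ⟨-, l, rfl, rfl, rfl, h⟩ := id hK
    obtain ⟨c', h₁, h₂⟩ := exists_contr_wires (S := S) (fun e => e.name.1) (fun e => e.name.2) l []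
    refine hK.eq_of_equiv h h₁ ?_ hc
    rw [← map_pol_relabel (fun e => e.name.1) l]
    exact h₂.symm
  | comp f g ihf ihg =>
    obtain ⟨-, C, F, G, hF, hG, hFG, h⟩ := id hK
    obtain ⟨c₁, h₁⟩ := hF.exists_contr
    obtain ⟨c₂, h₂⟩ := hG.exists_contr
    have h₃ := (h₁.tens (.id G.edges)).comp h₂
    rw [List.append_assoc] at h₃
    refine hK.eq_of_equiv h h₃ ?_ hc
    rw [Mor.mk_comp, ihf hF h₁, ihg hG h₂]
    change _ = (_ ⊗ₘ Mor.mk F.base ⊗ₘ Mor.mk G.base) ≫ₘ _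
    rw [Mor.tens_comp_tens_id_comp _ _ _ _ (cod_base hG.wf.1),
      Mor.tens_eq_comp _ _ ((Mor.cod_comp _ _).trans h₁.cod) (dom_base hG.wf.1), Mor.tens_unit]
    simp only [Mor.assoc]
  | tens f g ihf ihg =>
    obtain ⟨-, A₁, A₂, B₁, B₂, F, G, rfl, rfl, hF, hG, hFG, h⟩ := id hK
    obtain ⟨c₁, h₁⟩ := hF.exists_contr
    obtain ⟨c₂, h₂⟩ := hG.exists_contr
    have h₃ := (Contr.id (S := S) A₁).tens ((Contr.symm A₂ F.edges).tens (.id G.edges)) |>.comp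
      (n := B₁ ++ B₂) (by simpa only [List.append_assoc] using h₁.tens h₂)
    refine hK.eq_of_equiv h (by simpa only [List.append_assoc, edges] using h₃) ?_ hc
    rw [Mor.mk_tens, ihf hF h₁, ihg hG h₂]
    change _ = (_ ⊗ₘ Mor.mk F.base ⊗ₘ Mor.mk G.base) ≫ₘ _
    have hF₁ := dom_base hF.wf.1
    have hF₂ := cod_base hF.wf.1
    have key : (Mor.id ((A₁ ++ A₂).map Edge.pol) ⊗ₘ Mor.mk F.base ⊗ₘ Mor.mk G.base) ≫ₘ
        (Mor.id (A₁.map Edge.pol) ⊗ₘ Mor.symm (A₂.map Edge.pol) (F.edges.map Edge.pol) ⊗ₘ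
          Mor.id (G.edges.map Edge.pol)) =
        (Mor.id (A₁.map Edge.pol) ⊗ₘ Mor.mk F.base) ⊗ₘ
          Mor.id (A₂.map Edge.pol) ⊗ₘ Mor.mk G.base := by
      rw [List.map_append, ← Mor.tens_id, Mor.tens_assoc, Mor.interchange rfl,
        Mor.id_comp (Mor.dom_id (A₁.map Edge.pol)), ← Mor.tens_assoc (Mor.id (A₂.map Edge.pol)), Mor.interchange (by simp [hF₂]),
        Mor.comp_id (cod_base hG.wf.1), Mor.symm_natural_right _ hF₁ hF₂, Mor.symm_nil,
        Mor.id_comp (by simp [hF₁]), Mor.tens_assoc, Mor.tens_assoc]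
    rw [← Mor.assoc, key, Mor.interchange]
    rw [h₁.dom]
    simp [hF₂]
  | symm a b =>
    obtain ⟨-, l, m, rfl, rfl, rfl, rfl, h⟩ := id hK
    obtain ⟨c', h₁, h₂⟩ := exists_contr_wires (S := S) (fun e => e.name.1) (fun e => e.name.2)
      (l ++ m) []
    have h₃ := h₁.comp (n := (m ++ l).map (relabel fun e => e.name.2))
      (by simpa only [List.map_append, List.nil_append] using Contr.symm (S := S) _ _)
    refine hK.eq_of_equiv h h₃ ?_ hc
    rw [← Mor.assoc]
    refine ((congrArg (· ≫ₘ _) h₂).trans ?_).symm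
    rw [Mor.id_comp]
    · simp only [map_pol_relabel]; rfl
    · simp only [Mor.dom_symm, List.nil_append, List.map_append, map_pol_relabel]
  | cup =>
    obtain ⟨-, a, b, rfl, rfl, h⟩ := id hK
    exact hK.eq_of_equiv h (.id _) (((Mor.comp_id rfl).trans (Mor.unit_tens _)).symm) hc
  | cap =>
    obtain ⟨-, a, b, rfl, rfl, h⟩ := id hK
    obtain ⟨c', h₁, h₂⟩ := exists_contr_snake_out (S := S) [⟨.inp, a⟩] [] a b
    refine hK.eq_of_equiv h (.comp h₁ (.cap a)) ?_ hc
    rw [← Mor.assoc]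
    exact ((congrArg (· ≫ₘ Mor.cap) h₂).trans (Mor.id_comp rfl)).symm
  | gen φ =>
    obtain ⟨-, rfl, h₁, h⟩ := id hK
    exact hK.eq_of_equiv h (.id _)
      ((Mor.comp_id (by exact h₁.symm)).trans (Mor.unit_tens _)).symm hc

/-- Morphisms that are represented by the same tensor are equal. -/
theorem Rep.eqv [Infinite Name] (hf : Rep f A B K) (hg : Rep g A B K) :
    Eqv (A.map Edge.pol) (B.map Edge.pol) f g := by
  obtain ⟨c, hc⟩ := hf.exists_contr
  exact Mor.eqv_of_mk_eq hf.hasType ((hf.eq_contr hc).trans (hg.eq_contr hc).symm)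

end Expr

/-! ### An expression represents its normal forms -/

namespace Expr

variable {S : Signature.{u}} {Name : Type v}
variable {A B : List (Edge Name)} {G : Expr S Name}

theorem rep_base (hG : G.AritiesMatch) (hd : DistinctNames G.edges) :
    Rep G.base [] G.edges G := by
  induction G with
  | one => exact ⟨hd, [], rfl, rfl, rfl, .refl ⟨hG, List.nodup_nil⟩⟩
  | ident a b => exact ⟨hd, a, b, rfl, rfl, .refl ⟨hG, hd.of_map⟩⟩
  | gen φ es => exact ⟨hd, rfl, hG, .refl ⟨hG, hd.of_map⟩⟩
  | mul G H ihG ihH =>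
    have hd' := distinctNames_append.1 hd
    exact ⟨hd, [], [], _, _, G, H, rfl, rfl, ihG hG.1 hd'.1, ihH hG.2 hd'.2.1,
      ⟨hG, hd.of_map⟩, .refl ⟨hG, hd.of_map⟩⟩

theorem distinctNames_relabel {M : Type*} {r : Edge M → Name} {l : List (Edge M)} (hl : l.Nodup)
    (h : ∀ e ∈ l, ∀ e' ∈ l, r e = r e' → e = e') : DistinctNames (l.map (relabel r)) := by
  have : (l.map (relabel r)).map Edge.name = l.map r := by simp [relabel, Function.comp_def]
  rw [DistinctNames, this]
  exact hl.map_on fun e he e' he' => h e he e' he'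

/-- Each cap is read as the identity tensor that gives the input of a bound name its name back. -/
theorem rep_caps {s : Edge Name → Name} (as : List Name) (hs : ∀ a ∈ as, s ⟨.out, a⟩ = a)
    (hd : DistinctNames ((capEdges as).map (relabel s)))
    (hw : (wires s Edge.name (as.map (Edge.mk .inp)) : Expr S Name).WF) :
    Rep (caps as.length) ((capEdges as).map (relabel s)) []
      (wires s Edge.name (as.map (Edge.mk .inp)) : Expr S Name) := by
  induction as with
  | nil => exact ⟨hd, [], rfl, rfl, rfl, .refl hw⟩
  | cons a as ih =>
    have hd' := distinctNames_append.1
      (show DistinctNames ([_, _] ++ (capEdges as).map (relabel s)) from hd)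
    have hw' := wf_mul.1 hw
    refine ⟨by simpa using hd, [_, _], _, [], [], ident (s ⟨.inp, a⟩) a, _, rfl, rfl,
      ⟨by simpa using hd'.1, s ⟨.inp, a⟩, a, ?_, rfl, .refl hw'.1⟩,
      ih (fun b hb => hs b (.tail _ hb)) hd'.2.1 hw'.2.1, hw, .refl hw⟩
    simp [relabel, hs a (.head _)]

/-- Identity tensors for some of the edges of a renamed expression can be contracted. -/
theorem contract_rename [Infinite Name] (hG : G.WF) {r s u : Edge Name → Name}
    {L : List (Edge Name)} (hr : ∀ e ∈ G.edges, ∀ e' ∈ G.edges, r e = r e' → e = e')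
    (hL : ∀ e ∈ L, e ∈ G.edges) (hd : DistinctNames (L.map (relabel r) ++ L.map (relabel s)))
    (hrs : ∀ e ∈ G.edges, ∀ e' ∈ L, relabel r e ≠ relabel s e')
    (hu : ∀ e ∈ G.edges, e ∉ L → u e = r e) (hu' : ∀ e ∈ L, u e = s e) :
    (mul (G.rename fun p n => r ⟨p, n⟩) (wires r s L)).WF ∧
      Equiv (mul (G.rename fun p n => r ⟨p, n⟩) (wires r s L)) (G.rename fun p n => u ⟨p, n⟩) := by
  have he : (G.rename fun p n => r ⟨p, n⟩).edges = G.edges.map (relabel r) := edges_rename ..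
  have dr := distinctNames_relabel hG.2 hr
  have hw : (mul (G.rename fun p n => r ⟨p, n⟩) (wires r s L)).WF := by
    refine wf_mul.2 ⟨hG.rename fun p n k hn hk h => ?_, wf_wires hd, fun e h h' => ?_⟩
    · exact congrArg Edge.name (hr _ hn _ hk h)
    · rw [he] at h
      rcases mem_edges_wires'.1 h' with h' | h'
      · obtain ⟨f, hf, h'⟩ := List.mem_map.1 h'
        exact dr.flip_notMem h (h' ▸ List.mem_map_of_mem (hL f hf))
      · obtain ⟨f, hf, rfl⟩ := List.mem_map.1 h
        obtain ⟨f', hf', h'⟩ := List.mem_map.1 h'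
        exact hrs f hf f' hf' h'.symm
  obtain ⟨t, ht, ht'⟩ := exists_subst (r := r) (s := s) (l := L) fun e he e' he' h => by
    rw [hr e (hL e he) e' (hL e' he') (congrArg Edge.name h)]
  refine ⟨hw, ?_⟩
  have hut : (G.rename fun p n => u ⟨p, n⟩) = (G.rename fun p n => r ⟨p, n⟩).rename t := by
    rw [rename_rename]
    refine rename_congr fun e h => ?_
    by_cases h' : e ∈ L
    · exact (hu' e h').trans (ht e h').symm
    · refine (hu e h h').trans (ht' _ _ fun f hf h'' => h' ?_).symm
      exact hr e h f (hL f hf) (congrArg Edge.name h'') ▸ hf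
  rw [hut]
  refine Equiv.contract_wires hw (fun e h => ?_) ht fun e _ h => ht' _ _ h
  have h' : (⟨e.pol, r e⟩ : Edge Name) ∈ G.edges.map (relabel r) := List.mem_map_of_mem (hL e h)
  rw [IsFree, he]
  exact ⟨h', dr.flip_notMem h'⟩

/-- After replacing the wires by fresh ones, the atoms, the rewiring, and the layer of identities
and caps are represented by a renamed copy of `G` and two products of identity tensors; contracting
these restores the names of `G`. -/
theorem rep_normalForm [Infinite Name] (hG : G.WF) {m : List (Edge Name)} {as : List Name}
    {σ : Term S} (hm : DistinctNames m) (hmf : ∀ e, e ∈ m ↔ G.IsFree e) (has : as.Nodup)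
    (hb : ∀ a, a ∈ as ↔ G.IsBound a) (hσ : Rewiring G.edges (m ++ capEdges as) σ) :
    Rep (.comp G.base (.comp σ (.tens (.id (m.map Edge.pol)) (caps as.length)))) [] m G := by
  classical
  obtain ⟨r, hr, hrV⟩ := exists_fresh G.edges G.finite_names
  obtain ⟨s₀, hs₀, hsV⟩ := exists_fresh G.edges (V := G.names ∪ r '' {e | e ∈ G.edges})
    (G.finite_names.union (G.edges.finite_toSet.image r))
  -- a bound name keeps its output, so that contracting the other identity tensors restores it
  obtain ⟨s, hs₁, hs₂⟩ : ∃ s : Edge Name → Name, (∀ a ∈ as, s ⟨.out, a⟩ = a) ∧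
      ∀ e, ¬ (e.pol = .out ∧ e.name ∈ as) → s e = s₀ e :=
    ⟨fun e => if e.pol = .out ∧ e.name ∈ as then e.name else s₀ e,
      fun a ha => if_pos ⟨rfl, ha⟩, fun e he => if_neg he⟩
  have hs (e) (he : e ∈ G.edges) : (e.pol = .out ∧ e.name ∈ as ∧ s e = e.name) ∨ s e = s₀ e := by
    by_cases h : e.pol = .out ∧ e.name ∈ as
    · obtain ⟨p, n⟩ := e
      obtain ⟨rfl, h⟩ := h
      exact .inl ⟨rfl, h, hs₁ n h⟩
    · exact .inr (hs₂ e h)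
  have hsV' (e) {n : Name} (hn : n ∈ G.names) : s₀ e ≠ n := fun h => hsV e (.inl (h ▸ hn))
  have hrs : ∀ e ∈ G.edges, ∀ e' ∈ G.edges, r e ≠ s e' := by
    intro e he e' he' h
    rcases hs e' he' with ⟨-, -, h'⟩ | h'
    · exact hrV e (h ▸ h' ▸ mem_names he')
    · exact hsV e' (.inr ⟨e, he, h.trans h'⟩)
  have hsi : ∀ e ∈ G.edges, ∀ e' ∈ G.edges, s e = s e' → e = e' := by
    intro e he e' he' h
    rcases hs e he with ⟨h₁, h₂, h₃⟩ | h₃ <;> rcases hs e' he' with ⟨h₁', h₂', h₃'⟩ | h₃'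
    · obtain ⟨p, n⟩ := e
      obtain ⟨p', n'⟩ := e'
      simp only at h₁ h₁' h₃ h₃'
      rw [h₁, h₁', ← h₃, ← h₃', h]
    · exact (hsV' e' (mem_names he) (h₃'.symm.trans (h.symm.trans h₃))).elim
    · exact (hsV' e (mem_names he') (h₃.symm.trans (h.trans h₃'))).elim
    · exact hs₀ e he e' he' (h₃.symm.trans (h.trans h₃'))
  have hp := hσ.wiring (S := S) |>.perm
  have dr := distinctNames_relabel hG.2 hr
  have ds := distinctNames_relabel hG.2 hsi
  have drs : DistinctNames (G.edges.map (relabel r) ++ (m ++ capEdges as).map (relabel s)) := by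
    refine distinctNames_append.2 ⟨dr, ds.perm (hp.map _), ?_⟩
    simp only [List.forall_mem_map]
    exact fun e he e' he' => hrs e he e' (hp.mem_iff.2 he')
  -- the atoms and the rewiring
  have R₁ : Rep G.base [] (G.edges.map (relabel r)) (G.rename fun p n => r ⟨p, n⟩) := by
    have e : (G.rename fun p n => r ⟨p, n⟩).edges = G.edges.map (relabel r) := edges_rename ..
    have := rep_base ((aritiesMatch_rename (fun p n => r ⟨p, n⟩) G).2 hG.1) (e ▸ dr)
    rwa [base_rename, e] at this
  have R₂ := rep_rewiring hσ drs
  have E₁ : (mul (G.rename fun p n => r ⟨p, n⟩) (wires r s G.edges)).WF ∧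
      Equiv (mul (G.rename fun p n => r ⟨p, n⟩) (wires r s G.edges))
        (G.rename fun p n => s ⟨p, n⟩) := by
    have hp' := hp.symm.map (relabel s) |>.append_left (G.edges.map (relabel r))
    exact contract_rename hG hr (fun _ => id) (drs.perm hp')
      (fun e he e' he' h => hrs e he e' he' (congrArg Edge.name h))
      (fun e he he' => (he' he).elim) fun _ _ => rfl
  have R₁₂ : Rep (.comp G.base σ) [] ((m ++ capEdges as).map (relabel s))
      (G.rename fun p n => s ⟨p, n⟩) :=
    ⟨(distinctNames_append.1 drs).2.1, _, _, _, R₁, R₂, E₁.1, E₁.2.symm⟩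
  -- the identities and the caps
  have hmG (e) (he : e ∈ m) : e ∈ G.edges := ((hmf e).1 he).1
  have haG (a) (ha : a ∈ as) (p) : (⟨p, a⟩ : Edge Name) ∈ G.edges := ((hb a).1 ha).mem p
  let L := m ++ as.map (Edge.mk .inp)
  have hLG (e) (he : e ∈ L) : e ∈ G.edges := by
    rcases List.mem_append.1 he with he | he
    · exact hmG e he
    · obtain ⟨a, ha, rfl⟩ := List.mem_map.1 he
      exact haG a ha _
  have hLs (e) (he : e ∈ L) : s e = s₀ e := by
    refine hs₂ e fun h => ?_
    rcases List.mem_append.1 he with he | he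
    · exact ((hb _).1 h.2).not_isFree e.pol ((hmf e).1 he)
    · obtain ⟨a, ha, rfl⟩ := List.mem_map.1 he
      cases h.1
  have hmL : L.map (relabel Edge.name) = L := List.map_id L
  have dL : DistinctNames L := by
    refine distinctNames_append.2 ⟨hm, by simpa [DistinctNames, Function.comp_def] using has, ?_⟩
    simp only [List.forall_mem_map]
    exact fun e he a ha h => ((hb a).1 ha).not_isFree e.pol (h ▸ (hmf e).1 he)
  have dsL : DistinctNames (L.map (relabel s) ++ L.map (relabel Edge.name)) := by
    refine distinctNames_append.2 ⟨distinctNames_relabel dL.of_map fun e he e' he' =>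
      hsi e (hLG e he) e' (hLG e' he'), hmL.symm ▸ dL, ?_⟩
    simp only [List.forall_mem_map]
    exact fun e he e' he' h => hsV' e (mem_names (hLG e' he')) ((hLs e he).symm.trans h)
  have hsL (e) (he : e ∈ G.edges) (e') (he' : e' ∈ L) (h : s e = e'.name) :
      e.name ∈ as ∧ e.name = e'.name := by
    rcases hs e he with ⟨-, h₁, h₂⟩ | h'
    · exact ⟨h₁, h₂.symm.trans h⟩
    · exact (hsV' e (mem_names (hLG e' he')) (h'.symm.trans h)).elim
  have E₂ : (mul (G.rename fun p n => s ⟨p, n⟩) (wires s Edge.name L)).WF ∧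
      Equiv (mul (G.rename fun p n => s ⟨p, n⟩) (wires s Edge.name L)) G := by
    have := contract_rename hG (L := L) (u := Edge.name) hsi hLG dsL (fun e he e' he' h => ?_)
      (fun e he he' => ?_) (fun _ _ => rfl)
    · rwa [rename_eq_self (r := fun p n => Edge.name ⟨p, n⟩) fun _ _ => rfl] at this
    · have h' := (hsL e he e' he' (congrArg Edge.name h)).2
      have : e = e' := by
        obtain ⟨p, n⟩ := e
        obtain ⟨p', n'⟩ := e'
        rw [show p = p' from congrArg Edge.pol h, show n = n' from h']
      subst this
      exact hsV' e (mem_names he) ((hLs e he').symm.trans (congrArg Edge.name h))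
    · rcases List.mem_append.1 (hp.mem_iff.1 he) with h | h
      · exact (he' (List.mem_append_left _ h)).elim
      · rw [mem_capEdges] at h
        obtain ⟨_ | _, n⟩ := e
        · exact (hs₁ n h).symm
        · exact (he' (List.mem_append_right _ (List.mem_map_of_mem h))).elim
  have hpL : (mul (G.rename fun p n => s ⟨p, n⟩) (wires s Edge.name L)).factors.Perm
      (mul (G.rename fun p n => s ⟨p, n⟩) (mul (wires s Edge.name m)
        (wires s Edge.name (as.map (Edge.mk .inp))))).factors := by
    simp [factors, factors_wires, L]
  have hW' := (wf_mul.1 (wf_of_perm hpL E₂.1)).2.1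
  have hW'' := wf_mul.1 hW'
  have ds' := distinctNames_append.1 (List.map_append ▸ (distinctNames_append.1 drs).2.1 :
    DistinctNames (m.map (relabel s) ++ (capEdges as).map (relabel s)))
  have dsm : DistinctNames (m.map (relabel s) ++ m.map (relabel Edge.name)) := by
    refine List.Nodup.sublist (List.Sublist.map _ ?_) dsL
    exact ((List.sublist_append_left _ _).map _).append ((List.sublist_append_left _ _).map _)
  have hmm : m.map (relabel Edge.name) = m := List.map_id m
  have R₃ : Rep (.tens (.id (m.map Edge.pol)) (caps as.length) : Term S)
      ((m ++ capEdges as).map (relabel s)) m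
      (mul (wires s Edge.name m) (wires s Edge.name (as.map (Edge.mk .inp)))) := by
    refine ⟨?_, m.map (relabel s), (capEdges as).map (relabel s), m, [], _, _, List.map_append,
      (List.append_nil m).symm, ?_, rep_caps as hs₁ ds'.2.1 hW''.2.1, hW', .refl hW'⟩
    · refine distinctNames_append.2 ⟨(distinctNames_append.1 drs).2.1, hm, ?_⟩
      simp only [List.forall_mem_map]
      intro e he e' he' h
      have h' := hsL e (hp.mem_iff.2 he) e' (List.mem_append_left _ he') h
      exact ((hb _).1 h'.1).not_isFree e'.pol (h'.2 ▸ (hmf e').1 he')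
    · have := rep_rewiring (.id (S := S) m) dsm
      rwa [hmm] at this
  exact Rep.of_assoc ⟨hm, _, _, _, R₁₂, R₃, wf_of_perm hpL E₂.1, E₂.2.symm.trans (.of_perm E₂.1 hpL)⟩

end Expr

/-! ### Normal forms and boundaries -/

section Boundary

variable {S : Signature.{u}} {Name : Type v} {x : ℕ ↪ Name} {G H : Expr S Name} {w w' : List Pol}

theorem mem_boundary {e : Edge Name} :
    e ∈ boundary x w ↔ ∃ (i : ℕ) (h : i < w.length), e = ⟨w[i], x i⟩ := by
  simp [boundary, List.mem_mapIdx, eq_comm]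

theorem distinctNames_boundary (x : ℕ ↪ Name) (w : List Pol) :
    Expr.DistinctNames (boundary x w) := by
  have : (boundary x w).map Edge.name = (List.range w.length).map x := by
    apply List.ext_getElem <;> simp [boundary]
  rw [Expr.DistinctNames, this]
  exact List.nodup_range.map x.injective

theorem boundary_injective (h : ∀ e, e ∈ boundary x w ↔ e ∈ boundary x w') : w = w' := by
  have hp : (boundary x w).Perm (boundary x w') :=
    (List.perm_ext_iff_of_nodup (distinctNames_boundary x w).of_map
      (distinctNames_boundary x w').of_map).2 h
  have hl : w.length = w'.length := by simpa [boundary] using hp.length_eq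
  refine List.ext_getElem hl fun i hi hi' => ?_
  obtain ⟨j, hj, h'⟩ := mem_boundary.1 ((h _).1 (mem_boundary.2 ⟨i, hi, rfl⟩))
  obtain rfl := x.injective (congrArg Edge.name h')
  exact congrArg Edge.pol h'

theorem Expr.IsCanonical.exists_boundary (h : G.IsCanonical x) :
    ∃ w, ∀ e, e ∈ boundary x w ↔ G.IsFree e := by
  obtain ⟨N, h₁, h₂⟩ := h
  choose p hp hp' using h₁
  refine ⟨List.ofFn fun i : Fin N => p i i.2, fun e => ?_⟩
  rw [mem_boundary]
  constructor
  · rintro ⟨i, hi, rfl⟩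
    rw [List.length_ofFn] at hi
    simpa using hp i hi
  · intro he
    obtain ⟨i, hi, h⟩ := h₂ e he
    obtain ⟨q, n⟩ := e
    obtain rfl : n = x i := h
    exact ⟨i, by simpa using hi, by simpa using hp' i hi q he⟩

theorem Expr.isCanonical_of_boundary (h : ∀ e, e ∈ boundary x w ↔ G.IsFree e) :
    G.IsCanonical x := by
  refine ⟨w.length, fun i hi => ⟨w[i], (h _).1 (mem_boundary.2 ⟨i, hi, rfl⟩), fun p hp => ?_⟩,
    fun e he => ?_⟩
  · obtain ⟨j, hj, h'⟩ := mem_boundary.1 ((h _).2 hp)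
    obtain rfl := x.injective (congrArg Edge.name h')
    exact congrArg Edge.pol h'
  · obtain ⟨i, hi, rfl⟩ := mem_boundary.1 ((h e).2 he)
    exact ⟨i, hi, rfl⟩

theorem exists_normalForm (hG : G.WF) (h : ∀ e, e ∈ boundary x w ↔ G.IsFree e) :
    Nonempty (NormalForm x G w) := by
  obtain ⟨as, has, hb, hp⟩ := exists_perm_capEdges hG.2 (distinctNames_boundary x w).of_map h
  obtain ⟨σ, hσ⟩ := exists_rewiring (S := S) hp
  exact ⟨⟨as, has, hb, σ, hσ⟩⟩

theorem NormalForm.mem_boundary_iff (d : NormalForm x G w) (hG : G.WF) (e : Edge Name) :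
    e ∈ boundary x w ↔ G.IsFree e := by
  have hp := d.rewiring.wiring.perm
  have hn := (List.nodup_append.1 (hp.nodup_iff.1 hG.2)).2.2
  have he := hp.mem_iff (a := e)
  rw [List.mem_append, mem_capEdges, d.mem_bound] at he
  constructor
  · intro h
    refine (Expr.isFree_or_isBound (he.2 (.inl h))).resolve_right fun h' => ?_
    exact hn e h e (mem_capEdges.2 ((d.mem_bound _).2 h')) rfl
  · intro h
    exact (he.1 h.1).resolve_right fun h' => h'.not_isFree e.pol h

theorem NormalForm.rep [Infinite Name] (d : NormalForm x G w) (hG : G.WF) :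
    Expr.Rep d.term [] (boundary x w) G := by
  have := Expr.rep_normalForm hG (distinctNames_boundary x w) (d.mem_boundary_iff hG)
    d.bound_nodup d.mem_bound d.rewiring
  rwa [map_pol_boundary] at this

/-- Two expressions are equivalent exactly when their normal forms denote the same point. -/
theorem NormalForm.point_eq_iff [Infinite Name] (d : NormalForm x G w) (d' : NormalForm x H w')
    (hG : G.WF) (hH : H.WF) :
    (⟨w, d.point hG⟩ : Σ w, Point S w) = ⟨w', d'.point hH⟩ ↔ Expr.Equiv G H := by
  constructor
  · intro h
    obtain ⟨rfl, h⟩ := Sigma.mk.inj_iff.1 h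
    have e : Eqv [] w d.term d'.term := Quotient.exact (eq_of_heq h)
    exact ((Expr.rep_iff_of_eqv e).1 (d.rep hG)).unique (d'.rep hH)
  · intro e
    obtain rfl : w = w' := boundary_injective fun a =>
      (d.mem_boundary_iff hG a).trans ((e.isFree_iff a).trans (d'.mem_boundary_iff hH a).symm)
    have := (d.rep hG).eqv ((d'.rep hH).congr e.symm)
    rw [map_pol_boundary] at this
    exact congrArg _ (Quotient.sound this)

theorem exists_normalForm_of_point [Infinite Name] (x : ℕ ↪ Name) (p : Point S w) :
    ∃ (G : Expr.CanonExpr S x) (d : NormalForm x G.1 w), d.point G.2.1 = p := by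
  obtain ⟨⟨f, hf⟩, rfl⟩ := Quotient.exists_rep p
  obtain ⟨G, hG⟩ := Expr.exists_rep (Name := Name) hf (A := []) rfl (map_pol_boundary x w)
    (distinctNames_boundary x w)
  have hb (e) : e ∈ boundary x w ↔ G.IsFree e := by simp [hG.isFree_iff]
  obtain ⟨d⟩ := exists_normalForm hG.wf hb
  refine ⟨⟨G, hG.wf, Expr.isCanonical_of_boundary hb⟩, d, ?_⟩
  have := (d.rep hG.wf).eqv hG
  rw [map_pol_boundary] at this
  exact Quotient.sound this

end Boundary

end TensorCC

theorem mainTheorem2 (S : TensorCC.Signature.{u}) {Name : Type v} (x : ℕ ↪ Name) :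
    ∃ Φ : TensorCC.Expr.CanonTensor S x ≃ Σ w : List TensorCC.Pol, TensorCC.Point S w,
      -- every canonically named expression has a normal form
      (∀ G : TensorCC.Expr.CanonExpr S x,
        ∃ w : List TensorCC.Pol, Nonempty (TensorCC.NormalForm x G.1 w)) ∧
      -- whichever normal form is chosen, it denotes the point assigned to the tensor
      (∀ (G : TensorCC.Expr.CanonExpr S x) (w : List TensorCC.Pol)
        (d : TensorCC.NormalForm x G.1 w),
        Φ (Quotient.mk (TensorCC.Expr.canonSetoid S x) G) = ⟨w, d.point G.2.1⟩) ∧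
      -- every point is denoted by a normal form
      (∀ (w : List TensorCC.Pol) (p : TensorCC.Point S w),
        ∃ (G : TensorCC.Expr.CanonExpr S x) (d : TensorCC.NormalForm x G.1 w),
          d.point G.2.1 = p) := by
  have : Infinite Name := .of_injective x x.injective
  have h₁ (G : TensorCC.Expr.CanonExpr S x) :
      ∃ w : List TensorCC.Pol, Nonempty (TensorCC.NormalForm x G.1 w) := by
    obtain ⟨w, hw⟩ := G.2.2.exists_boundary
    exact ⟨w, TensorCC.exists_normalForm G.2.1 hw⟩
  choose w d using h₁
  let φ : TensorCC.Expr.CanonTensor S x → Σ w : List TensorCC.Pol, TensorCC.Point S w :=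
    Quotient.lift (fun G => ⟨w G, (d G).some.point G.2.1⟩)
      fun G H h => ((d G).some.point_eq_iff (d H).some G.2.1 H.2.1).2 h
  have hφ (G : TensorCC.Expr.CanonExpr S x) (w' : List TensorCC.Pol)
      (d' : TensorCC.NormalForm x G.1 w') :
      φ (Quotient.mk (TensorCC.Expr.canonSetoid S x) G) = ⟨w', d'.point G.2.1⟩ :=
    ((d G).some.point_eq_iff d' G.2.1 G.2.1).2 (.refl G.2.1)
  have hφ' : Function.Bijective φ := by
    constructor
    · rintro ⟨G⟩ ⟨H⟩ h
      exact Quotient.sound (((d G).some.point_eq_iff (d H).some G.2.1 H.2.1).1 h)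
    · rintro ⟨w', p⟩
      obtain ⟨G, d', rfl⟩ := TensorCC.exists_normalForm_of_point x p
      exact ⟨Quotient.mk _ G, hφ G w' d'⟩
  exact ⟨Equiv.ofBijective φ hφ', fun G => ⟨w G, d G⟩, hφ,
    fun w p => TensorCC.exists_normalForm_of_point x p⟩
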